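/- Let $\Bbbk$ be a field with $\operatorname{char}\Bbbk\neq 2$ and let $n\ge 0$. Let $E(n)$ be the Hopf algebra over $\Bbbk$ generated by $g,x_1,\dots,x_n$ with relations $g^2=1$, $x_i^2=0$, $gx_i=-x_ig$, $x_ix_j=-x_jx_i$ ($i<j$), with $\Delta(g)=g\otimes g$, $\Delta(x_i)=x_i\otimes g+1\otimes x_i$, $\varepsilon(g)=1$, $\varepsilon(x_i)=0$, $S(g)=g$, $S(x_i)=gx_i$. For $P=\{i_1<\dots<i_s\}\subseteq\{1,\dots,n\}$ put $x_P=x_{i_1}\cdots x_{i_s}$ ($x_\emptyset=1$), and for $F=\{i_{j_1},\dots,i_{j_r}\}\subseteq P$ put $S(F,P)=(j_1+\dots+j_r)-\frac{r(r+1)}2$. Let $(A,\rho)$ be a finite-dimensional right $E(n)$-comodule algebra. Then there are an algebra map $\varphi:A\to A$ with $\varphi^2=\mathrm{Id}_A$ and $\Bbbk$-linear maps $d_1,\dots,d_n:A\to A$ with $d_i(ab)=d_i(a)b+\varphi(a)d_i(b)$, $d_i^2=0$, $\varphi d_i=-d_i\varphi$, $d_id_j=-d_jd_i$, such that, with $d_P=d_{i_1}\cdots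 d_{i_s}$ and $d_\emptyset=\mathrm{Id}_A$, $$\rho(a)=\sum_{j=0,1}\ \sum_{P\subseteq\{1,\dots,n\}}(-1)^{\frac{|P|(|P|+1)}2}\varphi^j(d_P(a))\otimes\frac{x_P+(-1)^{|P|+j}gx_P}2\qquad(a\in A).$$ Fix any such tuple $(\varphi,d_1,\dots,d_n)$. Write $H=E(n)$ and let $(A\otimes H^{op},H,\psi)$ be the cowreath in $\Bbbk$-vector spaces with $\psi(h\otimes a\otimes l)=a_0\otimes l_1\otimes l_2ha_1$, comultiplication $h\mapsto 1\otimes1\otimes h_1\otimes h_2$ and counit $h\mapsto\varepsilon(h)1\otimes1$. For a linear map $B^A:H\otimes H\to A$ let $B(h\otimes h')=B^A(h\otimes h')\otimes 1$. The cowreath is called rt-separable (rth-separable) if for some $B^A$ it is separable (h-separable) via $B$, i.e. $B$ is a normalized Casimir morphism for the coalgebra $(H,\psi)$ in the monoidal category of right transfer morphisms through $A\otimes H^{op}$ (which moreover satisfies the h-coseparability condition $(B\otimes B)(\mathrm{Id}\otimes\Delta\otimes\mathrm{Id})=B(\mathrm{Id}\otimes\varepsilon\otimes\mathrm{Id})$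 in that category). Put $t_{k,Q}=B^A(1\otimes g^kx_Q)$ for $k=0,1$ and $Q\subseteq\{1,\dots,n\}$. For every linear map $B^A:H\otimes H\to A$ the following are equivalent: (i) the cowreath is separable via $B$; (ii) for all $a\in A$ and $h,h',h''\in H$: $a_0B^A(ha_1\otimes h'a_2)=B^A(h\otimes h')a$, $\ B^A(1\otimes h)_0\otimes B^A(1\otimes h)_1=B^A(1\otimes h_1)\otimes h_2$, $\ B^A(h_1h'\otimes h_2h'')=\varepsilon(h)B^A(h'\otimes h'')$, and $B^A(1\otimes1)=1$; (iii) for all $j,k\in\{0,1\}$, all $P,Q\subseteq\{1,\dots,n\}$ and all $a\in A$: $$B^A(1\otimes1)=1,$$ $$B^A(g^jx_P\otimes g^kx_Q)=B^A(1\otimes S(g^jx_P)g^kx_Q),$$ $$\varphi(t_{k,Q})=(-1)^{k+|Q|}t_{k,Q},$$ $$d_P(t_{k,Q})=\begin{cases}(-1)^{S(P,Q)+\frac{|P|(|P|+2k+1)}2}\,t_{k,Q\setminus P}&\text{if }P\subseteq Q,\\0&\text{if }P\not\subseteq Q,\end{cases}$$ $$t_{k,Q}a=\varphi^{|Q|}(a)t_{k,Q}+\delta_{k1}\sum_{\emptyset\neq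 P\subseteq Q^c}(-1)^{\frac{|P|(|P|+3)}2+S(P,P\sqcup Q)}2^{|P|}\,d_P\!\left(\varphi^{|P|+|Q|}(a)\right)t_{k,P\sqcup Q}.$$ Moreover, the following are equivalent: the cowreath is h-separable via $B$; (ii) holds together with $B^A(h\otimes1)B^A(1\otimes h')=B^A(h\otimes h')$ for all $h,h'\in H$; (iii) holds together with $t_{1,\emptyset}^2=1$ and $t_{1,P}=(-1)^{|P|}t_{0,P}t_{1,\emptyset}$ for every $P\subseteq\{1,\dots,n\}$. In particular, the cowreath is rt-separable if and only if some $B^A$ satisfies (iii), and rth-separable if and only if some $B^A$ satisfies (iii) and these two additional equalities. -/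

import Mathlib

open scoped TensorProduct

universe u v w

noncomputable section

/-! ## The Hopf algebras `E(n)` -/

namespace EAlg

/-- The generators of `E(n)`: the element `g` and the elements `x₁, …, xₙ`. -/
inductive Gen (n : ℕ) : Type
  | g : Gen n
  | x : Fin n → Gen n

/-- The defining relations of `E(n)` on the free algebra on `g, x₁, …, xₙ`:
`g² = 1`, `xᵢ² = 0`, `g xᵢ = - xᵢ g`, and `xᵢ xⱼ = - xⱼ xᵢ` for `i < j`. -/
inductive Rel (k : Type u) [Field k] (n : ℕ) :
    FreeAlgebra k (Gen n) → FreeAlgebra k (Gen n) → Prop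
  | g_sq : Rel k n (FreeAlgebra.ι k Gen.g * FreeAlgebra.ι k Gen.g) 1
  | x_sq (i : Fin n) :
      Rel k n (FreeAlgebra.ι k (Gen.x i) * FreeAlgebra.ι k (Gen.x i)) 0
  | g_x (i : Fin n) :
      Rel k n (FreeAlgebra.ι k Gen.g * FreeAlgebra.ι k (Gen.x i))
        (-(FreeAlgebra.ι k (Gen.x i) * FreeAlgebra.ι k Gen.g))
  | x_x (i j : Fin n) (hij : i < j) :
      Rel k n (FreeAlgebra.ι k (Gen.x i) * FreeAlgebra.ι k (Gen.x j))
        (-(FreeAlgebra.ι k (Gen.x j) * FreeAlgebra.ι k (Gen.x i)))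

end EAlg

/-- The algebra `E(n)` over `k`: generators `g, x₁, …, xₙ`, relations `EAlg.Rel`. -/
def EAlg (k : Type u) [Field k] (n : ℕ) : Type u := RingQuot (EAlg.Rel k n)

namespace EAlg

variable (k : Type u) [Field k] (n : ℕ)

instance instRing : Ring (EAlg k n) := inferInstanceAs (Ring (RingQuot (Rel k n)))

instance instAlgebra : Algebra k (EAlg k n) :=
  inferInstanceAs (Algebra k (RingQuot (Rel k n)))

/-- The quotient map from the free algebra. -/
def mk : FreeAlgebra k (Gen n) →ₐ[k] EAlg k n := RingQuot.mkAlgHom k (Rel k n)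

/-- The generator `g` of `E(n)`. -/
def g : EAlg k n := mk k n (FreeAlgebra.ι k Gen.g)

/-- The generator `xᵢ` of `E(n)`. -/
def x (i : Fin n) : EAlg k n := mk k n (FreeAlgebra.ι k (Gen.x i))

theorem g_mul_g : g k n * g k n = 1 := by
  rw [g, ← map_mul, ← map_one (mk k n)]
  exact RingQuot.mkAlgHom_rel k (Rel.g_sq (k := k) (n := n))

theorem x_mul_self (i : Fin n) : x k n i * x k n i = 0 := by
  rw [x, ← map_mul, ← map_zero (mk k n)]
  exact RingQuot.mkAlgHom_rel k (Rel.x_sq (k := k) i)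

theorem g_mul_x (i : Fin n) : g k n * x k n i = -(x k n i * g k n) := by
  rw [g, x, ← map_mul, ← map_mul, ← map_neg]
  exact RingQuot.mkAlgHom_rel k (Rel.g_x (k := k) i)

theorem x_mul_x_of_lt (i j : Fin n) (hij : i < j) :
    x k n i * x k n j = -(x k n j * x k n i) := by
  rw [x, x, ← map_mul, ← map_mul, ← map_neg]
  exact RingQuot.mkAlgHom_rel k (Rel.x_x (k := k) i j hij)

variable {k n}

/-- The universal property of `E(n)`. -/
def lift {B : Type*} [Ring B] [Algebra k B] (a : B) (b : Fin n → B)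
    (ha : a * a = 1) (hb : ∀ i, b i * b i = 0) (hab : ∀ i, a * b i = -(b i * a))
    (hbb : ∀ i j, i < j → b i * b j = -(b j * b i)) : EAlg k n →ₐ[k] B :=
  RingQuot.liftAlgHom k ⟨FreeAlgebra.lift k (fun s => Gen.casesOn s a b), by
    intro p q h
    induction h with
    | g_sq => simpa using ha
    | x_sq i => simpa using hb i
    | g_x i => simpa using hab i
    | x_x i j hij => simpa using hbb i j hij⟩

section lift

variable {B : Type*} [Ring B] [Algebra k B] (a : B) (b : Fin n → B)
  (ha : a * a = 1) (hb : ∀ i, b i * b i = 0) (hab : ∀ i, a * b i = -(b i * a))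
  (hbb : ∀ i j, i < j → b i * b j = -(b j * b i))

@[simp] theorem lift_g : lift (k := k) a b ha hb hab hbb (g k n) = a := by
  unfold lift g mk
  erw [RingQuot.liftAlgHom_mkAlgHom_apply]
  simp

@[simp] theorem lift_x (i : Fin n) : lift (k := k) a b ha hb hab hbb (x k n i) = b i := by
  unfold lift x mk
  erw [RingQuot.liftAlgHom_mkAlgHom_apply]
  simp

end lift

theorem hom_ext {B : Type*} [Semiring B] [Algebra k B] {f h : EAlg k n →ₐ[k] B}
    (hg : f (g k n) = h (g k n)) (hx : ∀ i, f (x k n i) = h (x k n i)) : f = h := by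
  refine RingQuot.ringQuot_ext' (S := k) (s := Rel k n) f h (FreeAlgebra.hom_ext ?_)
  funext s
  cases s with
  | g => exact hg
  | x i => exact hx i

theorem induction {C : EAlg k n → Prop} (hr : ∀ r : k, C (algebraMap k _ r))
    (hg : C (g k n)) (hx : ∀ i, C (x k n i)) (hmul : ∀ a b, C a → C b → C (a * b))
    (hadd : ∀ a b, C a → C b → C (a + b)) (a : EAlg k n) : C a := by
  obtain ⟨p, rfl⟩ := RingQuot.mkAlgHom_surjective k (Rel k n) a
  change C (mk k n p)
  induction p using FreeAlgebra.induction with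
  | grade0 r => rw [AlgHom.commutes]; exact hr r
  | grade1 s =>
    cases s with
    | g => exact hg
    | x i => exact hx i
  | mul a b ha hb => rw [map_mul]; exact hmul _ _ ha hb
  | add a b ha hb => rw [map_add]; exact hadd _ _ ha hb

/-- The comultiplication of `E(n)`: `Δ(g) = g ⊗ g`, `Δ(xᵢ) = xᵢ ⊗ g + 1 ⊗ xᵢ`. -/
def comulHom : EAlg k n →ₐ[k] EAlg k n ⊗[k] EAlg k n :=
  lift (g k n ⊗ₜ g k n) (fun i => x k n i ⊗ₜ g k n + 1 ⊗ₜ x k n i)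
    (by simp [g_mul_g, Algebra.TensorProduct.one_def])
    (fun i => by
      simp [mul_add, add_mul, g_mul_g, x_mul_self, g_mul_x, TensorProduct.tmul_neg])
    (fun i => by
      simp only [mul_add, add_mul, Algebra.TensorProduct.tmul_mul_tmul, g_mul_g, g_mul_x, one_mul,
        mul_one, TensorProduct.neg_tmul, TensorProduct.tmul_neg, neg_add])
    (fun i j hij => by
      simp only [mul_add, add_mul, Algebra.TensorProduct.tmul_mul_tmul, g_mul_g, g_mul_x, one_mul,
        mul_one, x_mul_x_of_lt k n i j hij, TensorProduct.neg_tmul, TensorProduct.tmul_neg]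
      abel)

/-- The counit of `E(n)`: `ε(g) = 1`, `ε(xᵢ) = 0`. -/
def counitHom : EAlg k n →ₐ[k] k :=
  lift 1 (fun _ => 0) (by simp) (by simp) (by simp) (by simp)

@[simp] theorem comulHom_g : comulHom (g k n) = g k n ⊗ₜ[k] g k n := lift_g ..

@[simp] theorem comulHom_x (i : Fin n) :
    comulHom (x k n i) = x k n i ⊗ₜ[k] g k n + 1 ⊗ₜ[k] x k n i := lift_x ..

@[simp] theorem counitHom_g : counitHom (g k n) = 1 := lift_g ..

@[simp] theorem counitHom_x (i : Fin n) : counitHom (x k n i) = 0 := lift_x ..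

instance instBialgebra : Bialgebra k (EAlg k n) :=
  Bialgebra.ofAlgHom comulHom counitHom
    (hom_ext (by simp) (fun i => by
      simp [TensorProduct.add_tmul, TensorProduct.tmul_add, Algebra.TensorProduct.one_def,
        add_assoc]))
    (hom_ext (by simp) (fun i => by simp))
    (hom_ext (by simp) (fun i => by simp))

/-- The antipode of `E(n)` as an algebra map into the opposite algebra:
`S(g) = g`, `S(xᵢ) = g xᵢ`. -/
def antipodeHom : EAlg k n →ₐ[k] (EAlg k n)ᵐᵒᵖ :=
  lift (MulOpposite.op (g k n)) (fun i => MulOpposite.op (g k n * x k n i))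
    (by rw [← MulOpposite.op_mul, g_mul_g, MulOpposite.op_one])
    (fun i => by
      rw [← MulOpposite.op_mul, g_mul_x, neg_mul_neg, mul_assoc, ← mul_assoc (g k n) (x k n i),
        g_mul_x, neg_mul, mul_neg, mul_assoc, g_mul_g, mul_one, x_mul_self, neg_zero,
        MulOpposite.op_zero])
    (fun i => by
      rw [← MulOpposite.op_mul, ← MulOpposite.op_mul, ← MulOpposite.op_neg, g_mul_x, mul_neg,
        ← mul_assoc, g_mul_x, neg_neg])
    (fun i j hij => by
      have key : ∀ i j : Fin n,
          g k n * x k n i * (g k n * x k n j) = -(x k n i * x k n j) := by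
        intro i j
        rw [g_mul_x, neg_mul, mul_assoc, ← mul_assoc (g k n) (g k n), g_mul_g, one_mul]
      rw [← MulOpposite.op_mul, ← MulOpposite.op_mul, ← MulOpposite.op_neg, key, key,
        x_mul_x_of_lt k n i j hij, neg_neg])

/-- The antipode of `E(n)` as a linear map. -/
def antipodeLin : EAlg k n →ₗ[k] EAlg k n :=
  (MulOpposite.opLinearEquiv k).symm.toLinearMap ∘ₗ antipodeHom.toLinearMap

@[simp] theorem antipodeLin_algebraMap (r : k) :
    antipodeLin (algebraMap k (EAlg k n) r) = algebraMap k (EAlg k n) r := by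
  simp only [antipodeLin, LinearMap.comp_apply, AlgHom.toLinearMap_apply, AlgHom.commutes]
  rfl

@[simp] theorem antipodeLin_one : antipodeLin (1 : EAlg k n) = 1 := by
  simpa using antipodeLin_algebraMap (k := k) (n := n) 1

@[simp] theorem antipodeLin_g : antipodeLin (g k n) = g k n := by
  simp [antipodeLin, antipodeHom]

@[simp] theorem antipodeLin_x (i : Fin n) : antipodeLin (x k n i) = g k n * x k n i := by
  simp [antipodeLin, antipodeHom]

@[simp] theorem antipodeLin_mul (a b : EAlg k n) :
    antipodeLin (a * b) = antipodeLin b * antipodeLin a := by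
  simp [antipodeLin]

theorem comul_eq (a : EAlg k n) : Coalgebra.comul (R := k) a = comulHom a := rfl

theorem counit_eq (a : EAlg k n) : Coalgebra.counit (R := k) a = counitHom a := rfl

theorem antipode_left (a : EAlg k n) :
    LinearMap.mul' k (EAlg k n) (antipodeLin.rTensor (EAlg k n) (Coalgebra.comul (R := k) a)) =
      algebraMap k (EAlg k n) (Coalgebra.counit (R := k) a) := by
  induction a using EAlg.induction with
  | hr r =>
    rw [Bialgebra.comul_algebraMap, Bialgebra.counit_algebraMap,
      Algebra.TensorProduct.algebraMap_apply]
    simp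
  | hg => simp [comul_eq, counit_eq, g_mul_g]
  | hx i => simp [comul_eq, counit_eq, g_mul_x, mul_assoc, g_mul_g]
  | hadd a b ha hb => simp only [map_add, ha, hb]
  | hmul a b ha hb =>
    rw [Bialgebra.comul_mul, Bialgebra.counit_mul, (algebraMap k (EAlg k n)).map_mul]
    obtain ⟨s, hs⟩ := TensorProduct.exists_finset (Coalgebra.comul (R := k) a)
    obtain ⟨t, ht⟩ := TensorProduct.exists_finset (Coalgebra.comul (R := k) b)
    have key : LinearMap.mul' k (EAlg k n) (antipodeLin.rTensor (EAlg k n)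
        (Coalgebra.comul (R := k) a * Coalgebra.comul (R := k) b)) =
        ∑ q ∈ t, antipodeLin q.1 * (LinearMap.mul' k (EAlg k n) (antipodeLin.rTensor (EAlg k n)
          (Coalgebra.comul (R := k) a))) * q.2 := by
      rw [hs, ht, Finset.sum_mul_sum, Finset.sum_comm]
      simp only [map_sum, Algebra.TensorProduct.tmul_mul_tmul, LinearMap.rTensor_tmul,
        LinearMap.mul'_apply, antipodeLin_mul, Finset.mul_sum, Finset.sum_mul, mul_assoc]
    rw [key, ha]
    simp only [← Algebra.commutes (Coalgebra.counit (R := k) a) (antipodeLin _), mul_assoc]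
    rw [← Finset.mul_sum]
    congr 1
    rw [← hb, ht]
    simp

theorem antipode_right (a : EAlg k n) :
    LinearMap.mul' k (EAlg k n) (antipodeLin.lTensor (EAlg k n) (Coalgebra.comul (R := k) a)) =
      algebraMap k (EAlg k n) (Coalgebra.counit (R := k) a) := by
  induction a using EAlg.induction with
  | hr r =>
    rw [Bialgebra.comul_algebraMap, Bialgebra.counit_algebraMap,
      Algebra.TensorProduct.algebraMap_apply]
    simp
  | hg => simp [comul_eq, counit_eq, g_mul_g]
  | hx i => simp [comul_eq, counit_eq, g_mul_x]
  | hadd a b ha hb => simp only [map_add, ha, hb]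
  | hmul a b ha hb =>
    rw [Bialgebra.comul_mul, Bialgebra.counit_mul, (algebraMap k (EAlg k n)).map_mul]
    obtain ⟨s, hs⟩ := TensorProduct.exists_finset (Coalgebra.comul (R := k) a)
    obtain ⟨t, ht⟩ := TensorProduct.exists_finset (Coalgebra.comul (R := k) b)
    have key : LinearMap.mul' k (EAlg k n) (antipodeLin.lTensor (EAlg k n)
        (Coalgebra.comul (R := k) a * Coalgebra.comul (R := k) b)) =
        ∑ q ∈ s, q.1 * (LinearMap.mul' k (EAlg k n) (antipodeLin.lTensor (EAlg k n)
          (Coalgebra.comul (R := k) b))) * antipodeLin q.2 := by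
      rw [hs, ht, Finset.sum_mul_sum]
      simp only [map_sum, Algebra.TensorProduct.tmul_mul_tmul, LinearMap.lTensor_tmul,
        LinearMap.mul'_apply, antipodeLin_mul, Finset.mul_sum, Finset.sum_mul, mul_assoc]
    rw [key, hb]
    simp only [mul_assoc, Algebra.commutes (Coalgebra.counit (R := k) b) (antipodeLin _)]
    simp only [← mul_assoc]
    rw [← Finset.sum_mul]
    congr 1
    rw [← ha, hs]
    simp

/-- The Hopf algebra structure of `E(n)`. -/
instance instHopfAlgebra : HopfAlgebra k (EAlg k n) where
  antipode := antipodeLin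
  mul_antipode_rTensor_comul := LinearMap.ext antipode_left
  mul_antipode_lTensor_comul := LinearMap.ext antipode_right

end EAlg

/-! ## Cowreaths in the category of vector spaces -/

namespace Transfer

variable {k : Type u} [Field k] {R : Type v} [Ring R] [Algebra k R]
variable {X Y Z W : Type*} [AddCommGroup X] [Module k X] [AddCommGroup Y] [Module k Y]
  [AddCommGroup Z] [Module k Z] [AddCommGroup W] [Module k W]

/-- `(m ⊗ Id_Z) (Id_R ⊗ f) : R ⊗ Y → R ⊗ Z` for `f : Y → R ⊗ Z`. The composite in the category of
transfer morphisms of `e : X → R ⊗ Y` and `f : Y → R ⊗ Z` is `mulAct f ∘ₗ e`. -/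
def mulAct (f : Y →ₗ[k] R ⊗[k] Z) : R ⊗[k] Y →ₗ[k] R ⊗[k] Z :=
  (LinearMap.mul' k R).rTensor Z ∘ₗ (TensorProduct.assoc k R R Z).symm.toLinearMap ∘ₗ f.lTensor R

/-- `m (Id_R ⊗ f) : R ⊗ Y → R` for `f : Y → R`, the analogue of `mulAct` for morphisms into the
unit object (with `R ⊗ k` identified with `R`). -/
def mulActUnit (f : Y →ₗ[k] R) : R ⊗[k] Y →ₗ[k] R := LinearMap.mul' k R ∘ₗ f.lTensor R

/-- The tensor product `Id_X ⊛ f : X ⊗ Y → R ⊗ (X ⊗ Z)` of the identity of `(X, ψ)` with a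
transfer morphism `f : Y → R ⊗ Z`. -/
def idTensor (ψ : X ⊗[k] R →ₗ[k] R ⊗[k] X) (f : Y →ₗ[k] R ⊗[k] Z) :
    X ⊗[k] Y →ₗ[k] R ⊗[k] (X ⊗[k] Z) :=
  (TensorProduct.assoc k R X Z).toLinearMap ∘ₗ ψ.rTensor Z ∘ₗ
    (TensorProduct.assoc k X R Z).symm.toLinearMap ∘ₗ f.lTensor X

/-- The tensor product `Id_X ⊛ f : X ⊗ Y → R ⊗ X` of the identity of `(X, ψ)` with a transfer
morphism `f : Y → R` into the unit object. -/
def idTensorUnit (ψ : X ⊗[k] R →ₗ[k] R ⊗[k] X) (f : Y →ₗ[k] R) : X ⊗[k] Y →ₗ[k] R ⊗[k] X :=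
  ψ ∘ₗ f.lTensor X

variable (Z) in
/-- The tensor product `f ⊛ Id_Z : X ⊗ Z → R ⊗ (Y ⊗ Z)` of a transfer morphism `f : X → R ⊗ Y`
with the identity of `Z`. -/
def tensorId (f : X →ₗ[k] R ⊗[k] Y) : X ⊗[k] Z →ₗ[k] R ⊗[k] (Y ⊗[k] Z) :=
  (TensorProduct.assoc k R Y Z).toLinearMap ∘ₗ f.rTensor Z

/-- The entwining map `ψ_X ⊙ ψ_Y = (ψ_X ⊗ Id_Y) (Id_X ⊗ ψ_Y)` of the tensor product of the transfer
morphisms `(X, ψ_X)` and `(Y, ψ_Y)`. -/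
def psiTensor (ψX : X ⊗[k] R →ₗ[k] R ⊗[k] X) (ψY : Y ⊗[k] R →ₗ[k] R ⊗[k] Y) :
    (X ⊗[k] Y) ⊗[k] R →ₗ[k] R ⊗[k] (X ⊗[k] Y) :=
  idTensor ψX ψY ∘ₗ (TensorProduct.assoc k X Y R).toLinearMap

end Transfer

open Transfer in
/-- A cowreath `(R, X, ψ)` in the category of `k`-vector spaces: `(X, ψ)` is a right transfer
morphism through the algebra `R`, and `(X, ψ)` is a coalgebra, with comultiplication `δ` and
counit `ε`, in the monoidal category of right transfer morphisms through `R`. -/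
structure Cowreath (k : Type u) [Field k] (R : Type v) [Ring R] [Algebra k R]
    (X : Type w) [AddCommGroup X] [Module k X] where
  /-- The entwining map. -/
  ψ : X ⊗[k] R →ₗ[k] R ⊗[k] X
  /-- The comultiplication. -/
  δ : X →ₗ[k] R ⊗[k] (X ⊗[k] X)
  /-- The counit. -/
  ε : X →ₗ[k] R
  /-- `ψ (Id ⊗ m) = (m ⊗ Id) (Id ⊗ ψ) (ψ ⊗ Id)` -/
  psi_mul : ψ ∘ₗ (LinearMap.mul' k R).lTensor X =
    mulAct ψ ∘ₗ (TensorProduct.assoc k R X R).toLinearMap ∘ₗ ψ.rTensor R ∘ₗ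
      (TensorProduct.assoc k X R R).symm.toLinearMap
  /-- `ψ (Id ⊗ u) = u ⊗ Id` -/
  psi_one : ∀ x : X, ψ (x ⊗ₜ 1) = 1 ⊗ₜ x
  /-- `δ` is a morphism from `(X, ψ)` to `(X, ψ) ⊛ (X, ψ)`. -/
  delta_mor : mulAct (psiTensor ψ ψ) ∘ₗ (TensorProduct.assoc k R (X ⊗[k] X) R).toLinearMap ∘ₗ
    δ.rTensor R = mulAct δ ∘ₗ ψ
  /-- Coassociativity. -/
  coassoc : (TensorProduct.assoc k X X X).toLinearMap.lTensor R ∘ₗ mulAct (tensorId X δ) ∘ₗ δ =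
    mulAct (idTensor ψ δ) ∘ₗ δ
  /-- `ε` is a morphism from `(X, ψ)` to the unit object. -/
  eps_mor : mulActUnit ε ∘ₗ ψ = LinearMap.mul' k R ∘ₗ ε.rTensor R
  /-- The left counit property. -/
  left_counit : mulAct (ε.rTensor X) ∘ₗ δ = TensorProduct.mk k R X 1
  /-- The right counit property. -/
  right_counit : mulAct (idTensorUnit ψ ε) ∘ₗ δ = TensorProduct.mk k R X 1

namespace Cowreath

open Transfer

variable {k : Type u} [Field k] {R : Type v} [Ring R] [Algebra k R]
  {X : Type w} [AddCommGroup X] [Module k X]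

/-- The cowreath `(R, X, ψ)` is separable via `B : X ⊗ X → R`: `B` is a normalized Casimir morphism
for the coalgebra `(X, ψ)` in the category of transfer morphisms through `R`, that is, a morphism
`X ⊛ X → 1` in this category with `(Id ⊛ B) (δ ⊛ Id) = (B ⊛ Id) (Id ⊛ δ)` and `B δ = ε`. -/
structure IsSeparableVia (C : Cowreath k R X) (B : X ⊗[k] X →ₗ[k] R) : Prop where
  mor : mulActUnit B ∘ₗ psiTensor C.ψ C.ψ = LinearMap.mul' k R ∘ₗ B.rTensor R
  casimir : mulAct (idTensorUnit C.ψ B) ∘ₗ (TensorProduct.assoc k X X X).toLinearMap.lTensor R ∘ₗ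
      tensorId X C.δ =
    mulAct (B.rTensor X) ∘ₗ (TensorProduct.assoc k X X X).symm.toLinearMap.lTensor R ∘ₗ
      idTensor C.ψ C.δ
  normalized : mulActUnit B ∘ₗ C.δ = C.ε

/-- The cowreath `(R, X, ψ)` is h-separable via `B : X ⊗ X → R`: it is separable via `B` and
`(B ⊛ B) (Id ⊛ δ ⊛ Id) = B (Id ⊛ ε ⊛ Id)`. -/
structure IsHSeparableVia (C : Cowreath k R X) (B : X ⊗[k] X →ₗ[k] R) : Prop
    extends C.IsSeparableVia B where
  heavy : mulActUnit (LinearMap.mul' k R ∘ₗ TensorProduct.map B B) ∘ₗ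
      ((TensorProduct.assoc k X X (X ⊗[k] X)).symm.toLinearMap ∘ₗ
        (TensorProduct.assoc k X X X).toLinearMap.lTensor X).lTensor R ∘ₗ
      idTensor C.ψ (tensorId X C.δ) =
    mulActUnit B ∘ₗ idTensor C.ψ (C.ε.rTensor X)

end Cowreath

/-! ## Comodule algebras and the associated cowreaths -/

/-- The algebra map `ρ : A → A ⊗ H` makes `A` a right `H`-comodule algebra: it is coassociative
and counital. -/
structure IsComoduleAlgebra {k : Type u} [Field k] {H : Type v} [Ring H] [Bialgebra k H]
    {A : Type w} [Ring A] [Algebra k A] (ρ : A →ₐ[k] A ⊗[k] H) : Prop where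
  coassoc : (TensorProduct.assoc k A H H).toLinearMap ∘ₗ ρ.toLinearMap.rTensor H ∘ₗ ρ.toLinearMap =
    (Coalgebra.comul (R := k) (A := H)).lTensor A ∘ₗ ρ.toLinearMap
  counit : (TensorProduct.rid k A).toLinearMap ∘ₗ (Coalgebra.counit (R := k) (A := H)).lTensor A ∘ₗ
    ρ.toLinearMap = LinearMap.id

namespace HopfCowreath

variable {k : Type u} [Field k] {H : Type v} [Ring H] [HopfAlgebra k H]
  {A : Type w} [Ring A] [Algebra k A]

/-- `(a ⊗ p) ⊗ (l ⊗ q) ↦ (a ⊗ l) ⊗ w(p ⊗ q)` -/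
def shuffle {P Q Z : Type*} [AddCommGroup P] [Module k P] [AddCommGroup Q] [Module k Q]
    [AddCommGroup Z] [Module k Z] (w : P ⊗[k] Q →ₗ[k] Z) :
    (A ⊗[k] P) ⊗[k] (H ⊗[k] Q) →ₗ[k] (A ⊗[k] Hᵐᵒᵖ) ⊗[k] Z :=
  TensorProduct.map (TensorProduct.map LinearMap.id (MulOpposite.opLinearEquiv k).toLinearMap) w ∘ₗ
    (TensorProduct.tensorTensorTensorComm k A P H Q).toLinearMap

@[simp] theorem shuffle_tmul {P Q Z : Type*} [AddCommGroup P] [Module k P] [AddCommGroup Q]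
    [Module k Q] [AddCommGroup Z] [Module k Z] (w : P ⊗[k] Q →ₗ[k] Z) (a : A) (p : P) (l : H)
    (q : Q) : shuffle w ((a ⊗ₜ[k] p) ⊗ₜ[k] (l ⊗ₜ[k] q)) =
      (a ⊗ₜ[k] MulOpposite.op l) ⊗ₜ[k] w (p ⊗ₜ[k] q) := by
  simp [shuffle]

theorem shuffle_add {P Q Z : Type*} [AddCommGroup P] [Module k P] [AddCommGroup Q]
    [Module k Q] [AddCommGroup Z] [Module k Z] (w w' : P ⊗[k] Q →ₗ[k] Z) :
    shuffle (A := A) (H := H) (w + w') = shuffle w + shuffle w' := by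
  simp only [shuffle, TensorProduct.map_add_right, LinearMap.add_comp]

theorem shuffle_smul {P Q Z : Type*} [AddCommGroup P] [Module k P] [AddCommGroup Q]
    [Module k Q] [AddCommGroup Z] [Module k Z] (c : k) (w : P ⊗[k] Q →ₗ[k] Z) :
    shuffle (A := A) (H := H) (c • w) = c • shuffle w := by
  simp only [shuffle, TensorProduct.map_smul_right, LinearMap.smul_comp]

/-- `a ⊗ l ↦ l h a` -/
def sandwich (h : H) : H ⊗[k] H →ₗ[k] H :=
  LinearMap.mul' k H ∘ₗ (LinearMap.mulRight k h).rTensor H ∘ₗ (TensorProduct.comm k H H).toLinearMap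

@[simp] theorem sandwich_tmul (h a l : H) : sandwich h (a ⊗ₜ[k] l) = l * h * a := by
  simp [sandwich]

theorem sandwich_add (h h' : H) :
    sandwich (k := k) (h + h') = sandwich h + sandwich h' := by
  ext a l; simp [mul_add, add_mul]

theorem sandwich_smul (c : k) (h : H) : sandwich (k := k) (c • h) = c • sandwich h := by
  ext a l; simp

/-- `a ⊗ l ↦ (a₀ ⊗ a₁) ⊗ (l₁ ⊗ l₂)` -/
def coact (ρ : A →ₐ[k] A ⊗[k] H) : A ⊗[k] Hᵐᵒᵖ →ₗ[k] (A ⊗[k] H) ⊗[k] (H ⊗[k] H) :=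
  TensorProduct.map ρ.toLinearMap
    ((Coalgebra.comul (R := k) (A := H)) ∘ₗ (MulOpposite.opLinearEquiv k).symm.toLinearMap)

@[simp] theorem coact_tmul (ρ : A →ₐ[k] A ⊗[k] H) (a : A) (l : Hᵐᵒᵖ) :
    coact ρ (a ⊗ₜ[k] l) = ρ a ⊗ₜ[k] Coalgebra.comul (R := k) l.unop := by
  simp [coact]

/-- The entwining map `ψ(h ⊗ a ⊗ l) = a₀ ⊗ l₁ ⊗ l₂ h a₁`. -/
def psi (ρ : A →ₐ[k] A ⊗[k] H) : H ⊗[k] (A ⊗[k] Hᵐᵒᵖ) →ₗ[k] (A ⊗[k] Hᵐᵒᵖ) ⊗[k] H :=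
  TensorProduct.lift (LinearMap.mk₂ k (fun h r => shuffle (sandwich h) (coact ρ r))
    (fun h h' r => by rw [sandwich_add, shuffle_add, LinearMap.add_apply])
    (fun c h r => by rw [sandwich_smul, shuffle_smul, LinearMap.smul_apply])
    (fun h r r' => by rw [map_add, map_add])
    (fun c h r => by rw [map_smul, map_smul]))

theorem psi_tmul (ρ : A →ₐ[k] A ⊗[k] H) (h : H) (a : A) (l : Hᵐᵒᵖ) :
    psi ρ (h ⊗ₜ[k] (a ⊗ₜ[k] l)) =
      shuffle (sandwich h) (ρ a ⊗ₜ[k] Coalgebra.comul (R := k) l.unop) := by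
  simp [psi]

variable (k H A) in
/-- The comultiplication `δ(h) = 1 ⊗ 1 ⊗ h₁ ⊗ h₂`. -/
def delta : H →ₗ[k] (A ⊗[k] Hᵐᵒᵖ) ⊗[k] (H ⊗[k] H) :=
  TensorProduct.mk k (A ⊗[k] Hᵐᵒᵖ) (H ⊗[k] H) 1 ∘ₗ Coalgebra.comul

variable (k H A) in
/-- The counit `ε(h) = ε_H(h) 1 ⊗ 1`. -/
def eps : H →ₗ[k] A ⊗[k] Hᵐᵒᵖ := Algebra.linearMap k (A ⊗[k] Hᵐᵒᵖ) ∘ₗ Coalgebra.counit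

theorem delta_apply (h : H) : delta k H A h = 1 ⊗ₜ[k] Coalgebra.comul (R := k) h := rfl

theorem eps_apply (h : H) :
    eps k H A h = Coalgebra.counit (R := k) h • (1 : A ⊗[k] Hᵐᵒᵖ) := by
  simp [eps, Algebra.algebraMap_eq_smul_one]

section ops

open Transfer

variable {R X Y Z : Type*} [Ring R] [Algebra k R] [AddCommGroup X] [Module k X]
  [AddCommGroup Y] [Module k Y] [AddCommGroup Z] [Module k Z]

/-- `r ⊗ z ↦ s r ⊗ z` -/
def lmul (Z : Type*) [AddCommGroup Z] [Module k Z] (s : R) : R ⊗[k] Z →ₗ[k] R ⊗[k] Z :=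
  (LinearMap.mulLeft k s).rTensor Z

@[simp] theorem lmul_tmul (s r : R) (z : Z) :
    lmul (k := k) Z s (r ⊗ₜ[k] z) = (s * r) ⊗ₜ[k] z := by
  simp [lmul]

@[simp] theorem lmul_one (t : R ⊗[k] Z) : lmul (k := k) Z (1 : R) t = t := by
  simp [lmul, LinearMap.mulLeft_one]

theorem mulAct_tmul (f : Y →ₗ[k] R ⊗[k] Z) (r : R) (y : Y) :
    mulAct f (r ⊗ₜ[k] y) = lmul Z r (f y) := by
  simp only [mulAct, LinearMap.comp_apply, LinearMap.lTensor_tmul, LinearEquiv.coe_coe]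
  induction f y using TensorProduct.induction_on with
  | zero => simp
  | tmul s z => simp
  | add a b ha hb => simp only [TensorProduct.tmul_add, map_add, ha, hb]

theorem mulActUnit_tmul (f : Y →ₗ[k] R) (r : R) (y : Y) :
    mulActUnit f (r ⊗ₜ[k] y) = r * f y := by
  simp [mulActUnit]

end ops

open Transfer

theorem psi_one (ρ : A →ₐ[k] A ⊗[k] H) (h : H) : psi ρ (h ⊗ₜ[k] 1) = 1 ⊗ₜ[k] h := by
  rw [Algebra.TensorProduct.one_def, psi_tmul, map_one, MulOpposite.unop_one, Bialgebra.comul_one,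
    Algebra.TensorProduct.one_def, Algebra.TensorProduct.one_def, shuffle_tmul, sandwich_tmul]
  simp

set_option linter.unusedSimpArgs false in
theorem psi_mul (ρ : A →ₐ[k] A ⊗[k] H) :
    psi ρ ∘ₗ (LinearMap.mul' k (A ⊗[k] Hᵐᵒᵖ)).lTensor H =
      mulAct (psi ρ) ∘ₗ (TensorProduct.assoc k _ H _).toLinearMap ∘ₗ (psi ρ).rTensor _ ∘ₗ
        (TensorProduct.assoc k H _ _).symm.toLinearMap := by
  refine TensorProduct.ext' fun h t => ?_
  induction t using TensorProduct.induction_on with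
  | zero => simp only [TensorProduct.zero_tmul, TensorProduct.tmul_zero, map_zero, zero_mul,
      mul_zero]
  | add a b ha hb => simp only [TensorProduct.tmul_add, map_add, ha, hb]
  | tmul r r' =>
  induction r using TensorProduct.induction_on with
  | zero => simp only [TensorProduct.zero_tmul, TensorProduct.tmul_zero, map_zero, zero_mul,
      mul_zero]
  | add a b ha hb => simp only [TensorProduct.add_tmul, TensorProduct.tmul_add, map_add, ha, hb]
  | tmul a l =>
  induction r' using TensorProduct.induction_on with
  | zero => simp only [TensorProduct.zero_tmul, TensorProduct.tmul_zero, map_zero, zero_mul,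
      mul_zero]
  | add a b ha hb => simp only [TensorProduct.tmul_add, map_add, ha, hb]
  | tmul a' l' =>
  simp only [LinearMap.comp_apply, LinearMap.lTensor_tmul, LinearMap.mul'_apply,
    Algebra.TensorProduct.tmul_mul_tmul, psi_tmul, MulOpposite.unop_mul, Bialgebra.comul_mul,
    map_mul, LinearEquiv.coe_coe, TensorProduct.assoc_symm_tmul, LinearMap.rTensor_tmul]
  have key : ∀ (u : A ⊗[k] H) (v : H ⊗[k] H),
      shuffle (sandwich h) ((u * ρ a') ⊗ₜ[k] (Coalgebra.comul (R := k) l'.unop * v)) =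
        mulAct (psi ρ) (TensorProduct.assoc k _ H _
          (shuffle (sandwich h) (u ⊗ₜ[k] v) ⊗ₜ[k] (a' ⊗ₜ[k] l'))) := by
    intro u v
    induction u using TensorProduct.induction_on with
    | zero => simp only [TensorProduct.zero_tmul, TensorProduct.tmul_zero, map_zero, zero_mul,
      mul_zero]
    | add a b ha hb => simp only [add_mul, TensorProduct.add_tmul, map_add, ha, hb]
    | tmul b p =>
    induction v using TensorProduct.induction_on with
    | zero => simp only [TensorProduct.zero_tmul, TensorProduct.tmul_zero, map_zero, zero_mul,
      mul_zero]
    | add a b ha hb =>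
      simp only [mul_add, TensorProduct.add_tmul, TensorProduct.tmul_add, map_add, ha, hb]
    | tmul m q =>
    rw [shuffle_tmul, TensorProduct.assoc_tmul, mulAct_tmul, psi_tmul]
    generalize ρ a' = u'
    generalize Coalgebra.comul (R := k) l'.unop = v'
    induction u' using TensorProduct.induction_on with
    | zero => simp only [TensorProduct.zero_tmul, TensorProduct.tmul_zero, map_zero, zero_mul,
      mul_zero]
    | add a b ha hb => simp only [mul_add, TensorProduct.add_tmul, map_add, ha, hb]
    | tmul b' p' =>
    induction v' using TensorProduct.induction_on with
    | zero => simp only [TensorProduct.zero_tmul, TensorProduct.tmul_zero, map_zero, zero_mul,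
      mul_zero]
    | add a b ha hb => simp only [add_mul, TensorProduct.tmul_add, map_add, ha, hb]
    | tmul m' q' => simp [mul_assoc]
  exact key _ _

/-- `(a₁ ⊗ a₂) ⊗ (l₁ ⊗ l₂) ↦ l₁ x a₁ ⊗ l₂ y a₂` -/
def sandwich₂ (x y : H) : (H ⊗[k] H) ⊗[k] (H ⊗[k] H) →ₗ[k] H ⊗[k] H :=
  TensorProduct.map (sandwich x) (sandwich y) ∘ₗ
    (TensorProduct.tensorTensorTensorComm k H H H H).toLinearMap

@[simp] theorem sandwich₂_tmul (x y a b l m : H) :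
    sandwich₂ x y ((a ⊗ₜ[k] b) ⊗ₜ[k] (l ⊗ₜ[k] m)) = (l * x * a) ⊗ₜ[k] (m * y * b) := by
  simp [sandwich₂]

set_option linter.unusedSimpArgs false in
theorem idTensor_psi (ρ : A →ₐ[k] A ⊗[k] H) (x y : H) (a : A) (l : Hᵐᵒᵖ) :
    idTensor (psi ρ) (psi ρ) (x ⊗ₜ[k] (y ⊗ₜ[k] (a ⊗ₜ[k] l))) =
      shuffle (sandwich₂ x y)
        (TensorProduct.assoc k A H H (ρ.toLinearMap.rTensor H (ρ a)) ⊗ₜ[k]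
          TensorProduct.assoc k H H H
            ((Coalgebra.comul (R := k)).rTensor H (Coalgebra.comul (R := k) l.unop))) := by
  simp only [idTensor, LinearMap.comp_apply, LinearMap.lTensor_tmul, psi_tmul, LinearEquiv.coe_coe]
  generalize ρ a = u
  generalize Coalgebra.comul (R := k) l.unop = v
  induction u using TensorProduct.induction_on with
  | zero => simp only [TensorProduct.zero_tmul, TensorProduct.tmul_zero, map_zero, zero_mul,
      mul_zero]
  | add a b ha hb => simp only [TensorProduct.add_tmul, TensorProduct.tmul_add, map_add, ha, hb]
  | tmul b p =>
  induction v using TensorProduct.induction_on with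
  | zero => simp only [TensorProduct.zero_tmul, TensorProduct.tmul_zero, map_zero, zero_mul,
      mul_zero]
  | add a b ha hb => simp only [TensorProduct.tmul_add, map_add, ha, hb]
  | tmul m q =>
  rw [shuffle_tmul, TensorProduct.assoc_symm_tmul, LinearMap.rTensor_tmul, LinearMap.rTensor_tmul,
    LinearMap.rTensor_tmul, psi_tmul, MulOpposite.unop_op, AlgHom.toLinearMap_apply]
  generalize ρ b = u'
  generalize Coalgebra.comul (R := k) m = v'
  induction u' using TensorProduct.induction_on with
  | zero => simp only [TensorProduct.zero_tmul, TensorProduct.tmul_zero, map_zero, zero_mul,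
      mul_zero]
  | add a b ha hb => simp only [TensorProduct.add_tmul, map_add, ha, hb]
  | tmul b' p' =>
  induction v' using TensorProduct.induction_on with
  | zero => simp only [TensorProduct.zero_tmul, TensorProduct.tmul_zero, map_zero, zero_mul,
      mul_zero]
  | add a b ha hb => simp only [TensorProduct.add_tmul, TensorProduct.tmul_add, map_add, ha, hb]
  | tmul m' q' => simp

theorem mulAct_delta_shuffle (h : H) (s : Finset (H × H))
    (hs : Coalgebra.comul (R := k) h = ∑ i ∈ s, i.1 ⊗ₜ[k] i.2) (u : A ⊗[k] H) (v : H ⊗[k] H) :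
    mulAct (delta k H A) (shuffle (sandwich h) (u ⊗ₜ[k] v)) =
      ∑ i ∈ s, shuffle (sandwich₂ i.1 i.2) ((Coalgebra.comul (R := k) (A := H)).lTensor A u ⊗ₜ[k]
        (Coalgebra.comul (R := k) (A := H)).lTensor H v) := by
  induction u using TensorProduct.induction_on with
  | zero => simp only [TensorProduct.zero_tmul, map_zero, Finset.sum_const_zero]
  | add a b ha hb => simp only [TensorProduct.add_tmul, map_add, ha, hb, Finset.sum_add_distrib]
  | tmul b p =>
  induction v using TensorProduct.induction_on with
  | zero => simp only [TensorProduct.tmul_zero, map_zero, Finset.sum_const_zero]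
  | add a b ha hb => simp only [TensorProduct.tmul_add, map_add, ha, hb, Finset.sum_add_distrib]
  | tmul m q =>
  simp only [shuffle_tmul, sandwich_tmul, mulAct_tmul, delta_apply, lmul_tmul, mul_one,
    LinearMap.lTensor_tmul, ← TensorProduct.tmul_sum, Bialgebra.comul_mul]
  congr 1
  rw [hs]
  generalize Coalgebra.comul (R := k) p = p'
  generalize Coalgebra.comul (R := k) q = q'
  induction p' using TensorProduct.induction_on with
  | zero => simp only [TensorProduct.zero_tmul, map_zero, Finset.sum_const_zero, mul_zero]
  | add a b ha hb =>
    simp only [TensorProduct.add_tmul, map_add, ← ha, ← hb, Finset.sum_add_distrib, mul_add]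
  | tmul p₁ p₂ =>
  induction q' using TensorProduct.induction_on with
  | zero => simp only [TensorProduct.tmul_zero, map_zero, Finset.sum_const_zero, zero_mul]
  | add a b ha hb =>
    simp only [TensorProduct.tmul_add, map_add, ← ha, ← hb, Finset.sum_add_distrib, add_mul]
  | tmul q₁ q₂ =>
  simp only [sandwich₂_tmul, Finset.mul_sum, Finset.sum_mul, Algebra.TensorProduct.tmul_mul_tmul]

theorem delta_mor (ρ : A →ₐ[k] A ⊗[k] H) (hρ : IsComoduleAlgebra ρ) :
    mulAct (psiTensor (psi ρ) (psi ρ)) ∘ₗ (TensorProduct.assoc k _ (H ⊗[k] H) _).toLinearMap ∘ₗ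
      (delta k H A).rTensor _ = mulAct (delta k H A) ∘ₗ psi ρ := by
  refine TensorProduct.ext' fun h t => ?_
  simp only [LinearMap.comp_apply, LinearMap.rTensor_tmul, delta_apply, LinearEquiv.coe_coe,
    TensorProduct.assoc_tmul, mulAct_tmul, lmul_one]
  induction t using TensorProduct.induction_on with
  | zero => simp only [TensorProduct.tmul_zero, map_zero]
  | add a b ha hb => simp only [TensorProduct.tmul_add, map_add, ha, hb]
  | tmul a l =>
  have h1 : TensorProduct.assoc k A H H (ρ.toLinearMap.rTensor H (ρ a)) =
      (Coalgebra.comul (R := k) (A := H)).lTensor A (ρ a) :=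
    LinearMap.congr_fun hρ.coassoc a
  obtain ⟨s, hs⟩ := TensorProduct.exists_finset (Coalgebra.comul (R := k) h)
  rw [psi_tmul, mulAct_delta_shuffle h s hs, hs, TensorProduct.sum_tmul, map_sum]
  refine Finset.sum_congr rfl fun i _ => ?_
  rw [psiTensor, LinearMap.comp_apply, LinearEquiv.coe_coe, TensorProduct.assoc_tmul,
    idTensor_psi, h1, Coalgebra.coassoc_apply]

theorem tensorId_delta (c : H ⊗[k] H) :
    tensorId H (delta k H A) c = 1 ⊗ₜ[k] (Coalgebra.comul (R := k) (A := H)).rTensor H c := by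
  induction c using TensorProduct.induction_on with
  | zero => simp only [TensorProduct.tmul_zero, map_zero]
  | add a b ha hb => simp only [TensorProduct.tmul_add, map_add, ha, hb]
  | tmul x y =>
  simp only [tensorId, LinearMap.comp_apply, LinearMap.rTensor_tmul, delta_apply,
    LinearEquiv.coe_coe, TensorProduct.assoc_tmul]

theorem idTensor_delta (ρ : A →ₐ[k] A ⊗[k] H) (c : H ⊗[k] H) :
    idTensor (psi ρ) (delta k H A) c =
      1 ⊗ₜ[k] (Coalgebra.comul (R := k) (A := H)).lTensor H c := by
  induction c using TensorProduct.induction_on with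
  | zero => simp only [TensorProduct.tmul_zero, map_zero]
  | add a b ha hb => simp only [TensorProduct.tmul_add, map_add, ha, hb]
  | tmul x y =>
  simp only [idTensor, LinearMap.comp_apply, LinearMap.lTensor_tmul, delta_apply,
    LinearEquiv.coe_coe, TensorProduct.assoc_symm_tmul, LinearMap.rTensor_tmul, psi_one,
    TensorProduct.assoc_tmul]

theorem coassoc (ρ : A →ₐ[k] A ⊗[k] H) :
    (TensorProduct.assoc k H H H).toLinearMap.lTensor (A ⊗[k] Hᵐᵒᵖ) ∘ₗ
      mulAct (tensorId H (delta k H A)) ∘ₗ delta k H A =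
    mulAct (idTensor (psi ρ) (delta k H A)) ∘ₗ delta k H A := by
  refine LinearMap.ext fun h => ?_
  simp only [LinearMap.comp_apply, delta_apply, mulAct_tmul, lmul_one, tensorId_delta,
    idTensor_delta, LinearMap.lTensor_tmul, LinearEquiv.coe_coe, Coalgebra.coassoc_apply]

theorem mulActUnit_eps_shuffle (h : H) (u : A ⊗[k] H) (v : H ⊗[k] H) :
    mulActUnit (eps k H A) (shuffle (sandwich h) (u ⊗ₜ[k] v)) =
      Coalgebra.counit (R := k) h •
        (TensorProduct.rid k A ((Coalgebra.counit (R := k) (A := H)).lTensor A u) ⊗ₜ[k]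
          MulOpposite.op
            (TensorProduct.rid k H ((Coalgebra.counit (R := k) (A := H)).lTensor H v))) := by
  induction u using TensorProduct.induction_on with
  | zero => simp only [TensorProduct.zero_tmul, map_zero, smul_zero]
  | add a b ha hb => simp only [TensorProduct.add_tmul, map_add, ha, hb, smul_add]
  | tmul b p =>
  induction v using TensorProduct.induction_on with
  | zero => simp only [TensorProduct.tmul_zero, map_zero, smul_zero, MulOpposite.op_zero]
  | add a b ha hb =>
    simp only [TensorProduct.tmul_add, map_add, ha, hb, smul_add, MulOpposite.op_add]
  | tmul m q =>
  simp only [shuffle_tmul, sandwich_tmul, mulActUnit_tmul, eps_apply, LinearMap.lTensor_tmul,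
    TensorProduct.rid_tmul, Bialgebra.counit_mul, mul_smul_comm, mul_one, MulOpposite.op_smul,
    TensorProduct.tmul_smul, TensorProduct.smul_tmul', smul_smul]
  congr 1
  congr 1
  ring

theorem eps_mor (ρ : A →ₐ[k] A ⊗[k] H) (hρ : IsComoduleAlgebra ρ) :
    mulActUnit (eps k H A) ∘ₗ psi ρ =
      LinearMap.mul' k (A ⊗[k] Hᵐᵒᵖ) ∘ₗ (eps k H A).rTensor (A ⊗[k] Hᵐᵒᵖ) := by
  refine TensorProduct.ext' fun h t => ?_
  simp only [LinearMap.comp_apply, LinearMap.rTensor_tmul, LinearMap.mul'_apply]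
  induction t using TensorProduct.induction_on with
  | zero => simp only [TensorProduct.tmul_zero, map_zero, mul_zero]
  | add a b ha hb => simp only [TensorProduct.tmul_add, map_add, ha, hb, mul_add]
  | tmul a l =>
  have h1 : TensorProduct.rid k A ((Coalgebra.counit (R := k) (A := H)).lTensor A (ρ a)) = a :=
    LinearMap.congr_fun hρ.counit a
  rw [psi_tmul, mulActUnit_eps_shuffle, h1, Coalgebra.lTensor_counit_comul,
    TensorProduct.rid_tmul, one_smul, MulOpposite.op_unop, eps_apply, smul_mul_assoc, one_mul]

theorem left_counit :
    mulAct ((eps k H A).rTensor H) ∘ₗ delta k H A = TensorProduct.mk k (A ⊗[k] Hᵐᵒᵖ) H 1 := by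
  have key : ∀ c : H ⊗[k] H, (eps k H A).rTensor H c =
      1 ⊗ₜ[k] TensorProduct.lid k H ((Coalgebra.counit (R := k) (A := H)).rTensor H c) := by
    intro c
    induction c using TensorProduct.induction_on with
    | zero => simp only [TensorProduct.tmul_zero, map_zero]
    | add a b ha hb => simp only [TensorProduct.tmul_add, map_add, ha, hb]
    | tmul x y =>
    rw [LinearMap.rTensor_tmul, LinearMap.rTensor_tmul, eps_apply, TensorProduct.lid_tmul,
      TensorProduct.smul_tmul]
  refine LinearMap.ext fun h => ?_
  rw [LinearMap.comp_apply, delta_apply, mulAct_tmul, lmul_one, key,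
    Coalgebra.rTensor_counit_comul, TensorProduct.lid_tmul, one_smul, TensorProduct.mk_apply]

theorem right_counit (ρ : A →ₐ[k] A ⊗[k] H) :
    mulAct (idTensorUnit (psi ρ) (eps k H A)) ∘ₗ delta k H A =
      TensorProduct.mk k (A ⊗[k] Hᵐᵒᵖ) H 1 := by
  have key : ∀ c : H ⊗[k] H, idTensorUnit (psi ρ) (eps k H A) c =
      1 ⊗ₜ[k] TensorProduct.rid k H ((Coalgebra.counit (R := k) (A := H)).lTensor H c) := by
    intro c
    induction c using TensorProduct.induction_on with
    | zero => simp only [TensorProduct.tmul_zero, map_zero]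
    | add a b ha hb => simp only [TensorProduct.tmul_add, map_add, ha, hb]
    | tmul x y =>
    rw [idTensorUnit, LinearMap.comp_apply, LinearMap.lTensor_tmul, LinearMap.lTensor_tmul,
      eps_apply, TensorProduct.rid_tmul, TensorProduct.tmul_smul, map_smul, psi_one,
      TensorProduct.tmul_smul]
  refine LinearMap.ext fun h => ?_
  rw [LinearMap.comp_apply, delta_apply, mulAct_tmul, lmul_one, key,
    Coalgebra.lTensor_counit_comul, TensorProduct.rid_tmul, one_smul, TensorProduct.mk_apply]

end HopfCowreath

/-- The cowreath `(A ⊗ H^op, H, ψ)` of a Hopf algebra `H` and a right `H`-comodule algebra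
`(A, ρ)`: `ψ(h ⊗ a ⊗ l) = a₀ ⊗ l₁ ⊗ l₂ h a₁`, `δ(h) = 1 ⊗ 1 ⊗ h₁ ⊗ h₂` and
`ε(h) = ε_H(h) 1 ⊗ 1`. -/
def hopfCowreath {k : Type u} [Field k] {H : Type v} [Ring H] [HopfAlgebra k H]
    {A : Type w} [Ring A] [Algebra k A] (ρ : A →ₐ[k] A ⊗[k] H) (hρ : IsComoduleAlgebra ρ) :
    Cowreath k (A ⊗[k] Hᵐᵒᵖ) H where
  ψ := HopfCowreath.psi ρ
  δ := HopfCowreath.delta k H A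
  ε := HopfCowreath.eps k H A
  psi_mul := HopfCowreath.psi_mul ρ
  psi_one := HopfCowreath.psi_one ρ
  delta_mor := HopfCowreath.delta_mor ρ hρ
  coassoc := HopfCowreath.coassoc ρ
  eps_mor := HopfCowreath.eps_mor ρ hρ
  left_counit := HopfCowreath.left_counit
  right_counit := HopfCowreath.right_counit ρ

/-! ## Right-trivial separability -/

section RightTrivial

variable {k : Type u} [Field k] {H : Type v} [Ring H] [HopfAlgebra k H]
  {A : Type w} [Ring A] [Algebra k A]

/-- The map `B : H ⊗ H → A ⊗ H^op`, `h ⊗ h' ↦ B^A(h ⊗ h') ⊗ 1`, for `B^A : H ⊗ H → A`. -/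
def rightTrivial (BA : H ⊗[k] H →ₗ[k] A) : H ⊗[k] H →ₗ[k] A ⊗[k] Hᵐᵒᵖ :=
  (TensorProduct.mk k A Hᵐᵒᵖ).flip 1 ∘ₗ BA

/-- The cowreath `(A ⊗ H^op, H, ψ)` is rt-separable: it is separable via a Casimir morphism of the
form `h ⊗ h' ↦ B^A(h ⊗ h') ⊗ 1`. -/
def IsRtSeparable (ρ : A →ₐ[k] A ⊗[k] H) (hρ : IsComoduleAlgebra ρ) : Prop :=
  ∃ BA : H ⊗[k] H →ₗ[k] A, (hopfCowreath ρ hρ).IsSeparableVia (rightTrivial BA)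

/-- The cowreath `(A ⊗ H^op, H, ψ)` is rth-separable: it is h-separable via a Casimir morphism of
the form `h ⊗ h' ↦ B^A(h ⊗ h') ⊗ 1`. -/
def IsRthSeparable (ρ : A →ₐ[k] A ⊗[k] H) (hρ : IsComoduleAlgebra ρ) : Prop :=
  ∃ BA : H ⊗[k] H →ₗ[k] A, (hopfCowreath ρ hρ).IsHSeparableVia (rightTrivial BA)

/-- The conditions on `B^A` which express, in Sweedler notation, that `(A ⊗ H^op, H, ψ)` is
separable via `h ⊗ h' ↦ B^A(h ⊗ h') ⊗ 1`. -/
structure IsRtCasimir (ρ : A →ₐ[k] A ⊗[k] H) (BA : H ⊗[k] H →ₗ[k] A) : Prop where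
  /-- `a₀ B^A(h a₁ ⊗ h' a₂) = B^A(h ⊗ h') a` -/
  balanced : ∀ (a : A) (h h' : H),
    LinearMap.mul' k A
      ((BA ∘ₗ TensorProduct.map (LinearMap.mulLeft k h) (LinearMap.mulLeft k h')).lTensor A
        ((Coalgebra.comul (R := k) (A := H)).lTensor A (ρ a))) = BA (h ⊗ₜ h') * a
  /-- `B^A(1 ⊗ h)₀ ⊗ B^A(1 ⊗ h)₁ = B^A(1 ⊗ h₁) ⊗ h₂` -/
  colinear : ∀ h : H, ρ (BA (1 ⊗ₜ h)) =
    (BA ∘ₗ TensorProduct.mk k H H 1).rTensor H (Coalgebra.comul (R := k) h)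
  /-- `B^A(h₁ h' ⊗ h₂ h'') = ε(h) B^A(h' ⊗ h'')` -/
  invariant : ∀ h h' h'' : H,
    BA (TensorProduct.map (LinearMap.mulRight k h') (LinearMap.mulRight k h'')
      (Coalgebra.comul (R := k) h)) = Coalgebra.counit (R := k) h • BA (h' ⊗ₜ h'')
  /-- `B^A(1 ⊗ 1) = 1` -/
  normalized : BA (1 ⊗ₜ 1) = 1

/-- The conditions on `B^A` which express that `(A ⊗ H^op, H, ψ)` is h-separable via
`h ⊗ h' ↦ B^A(h ⊗ h') ⊗ 1`. -/
structure IsRthCasimir (ρ : A →ₐ[k] A ⊗[k] H) (BA : H ⊗[k] H →ₗ[k] A) : Prop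
    extends IsRtCasimir ρ BA where
  /-- `B^A(h ⊗ 1) B^A(1 ⊗ h') = B^A(h ⊗ h')` -/
  heavy : ∀ h h' : H, BA (h ⊗ₜ 1) * BA (1 ⊗ₜ h') = BA (h ⊗ₜ h')

end RightTrivial

/-! ## `E(n)`-comodule algebras -/

/-- For `F = {i_{j₁}, …, i_{jᵣ}} ⊆ P = {i₁ < … < iₛ}`, the number
`S(F, P) = (j₁ + ⋯ + jᵣ) - r (r + 1) / 2`; here `#{q ∈ P | q ≤ p}` is the position of `p` in `P`.
The subtraction does not truncate, since `r` distinct positions add up to at least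
`1 + 2 + ⋯ + r`. -/
def posSum {n : ℕ} (F P : Finset (Fin n)) : ℕ :=
  (∑ p ∈ F, (P.filter (fun q => q ≤ p)).card) - F.card * (F.card + 1) / 2

namespace EAlg

variable (k : Type u) [Field k] {n : ℕ}

/-- `x_P = x_{i₁} ⋯ x_{iₛ}` for `P = {i₁ < … < iₛ}`. -/
def xProd (P : Finset (Fin n)) : EAlg k n := ((P.sort (· ≤ ·)).map (x k n)).prod

/-- The basis element `g^j x_P` of `E(n)`, with `j = 0, 1`. -/
def gx (j : Fin 2) (P : Finset (Fin n)) : EAlg k n := g k n ^ (j : ℕ) * xProd k P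

end EAlg

section Tuple

variable {k : Type u} [Field k] {n : ℕ} {A : Type v} [Ring A] [Algebra k A]

/-- `d_P = d_{i₁} ∘ ⋯ ∘ d_{iₛ}` for `P = {i₁ < … < iₛ}`; in particular `d_∅ = Id`. -/
def dProd (d : Fin n → A →ₗ[k] A) (P : Finset (Fin n)) : A →ₗ[k] A :=
  ((P.sort (· ≤ ·)).map (fun i => (d i : Module.End k A))).prod

/-- `(φ, d₁, …, dₙ)` is the tuple of maps describing the coaction `ρ : A → A ⊗ E(n)`: `φ` is an
involution of the algebra `A`, the `dᵢ` are `φ`-derivations which square to zero, anticommute with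
`φ` and anticommute with each other, and `ρ` is given by
`ρ(a) = ∑_{j=0,1} ∑_P (-1)^{|P|(|P|+1)/2} φ^j(d_P(a)) ⊗ (x_P + (-1)^{|P|+j} g x_P) / 2`. -/
structure IsCoactionTuple (ρ : A →ₐ[k] A ⊗[k] EAlg k n) (φ : A →ₐ[k] A)
    (d : Fin n → A →ₗ[k] A) : Prop where
  phi_phi : ∀ a, φ (φ a) = a
  d_mul : ∀ i a b, d i (a * b) = d i a * b + φ a * d i b
  d_sq : ∀ i a, d i (d i a) = 0
  phi_d : ∀ i a, φ (d i a) = -d i (φ a)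
  d_d : ∀ i j a, d i (d j a) = -d j (d i a)
  rho_eq : ∀ a, ρ a = ∑ j : Fin 2, ∑ P : Finset (Fin n),
    (-1 : k) ^ (P.card * (P.card + 1) / 2) •
      (φ^[(j : ℕ)] (dProd d P a) ⊗ₜ[k] ((2 : k)⁻¹ •
        (EAlg.xProd k P + (-1 : k) ^ (P.card + (j : ℕ)) • (EAlg.g k n * EAlg.xProd k P))))

/-- `t_{j,Q} = B^A(1 ⊗ g^j x_Q)` -/
def tElem (BA : EAlg k n ⊗[k] EAlg k n →ₗ[k] A) (j : Fin 2) (Q : Finset (Fin n)) : A :=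
  BA (1 ⊗ₜ EAlg.gx k j Q)

/-- The explicit conditions for rt-separability in terms of the tuple `(φ, d₁, …, dₙ)` and the
elements `t_{l,Q} = B^A(1 ⊗ g^l x_Q)`. -/
structure RtConditions (φ : A →ₐ[k] A) (d : Fin n → A →ₗ[k] A)
    (BA : EAlg k n ⊗[k] EAlg k n →ₗ[k] A) : Prop where
  /-- `B^A(1 ⊗ 1) = 1` -/
  one : BA (1 ⊗ₜ 1) = 1
  /-- `B^A(g^j x_P ⊗ g^l x_Q) = B^A(1 ⊗ S(g^j x_P) g^l x_Q)` -/
  antipode : ∀ (j l : Fin 2) (P Q : Finset (Fin n)),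
    BA (EAlg.gx k j P ⊗ₜ EAlg.gx k l Q) =
      BA (1 ⊗ₜ (HopfAlgebra.antipode k (EAlg.gx k j P) * EAlg.gx k l Q))
  /-- `φ(t_{l,Q}) = (-1)^{l+|Q|} t_{l,Q}` -/
  phi : ∀ (l : Fin 2) (Q : Finset (Fin n)),
    φ (tElem BA l Q) = (-1 : k) ^ ((l : ℕ) + Q.card) • tElem BA l Q
  /-- `d_P(t_{l,Q}) = (-1)^{S(P,Q) + |P|(|P|+2l+1)/2} t_{l,Q∖P}` if `P ⊆ Q` -/
  d_of_subset : ∀ (l : Fin 2) (P Q : Finset (Fin n)), P ⊆ Q →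
    dProd d P (tElem BA l Q) =
      (-1 : k) ^ (posSum P Q + P.card * (P.card + 2 * (l : ℕ) + 1) / 2) • tElem BA l (Q \ P)
  /-- `d_P(t_{l,Q}) = 0` if `P ⊈ Q` -/
  d_of_not_subset : ∀ (l : Fin 2) (P Q : Finset (Fin n)), ¬ P ⊆ Q → dProd d P (tElem BA l Q) = 0
  /-- `t_{l,Q} a = φ^{|Q|}(a) t_{l,Q} + δ_{l,1} ∑_{∅ ≠ P ⊆ Qᶜ} (-1)^{|P|(|P|+3)/2 + S(P,P⊔Q)} 2^{|P|}
  d_P(φ^{|P|+|Q|}(a)) t_{l,P⊔Q}` -/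
  comm : ∀ (l : Fin 2) (Q : Finset (Fin n)) (a : A),
    tElem BA l Q * a = φ^[Q.card] a * tElem BA l Q +
      if l = 1 then
        ∑ P ∈ Qᶜ.powerset.filter (fun P => P ≠ ∅),
          ((-1 : k) ^ (P.card * (P.card + 3) / 2 + posSum P (P ∪ Q)) * 2 ^ P.card) •
            (dProd d P (φ^[P.card + Q.card] a) * tElem BA l (P ∪ Q))
      else 0

/-- The additional conditions for rth-separability: `t_{1,∅}² = 1` and
`t_{1,P} = (-1)^{|P|} t_{0,P} t_{1,∅}`. -/
structure RthConditions (BA : EAlg k n ⊗[k] EAlg k n →ₗ[k] A) : Prop where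
  sq : tElem BA 1 ∅ ^ 2 = 1
  t_one : ∀ P : Finset (Fin n), tElem BA 1 P = (-1 : k) ^ P.card • (tElem BA 0 P * tElem BA 1 ∅)

end Tuple

end

/-! Everything is read through the single linear map t(h) = B^A(1 ⊗ h). The argument has three
layers: a reduction valid for every Hopf algebra, a dictionary between coactions of E(n) and tuples
(φ, d₁, …, dₙ), and a sign computation with the right adjoint action of E(n) on itself.

General Hopf algebra. Since B takes values in A ⊗ 1, the cowreath identities can be evaluated. The
morphism condition reads a₀ B^A(l₂ h a₁ ⊗ l₃ h' a₂) ⊗ l₁ = B^A(h ⊗ h') a ⊗ l: taking l = 1 gives the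
balancing condition, taking a = 1 and applying the counit to l gives invariance, and together the
two give it back. The elements x₁ ⊗ x₂ y span H ⊗ H (`ext_comul_mul`), and on them the Casimir
identity is reduced by invariance to colinearity of t. On the same elements invariance is seen to be
equivalent to B^A(h ⊗ h') = t(S(h) h'). If S is surjective, the heavy condition says that t is
multiplicative, and then t(y₁) t(S(y₂)) = ε(y) yields the full h-coseparability identity.

Tuples. Contracting ρ with the character χ (g ↦ -1, xᵢ ↦ 0) and with skew derivations Dᵢ of E(n)
gives φ and dᵢ. Such contractions on A and on E(n) are intertwined by ρ, and ρ is injective, so all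
relations are checked once, on the generators of E(n). The explicit formula for ρ is a dual-basis
expansion of its second leg (`sum_coactFun_smul_coactElem`). Conversely, the formula forces φ and dᵢ
to be these contractions, so any tuple is this one, and colinearity of t means that t commutes with
φ and every dᵢ (`colinear_iff`). Evaluated at g^l x_Q, this gives the formulas for φ(t_{l,Q}) and
d_P(t_{l,Q}).

Balancing. Once B^A(h ⊗ h') = t(S(h) h'), balancing becomes t(y) a = a₀ t(y ◁ a₁) with y ◁ h = S(h₁)
y h₂. For y = x_Q the two terms of y ◁ xᵢ cancel, while for y = g x_Q they agree. This is the origin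
of the factor δ_{l1} 2^{|P|} in the commutation formula (`adjSum_gx_eq`).

h-separability. With a = t(z), balancing and colinearity give t(y) t(z) = t(z₁) t(y ◁ z₂). The two
extra equalities make t multiplicative against g; comparing this rule for y = x_P and y = g x_P then
determines 2 t(x_P) t(xᵢ), and since 2 is invertible t is multiplicative on all generators
(`apply_mul_of_rthConditions`). -/

noncomputable section

/-! ### Separability and h-separability for an arbitrary Hopf algebra -/

namespace HopfCowreath

open Transfer

variable {k : Type u} [Field k] {H : Type v} [Ring H] [HopfAlgebra k H]
  {A : Type w} [Ring A] [Algebra k A]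

/-- `a ⊗ l ↦ ε(l) a` -/
def evalCounit : A ⊗[k] Hᵐᵒᵖ →ₗ[k] A :=
  (TensorProduct.rid k A).toLinearMap ∘ₗ
    (Coalgebra.counit ∘ₗ (MulOpposite.opLinearEquiv k).symm.toLinearMap).lTensor A

@[simp] theorem evalCounit_tmul (a : A) (l : Hᵐᵒᵖ) :
    evalCounit (a ⊗ₜ[k] l) = Coalgebra.counit (R := k) l.unop • a := by
  simp [evalCounit]

theorem rightTrivial_apply (BA : H ⊗[k] H →ₗ[k] A) (t : H ⊗[k] H) :
    rightTrivial BA t = BA t ⊗ₜ 1 := rfl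

/-- The counit on H^op retracts a ↦ a ⊗ 1, because ε(1) = 1. -/
theorem tmul_one_inj {a b : A} (h : a ⊗ₜ[k] (1 : Hᵐᵒᵖ) = b ⊗ₜ[k] (1 : Hᵐᵒᵖ)) : a = b := by
  simpa using congrArg evalCounit h

/-- `a ⊗ (p ⊗ q) ↦ a B(h p ⊗ h' q)` -/
def pairLeft (BA : H ⊗[k] H →ₗ[k] A) (h h' : H) : A ⊗[k] (H ⊗[k] H) →ₗ[k] A :=
  LinearMap.mul' k A ∘ₗ
    (BA ∘ₗ TensorProduct.map (LinearMap.mulLeft k h) (LinearMap.mulLeft k h')).lTensor A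

theorem mulActUnit_shuffle (BA : H ⊗[k] H →ₗ[k] A) (x y m q₁ q₂ : H) (u : A ⊗[k] (H ⊗[k] H)) :
    mulActUnit (rightTrivial BA) (shuffle (sandwich₂ x y) (u ⊗ₜ[k] (m ⊗ₜ[k] (q₁ ⊗ₜ[k] q₂)))) =
      pairLeft BA (q₁ * x) (q₂ * y) u ⊗ₜ[k] MulOpposite.op m := by
  induction u using TensorProduct.induction_on with
  | zero => simp only [TensorProduct.zero_tmul, map_zero]
  | add a b ha hb => simp only [TensorProduct.add_tmul, map_add, ha, hb]
  | tmul b w =>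
  induction w using TensorProduct.induction_on with
  | zero => simp only [TensorProduct.zero_tmul, TensorProduct.tmul_zero, map_zero]
  | add a b ha hb => simp only [TensorProduct.add_tmul, TensorProduct.tmul_add, map_add, ha, hb]
  | tmul p₁ p₂ =>
  simp [pairLeft, mulActUnit_tmul, rightTrivial_apply, mul_assoc]

/-- Coassociativity of ρ and of Δ brings the iterated coaction into the form a₀ ⊗ (a₁ ⊗ a₂) and l₁ ⊗
(l₂ ⊗ l₃), so that the value is a₀ B^A(l₂ x a₁ ⊗ l₃ y a₂) ⊗ l₁. -/
theorem mulActUnit_psiTensor (ρ : A →ₐ[k] A ⊗[k] H) (hρ : IsComoduleAlgebra ρ)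
    (BA : H ⊗[k] H →ₗ[k] A) (x y : H) (a : A) (l : Hᵐᵒᵖ) :
    mulActUnit (rightTrivial BA)
        (psiTensor (psi ρ) (psi ρ) ((x ⊗ₜ[k] y) ⊗ₜ[k] (a ⊗ₜ[k] l))) =
      mulActUnit (rightTrivial BA) (shuffle (sandwich₂ x y)
        ((Coalgebra.comul (R := k) (A := H)).lTensor A (ρ a) ⊗ₜ[k]
          (Coalgebra.comul (R := k) (A := H)).lTensor H (Coalgebra.comul (R := k) l.unop))) := by
  have h1 : TensorProduct.assoc k A H H (ρ.toLinearMap.rTensor H (ρ a)) =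
      (Coalgebra.comul (R := k) (A := H)).lTensor A (ρ a) :=
    LinearMap.congr_fun hρ.coassoc a
  rw [psiTensor, LinearMap.comp_apply, LinearEquiv.coe_coe, TensorProduct.assoc_tmul,
    idTensor_psi, h1, Coalgebra.coassoc_apply]

theorem map_mulRight (c : H ⊗[k] H) (h h' : H) :
    TensorProduct.map (LinearMap.mulRight k h) (LinearMap.mulRight k h') c = c * h ⊗ₜ h' := by
  induction c using TensorProduct.induction_on with
  | zero => simp
  | add a b ha hb => simp only [map_add, ha, hb, add_mul]
  | tmul p q => simp

/-- Balancing pulls a out to the right, leaving B^A(l₂ x ⊗ l₃ y) a ⊗ l₁; invariance then replaces l₂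
⊗ l₃ by ε(l₂), and the counit axiom restores l. -/
theorem mor_of_isRtCasimir {ρ : A →ₐ[k] A ⊗[k] H} (hρ : IsComoduleAlgebra ρ)
    {BA : H ⊗[k] H →ₗ[k] A} (hB : IsRtCasimir ρ BA) :
    mulActUnit (rightTrivial BA) ∘ₗ psiTensor (psi ρ) (psi ρ) =
      LinearMap.mul' k (A ⊗[k] Hᵐᵒᵖ) ∘ₗ (rightTrivial BA).rTensor (A ⊗[k] Hᵐᵒᵖ) := by
  refine TensorProduct.ext_fourfold' fun x y a l => ?_
  rw [LinearMap.comp_apply, mulActUnit_psiTensor ρ hρ, LinearMap.comp_apply,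
    LinearMap.rTensor_tmul, LinearMap.mul'_apply, rightTrivial_apply,
    Algebra.TensorProduct.tmul_mul_tmul, one_mul]
  have key : ∀ c : H ⊗[k] H, mulActUnit (rightTrivial BA) (shuffle (sandwich₂ x y)
      ((Coalgebra.comul (R := k) (A := H)).lTensor A (ρ a) ⊗ₜ[k]
        (Coalgebra.comul (R := k) (A := H)).lTensor H c)) =
      (BA (x ⊗ₜ y) * a) ⊗ₜ MulOpposite.op (TensorProduct.rid k H
        ((Coalgebra.counit (R := k) (A := H)).lTensor H c)) := by
    intro c
    induction c using TensorProduct.induction_on with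
    | zero => simp only [TensorProduct.tmul_zero, map_zero, MulOpposite.op_zero]
    | add a b ha hb =>
      simp only [TensorProduct.tmul_add, map_add, ha, hb, MulOpposite.op_add]
    | tmul m q =>
    have h2 : ∀ w : H ⊗[k] H, mulActUnit (rightTrivial BA) (shuffle (sandwich₂ x y)
        ((Coalgebra.comul (R := k) (A := H)).lTensor A (ρ a) ⊗ₜ[k] (m ⊗ₜ[k] w))) =
        (BA (w * x ⊗ₜ y) * a) ⊗ₜ MulOpposite.op m := by
      intro w
      induction w using TensorProduct.induction_on with
      | zero => simp only [TensorProduct.tmul_zero, map_zero, zero_mul, TensorProduct.zero_tmul]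
      | add a b ha hb =>
        simp only [TensorProduct.tmul_add, map_add, ha, hb, add_mul, TensorProduct.add_tmul]
      | tmul q₁ q₂ =>
      rw [mulActUnit_shuffle]
      rw [Algebra.TensorProduct.tmul_mul_tmul]
      congr 1
      exact hB.balanced a _ _
    rw [LinearMap.lTensor_tmul, h2, ← map_mulRight, hB.invariant, LinearMap.lTensor_tmul,
      TensorProduct.rid_tmul, MulOpposite.op_smul, TensorProduct.tmul_smul, smul_mul_assoc,
      TensorProduct.smul_tmul']
  rw [key, Coalgebra.lTensor_counit_comul, TensorProduct.rid_tmul, one_smul, MulOpposite.op_unop]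

/-- The morphism condition at l = 1, where all legs of Δ(l) are trivial. -/
theorem balanced_of_mor {ρ : A →ₐ[k] A ⊗[k] H} (hρ : IsComoduleAlgebra ρ)
    {BA : H ⊗[k] H →ₗ[k] A}
    (hB : mulActUnit (rightTrivial BA) ∘ₗ psiTensor (psi ρ) (psi ρ) =
      LinearMap.mul' k (A ⊗[k] Hᵐᵒᵖ) ∘ₗ (rightTrivial BA).rTensor (A ⊗[k] Hᵐᵒᵖ))
    (a : A) (h h' : H) :
    LinearMap.mul' k A
      ((BA ∘ₗ TensorProduct.map (LinearMap.mulLeft k h) (LinearMap.mulLeft k h')).lTensor A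
        ((Coalgebra.comul (R := k) (A := H)).lTensor A (ρ a))) = BA (h ⊗ₜ h') * a := by
  have := LinearMap.congr_fun hB ((h ⊗ₜ h') ⊗ₜ (a ⊗ₜ 1))
  rw [LinearMap.comp_apply, mulActUnit_psiTensor ρ hρ, LinearMap.comp_apply,
    LinearMap.rTensor_tmul, LinearMap.mul'_apply, rightTrivial_apply,
    Algebra.TensorProduct.tmul_mul_tmul, one_mul, MulOpposite.unop_one, Bialgebra.comul_one,
    Algebra.TensorProduct.one_def, LinearMap.lTensor_tmul, Bialgebra.comul_one,
    Algebra.TensorProduct.one_def, mulActUnit_shuffle, one_mul, one_mul, MulOpposite.op_one] at this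
  exact tmul_one_inj this

/-- The morphism condition at a = 1, with the counit applied to the remaining leg l₁. -/
theorem invariant_of_mor {ρ : A →ₐ[k] A ⊗[k] H} (hρ : IsComoduleAlgebra ρ)
    {BA : H ⊗[k] H →ₗ[k] A}
    (hB : mulActUnit (rightTrivial BA) ∘ₗ psiTensor (psi ρ) (psi ρ) =
      LinearMap.mul' k (A ⊗[k] Hᵐᵒᵖ) ∘ₗ (rightTrivial BA).rTensor (A ⊗[k] Hᵐᵒᵖ))
    (h x y : H) :
    BA (Coalgebra.comul (R := k) h * x ⊗ₜ y) = Coalgebra.counit (R := k) h • BA (x ⊗ₜ y) := by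
  have := congrArg evalCounit
    (LinearMap.congr_fun hB ((x ⊗ₜ y) ⊗ₜ (1 ⊗ₜ MulOpposite.op h)))
  rw [LinearMap.comp_apply, mulActUnit_psiTensor ρ hρ, LinearMap.comp_apply,
    LinearMap.rTensor_tmul, LinearMap.mul'_apply, rightTrivial_apply,
    Algebra.TensorProduct.tmul_mul_tmul, one_mul, MulOpposite.unop_op, mul_one, evalCounit_tmul,
    MulOpposite.unop_op, map_one, Algebra.TensorProduct.one_def, LinearMap.lTensor_tmul,
    Bialgebra.comul_one, Algebra.TensorProduct.one_def] at this
  rw [← this]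
  have key : ∀ c : H ⊗[k] H, evalCounit (mulActUnit (rightTrivial BA) (shuffle (sandwich₂ x y)
      (((1 : A) ⊗ₜ[k] ((1 : H) ⊗ₜ[k] (1 : H))) ⊗ₜ[k]
        (Coalgebra.comul (R := k) (A := H)).lTensor H c))) =
      BA (Coalgebra.comul (R := k) (TensorProduct.lid k H
        ((Coalgebra.counit (R := k) (A := H)).rTensor H c)) * x ⊗ₜ y) := by
    intro c
    induction c using TensorProduct.induction_on with
    | zero => simp only [TensorProduct.tmul_zero, map_zero, zero_mul]
    | add a b ha hb => simp only [TensorProduct.tmul_add, map_add, ha, hb, add_mul]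
    | tmul m q =>
    rw [LinearMap.lTensor_tmul, LinearMap.rTensor_tmul, TensorProduct.lid_tmul, map_smul]
    generalize Coalgebra.comul (R := k) q = w
    induction w using TensorProduct.induction_on with
    | zero => simp only [TensorProduct.tmul_zero, map_zero, zero_mul, smul_zero]
    | add a b ha hb => simp only [TensorProduct.tmul_add, map_add, ha, hb, add_mul, smul_add]
    | tmul q₁ q₂ =>
    rw [mulActUnit_shuffle]
    simp [pairLeft]
  rw [key, Coalgebra.rTensor_counit_comul, TensorProduct.lid_tmul, one_smul]

/-- `H ⊗ H` is spanned by the elements `x₁ ⊗ x₂ y`. -/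
theorem ext_comul_mul {M : Type*} [AddCommGroup M] [Module k M] {f f' : H ⊗[k] H →ₗ[k] M}
    (h : ∀ x y : H, f (Coalgebra.comul (R := k) x * 1 ⊗ₜ y) =
      f' (Coalgebra.comul (R := k) x * 1 ⊗ₜ y)) : f = f' := by
  refine TensorProduct.ext' fun x y => ?_
  -- The identity used is x ⊗ y = x₁ ⊗ x₂ S(x₃) y; here T(p ⊗ q) = p S(q) y.
  let T : H ⊗[k] H →ₗ[k] H :=
    LinearMap.mulRight k y ∘ₗ LinearMap.mul' k H ∘ₗ (HopfAlgebra.antipode k).lTensor H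
  have h1 : ∀ c : H ⊗[k] H,
      f (T.lTensor H (TensorProduct.assoc k H H H (Coalgebra.comul.rTensor H c))) =
      f' (T.lTensor H (TensorProduct.assoc k H H H (Coalgebra.comul.rTensor H c))) := by
    intro c
    induction c using TensorProduct.induction_on with
    | zero => simp only [map_zero]
    | add a b ha hb => simp only [map_add, ha, hb]
    | tmul p q =>
    have h2 : ∀ w : H ⊗[k] H, T.lTensor H (TensorProduct.assoc k H H H (w ⊗ₜ q)) =
        w * 1 ⊗ₜ (HopfAlgebra.antipode k q * y) := by
      intro w
      induction w using TensorProduct.induction_on with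
      | zero => simp only [TensorProduct.zero_tmul, map_zero, zero_mul]
      | add a b ha hb => simp only [TensorProduct.add_tmul, map_add, ha, hb, add_mul]
      | tmul w₁ w₂ => simp [T, mul_assoc]
    rw [LinearMap.rTensor_tmul, h2, h]
  have h3 : ∀ c : H ⊗[k] H, T.lTensor H (Coalgebra.comul.lTensor H c) =
      TensorProduct.rid k H ((Coalgebra.counit (R := k) (A := H)).lTensor H c) ⊗ₜ y := by
    intro c
    induction c using TensorProduct.induction_on with
    | zero => simp only [map_zero, TensorProduct.zero_tmul]
    | add a b ha hb => simp only [map_add, ha, hb, TensorProduct.add_tmul]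
    | tmul p q =>
    simp only [LinearMap.lTensor_tmul, T, LinearMap.comp_apply,
      HopfAlgebra.mul_antipode_lTensor_comul_apply, LinearMap.mulRight_apply,
      TensorProduct.rid_tmul, Algebra.algebraMap_eq_smul_one, smul_mul_assoc, one_mul,
      TensorProduct.tmul_smul, TensorProduct.smul_tmul']
  have h4 := h1 (Coalgebra.comul x)
  rwa [Coalgebra.coassoc_apply, h3, Coalgebra.lTensor_counit_comul, TensorProduct.rid_tmul,
    one_smul] at h4

/-- `x ⊗ a ↦ a₀ ⊗ x a₁` -/
def coactMul (ρ : A →ₐ[k] A ⊗[k] H) : H ⊗[k] A →ₗ[k] A ⊗[k] H :=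
  (LinearMap.mul' k H).lTensor A ∘ₗ (TensorProduct.leftComm k H A H).toLinearMap ∘ₗ
    ρ.toLinearMap.lTensor H

theorem coactMul_tmul (ρ : A →ₐ[k] A ⊗[k] H) (x : H) (a : A) :
    coactMul ρ (x ⊗ₜ a) = (LinearMap.mulLeft k x).lTensor A (ρ a) := by
  rw [coactMul, LinearMap.comp_apply, LinearMap.comp_apply, LinearMap.lTensor_tmul,
    AlgHom.toLinearMap_apply]
  generalize ρ a = u
  induction u using TensorProduct.induction_on with
  | zero => simp only [TensorProduct.tmul_zero, map_zero]
  | add a b ha hb => simp only [TensorProduct.tmul_add, map_add, ha, hb]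
  | tmul b p => simp

/-- `x ⊗ y ↦ B(x₂ ⊗ y)₀ ⊗ x₁ B(x₂ ⊗ y)₁` -/
def casimirLeft (ρ : A →ₐ[k] A ⊗[k] H) (BA : H ⊗[k] H →ₗ[k] A) : H ⊗[k] H →ₗ[k] A ⊗[k] H :=
  coactMul ρ ∘ₗ BA.lTensor H ∘ₗ (TensorProduct.assoc k H H H).toLinearMap ∘ₗ
    Coalgebra.comul.rTensor H

/-- `x ⊗ y ↦ B(x ⊗ y₁) ⊗ y₂` -/
def casimirRight (BA : H ⊗[k] H →ₗ[k] A) : H ⊗[k] H →ₗ[k] A ⊗[k] H :=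
  BA.rTensor H ∘ₗ (TensorProduct.assoc k H H H).symm.toLinearMap ∘ₗ Coalgebra.comul.lTensor H

theorem casimir_lhs (ρ : A →ₐ[k] A ⊗[k] H) (BA : H ⊗[k] H →ₗ[k] A) :
    mulAct (idTensorUnit (psi ρ) (rightTrivial BA)) ∘ₗ
        (TensorProduct.assoc k H H H).toLinearMap.lTensor (A ⊗[k] Hᵐᵒᵖ) ∘ₗ
          tensorId H (delta k H A) =
      ((TensorProduct.mk k A Hᵐᵒᵖ).flip 1).rTensor H ∘ₗ casimirLeft ρ BA := by
  refine TensorProduct.ext' fun x y => ?_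
  simp only [LinearMap.comp_apply, tensorId_delta, LinearMap.lTensor_tmul, LinearMap.rTensor_tmul,
    mulAct_tmul, lmul_one, casimirLeft, LinearEquiv.coe_coe]
  generalize Coalgebra.comul (R := k) x = c
  induction c using TensorProduct.induction_on with
  | zero => simp only [TensorProduct.zero_tmul, map_zero]
  | add a b ha hb => simp only [TensorProduct.add_tmul, map_add, ha, hb]
  | tmul p q =>
  simp only [TensorProduct.assoc_tmul, idTensorUnit, LinearMap.comp_apply, LinearMap.lTensor_tmul,
    rightTrivial_apply, psi_tmul, coactMul_tmul, MulOpposite.unop_one, Bialgebra.comul_one]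
  generalize ρ (BA (q ⊗ₜ y)) = u
  rw [Algebra.TensorProduct.one_def]
  induction u using TensorProduct.induction_on with
  | zero => simp only [TensorProduct.zero_tmul, map_zero]
  | add a b ha hb => simp only [TensorProduct.add_tmul, map_add, ha, hb]
  | tmul b r => simp

theorem casimir_rhs (ρ : A →ₐ[k] A ⊗[k] H) (BA : H ⊗[k] H →ₗ[k] A) :
    mulAct ((rightTrivial BA).rTensor H) ∘ₗ
        (TensorProduct.assoc k H H H).symm.toLinearMap.lTensor (A ⊗[k] Hᵐᵒᵖ) ∘ₗ
          idTensor (psi ρ) (delta k H A) =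
      ((TensorProduct.mk k A Hᵐᵒᵖ).flip 1).rTensor H ∘ₗ casimirRight BA := by
  refine TensorProduct.ext' fun x y => ?_
  simp only [LinearMap.comp_apply, idTensor_delta, LinearMap.lTensor_tmul,
    mulAct_tmul, lmul_one, casimirRight, LinearEquiv.coe_coe, rightTrivial,
    LinearMap.rTensor_comp]

/-- Both sides of the Casimir identity have trivial H^op leg, since B lands in A ⊗ 1 and Δ(1) = 1 ⊗
1; the counit on that leg removes it without loss. -/
theorem casimir_iff (ρ : A →ₐ[k] A ⊗[k] H) (BA : H ⊗[k] H →ₗ[k] A) :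
    (mulAct (idTensorUnit (psi ρ) (rightTrivial BA)) ∘ₗ
        (TensorProduct.assoc k H H H).toLinearMap.lTensor (A ⊗[k] Hᵐᵒᵖ) ∘ₗ
          tensorId H (delta k H A) =
      mulAct ((rightTrivial BA).rTensor H) ∘ₗ
        (TensorProduct.assoc k H H H).symm.toLinearMap.lTensor (A ⊗[k] Hᵐᵒᵖ) ∘ₗ
          idTensor (psi ρ) (delta k H A)) ↔ casimirLeft ρ BA = casimirRight BA := by
  rw [casimir_lhs, casimir_rhs]
  refine ⟨fun h => ?_, fun h => by rw [h]⟩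
  have h1 : (evalCounit (k := k) (H := H) (A := A)) ∘ₗ (TensorProduct.mk k A Hᵐᵒᵖ).flip 1 =
      LinearMap.id := LinearMap.ext fun a => by simp
  have h2 := congrArg (fun f => (evalCounit (k := k) (H := H) (A := A)).rTensor H ∘ₗ f) h
  simpa only [← LinearMap.comp_assoc, ← LinearMap.rTensor_comp, h1, LinearMap.rTensor_id,
    LinearMap.id_comp] using h2

/-- The Casimir identity with first argument 1. -/
theorem colinear_of_casimir {ρ : A →ₐ[k] A ⊗[k] H} {BA : H ⊗[k] H →ₗ[k] A}
    (h : casimirLeft ρ BA = casimirRight BA) (y : H) : ρ (BA (1 ⊗ₜ y)) =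
      (BA ∘ₗ TensorProduct.mk k H H 1).rTensor H (Coalgebra.comul (R := k) y) := by
  have h1 := LinearMap.congr_fun h (1 ⊗ₜ y)
  simp only [casimirLeft, casimirRight, LinearMap.comp_apply, LinearMap.rTensor_tmul,
    LinearMap.lTensor_tmul, Bialgebra.comul_one, Algebra.TensorProduct.one_def,
    LinearEquiv.coe_coe, TensorProduct.assoc_tmul, coactMul_tmul, LinearMap.mulLeft_one,
    LinearMap.lTensor_id, LinearMap.id_apply] at h1
  rw [h1]
  generalize Coalgebra.comul (R := k) y = c
  induction c using TensorProduct.induction_on with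
  | zero => simp only [TensorProduct.tmul_zero, map_zero]
  | add a b ha hb => simp only [TensorProduct.tmul_add, map_add, ha, hb]
  | tmul p q => simp

/-- It suffices to compare on x₁ ⊗ x₂ y. There invariance turns the left side into B^A(1 ⊗ y)₀ ⊗ x
B^A(1 ⊗ y)₁ and the right side into B^A(1 ⊗ y₁) ⊗ x y₂; these agree by colinearity. -/
theorem casimir_of_isRtCasimir {ρ : A →ₐ[k] A ⊗[k] H} {BA : H ⊗[k] H →ₗ[k] A}
    (hB : IsRtCasimir ρ BA) : casimirLeft ρ BA = casimirRight BA := by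
  have inv : ∀ h h' h'' : H, BA (Coalgebra.comul (R := k) h * h' ⊗ₜ h'') =
      Coalgebra.counit (R := k) h • BA (h' ⊗ₜ h'') := by
    intro h h' h''
    rw [← map_mulRight, hB.invariant]
  refine ext_comul_mul fun x y => ?_
  -- The arguments of B^A are x₂ ⊗ x₃ y, with x₁ outside; invariance contracts x₂ ⊗ x₃.
  have hl : casimirLeft ρ BA (Coalgebra.comul (R := k) x * 1 ⊗ₜ y) =
      coactMul ρ (x ⊗ₜ BA (1 ⊗ₜ y)) := by
    have h1 : ∀ c : H ⊗[k] H, casimirLeft ρ BA (c * 1 ⊗ₜ y) =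
        coactMul ρ ((BA ∘ₗ LinearMap.mulRight k (1 ⊗ₜ y)).lTensor H
          (TensorProduct.assoc k H H H (Coalgebra.comul.rTensor H c))) := by
      intro c
      induction c using TensorProduct.induction_on with
      | zero => simp only [zero_mul, map_zero]
      | add a b ha hb => simp only [add_mul, map_add, ha, hb]
      | tmul p q =>
      simp only [casimirLeft, LinearMap.comp_apply, Algebra.TensorProduct.tmul_mul_tmul, mul_one,
        LinearMap.rTensor_tmul, LinearEquiv.coe_coe]
      generalize Coalgebra.comul (R := k) p = w
      induction w using TensorProduct.induction_on with
      | zero => simp only [TensorProduct.zero_tmul, map_zero]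
      | add a b ha hb => simp only [TensorProduct.add_tmul, map_add, ha, hb]
      | tmul w₁ w₂ => simp
    have h2 : ∀ c : H ⊗[k] H, (BA ∘ₗ LinearMap.mulRight k (1 ⊗ₜ y)).lTensor H
        (Coalgebra.comul.lTensor H c) =
        TensorProduct.rid k H ((Coalgebra.counit (R := k) (A := H)).lTensor H c) ⊗ₜ
          BA (1 ⊗ₜ y) := by
      intro c
      induction c using TensorProduct.induction_on with
      | zero => simp only [map_zero, TensorProduct.zero_tmul]
      | add a b ha hb => simp only [map_add, ha, hb, TensorProduct.add_tmul]
      | tmul p q =>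
      simp only [LinearMap.lTensor_tmul, LinearMap.comp_apply, LinearMap.mulRight_apply, inv,
        TensorProduct.rid_tmul, TensorProduct.tmul_smul, TensorProduct.smul_tmul']
    rw [h1, Coalgebra.coassoc_apply, h2, Coalgebra.lTensor_counit_comul, TensorProduct.rid_tmul,
      one_smul]
  -- Now the arguments of B^A are x₁ ⊗ x₂ y₁, with x₃ y₂ outside; invariance contracts x₁ ⊗ x₂.
  have hr : casimirRight BA (Coalgebra.comul (R := k) x * 1 ⊗ₜ y) =
      coactMul ρ (x ⊗ₜ BA (1 ⊗ₜ y)) := by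
    have h1 : ∀ c : H ⊗[k] H, casimirRight BA (c * 1 ⊗ₜ y) =
        BA.rTensor H ((TensorProduct.assoc k H H H).symm
          ((LinearMap.mulRight k (Coalgebra.comul (R := k) y)).lTensor H
            (Coalgebra.comul.lTensor H c))) := by
      intro c
      induction c using TensorProduct.induction_on with
      | zero => simp only [zero_mul, map_zero]
      | add a b ha hb => simp only [add_mul, map_add, ha, hb]
      | tmul p q => simp [casimirRight]
    have h2 : ∀ c d : H ⊗[k] H, BA.rTensor H ((TensorProduct.assoc k H H H).symm
          ((LinearMap.mulRight k d).lTensor H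
            (TensorProduct.assoc k H H H (Coalgebra.comul.rTensor H c)))) =
        (LinearMap.mulLeft k (TensorProduct.lid k H
          ((Coalgebra.counit (R := k) (A := H)).rTensor H c))).lTensor A
          ((BA ∘ₗ TensorProduct.mk k H H 1).rTensor H d) := by
      intro c d
      induction d using TensorProduct.induction_on with
      | zero =>
        simp only [map_zero, LinearMap.mulRight_zero_eq_zero, LinearMap.lTensor_zero,
          LinearMap.zero_apply]
      | add d₁ d₂ h₁ h₂ =>
        have : LinearMap.mulRight k (d₁ + d₂) = LinearMap.mulRight k d₁ + LinearMap.mulRight k d₂ :=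
          LinearMap.ext fun z => by simp [mul_add]
        simp only [this, LinearMap.lTensor_add, LinearMap.add_apply, map_add, h₁, h₂]
      | tmul d₁ d₂ =>
      induction c using TensorProduct.induction_on with
      | zero =>
        simp only [map_zero, LinearMap.mulLeft_zero_eq_zero, LinearMap.lTensor_zero,
          LinearMap.zero_apply]
      | add c₁ c₂ h₁ h₂ =>
        simp only [map_add, h₁, h₂, LinearMap.rTensor_tmul, LinearMap.lTensor_tmul,
          LinearMap.mulLeft_apply, add_mul, TensorProduct.tmul_add]
      | tmul p q =>
      have h3 : ∀ w : H ⊗[k] H, BA.rTensor H ((TensorProduct.assoc k H H H).symm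
          ((LinearMap.mulRight k (d₁ ⊗ₜ d₂)).lTensor H (TensorProduct.assoc k H H H (w ⊗ₜ q)))) =
          BA (w * 1 ⊗ₜ d₁) ⊗ₜ (q * d₂) := by
        intro w
        induction w using TensorProduct.induction_on with
        | zero => simp only [TensorProduct.zero_tmul, map_zero, zero_mul]
        | add a b ha hb => simp only [TensorProduct.add_tmul, map_add, ha, hb, add_mul]
        | tmul w₁ w₂ => simp
      rw [LinearMap.rTensor_tmul, h3, inv]
      simp [TensorProduct.smul_tmul']
    rw [h1, ← Coalgebra.coassoc_apply, h2, Coalgebra.rTensor_counit_comul, TensorProduct.lid_tmul,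
      one_smul, coactMul_tmul, hB.colinear]
  rw [hl, hr]

theorem isSeparableVia_iff_isRtCasimir {ρ : A →ₐ[k] A ⊗[k] H} (hρ : IsComoduleAlgebra ρ)
    (BA : H ⊗[k] H →ₗ[k] A) :
    (hopfCowreath ρ hρ).IsSeparableVia (rightTrivial BA) ↔ IsRtCasimir ρ BA := by
  constructor
  · intro h
    refine ⟨balanced_of_mor hρ h.mor, colinear_of_casimir ((casimir_iff ρ BA).1 h.casimir),
      fun x y z => ?_, ?_⟩
    · rw [map_mulRight, invariant_of_mor hρ h.mor]
    · have h1 := LinearMap.congr_fun h.normalized (1 : H)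
      simp only [hopfCowreath, LinearMap.comp_apply, delta_apply, eps_apply, mulActUnit_tmul,
        Bialgebra.comul_one, Bialgebra.counit_one, one_smul, rightTrivial_apply, one_mul] at h1
      exact tmul_one_inj (k := k) (H := H) h1
  · intro h
    refine ⟨mor_of_isRtCasimir hρ h, (casimir_iff ρ BA).2 (casimir_of_isRtCasimir h), ?_⟩
    refine LinearMap.ext fun x => ?_
    -- Normalization B δ = ε at a general element follows from B^A(1 ⊗ 1) = 1 by invariance.
    have h1 := h.invariant x 1 1
    rw [map_mulRight, ← Algebra.TensorProduct.one_def, mul_one, Algebra.TensorProduct.one_def,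
      h.normalized] at h1
    simp only [hopfCowreath, LinearMap.comp_apply, delta_apply, eps_apply, mulActUnit_tmul,
      rightTrivial_apply, one_mul, h1]
    rw [← TensorProduct.smul_tmul', Algebra.TensorProduct.one_def]

/-- On the spanning elements x₁ ⊗ x₂ y the left side is ε(x) B^A(1 ⊗ y) by invariance, and so is the
right side because S(x₁) x₂ = ε(x). Hence B^A is determined by its values on 1 ⊗ H. -/
theorem apply_tmul_eq_antipode {BA : H ⊗[k] H →ₗ[k] A}
    (hB : ∀ h h' h'' : H, BA (TensorProduct.map (LinearMap.mulRight k h') (LinearMap.mulRight k h'')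
      (Coalgebra.comul (R := k) h)) = Coalgebra.counit (R := k) h • BA (h' ⊗ₜ h'')) (h h' : H) :
    BA (h ⊗ₜ h') = BA (1 ⊗ₜ (HopfAlgebra.antipode k h * h')) := by
  let T : H ⊗[k] H →ₗ[k] A := BA ∘ₗ TensorProduct.mk k H H 1 ∘ₗ LinearMap.mul' k H ∘ₗ
    (HopfAlgebra.antipode k).rTensor H
  have h1 : BA = T := by
    refine ext_comul_mul fun x y => ?_
    have h2 : ∀ c : H ⊗[k] H, T (c * 1 ⊗ₜ y) = BA (1 ⊗ₜ
        (LinearMap.mul' k H ((HopfAlgebra.antipode k).rTensor H c) * y)) := by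
      intro c
      induction c using TensorProduct.induction_on with
      | zero => simp only [zero_mul, map_zero, TensorProduct.tmul_zero]
      | add a b ha hb => simp only [add_mul, map_add, ha, hb, TensorProduct.tmul_add]
      | tmul p q => simp [T, mul_assoc]
    rw [← map_mulRight, hB, map_mulRight, h2, HopfAlgebra.mul_antipode_rTensor_comul_apply,
      Algebra.algebraMap_eq_smul_one, smul_mul_assoc, one_mul, TensorProduct.tmul_smul, map_smul]
  conv_lhs => rw [h1]
  simp [T]

/-- The heaviness condition, evaluated. -/
theorem heavy_iff (ρ : A →ₐ[k] A ⊗[k] H) (BA : H ⊗[k] H →ₗ[k] A) :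
    (mulActUnit (LinearMap.mul' k (A ⊗[k] Hᵐᵒᵖ) ∘ₗ
          TensorProduct.map (rightTrivial BA) (rightTrivial BA)) ∘ₗ
        ((TensorProduct.assoc k H H (H ⊗[k] H)).symm.toLinearMap ∘ₗ
          (TensorProduct.assoc k H H H).toLinearMap.lTensor H).lTensor (A ⊗[k] Hᵐᵒᵖ) ∘ₗ
        idTensor (psi ρ) (tensorId H (delta k H A)) =
      mulActUnit (rightTrivial BA) ∘ₗ idTensor (psi ρ) ((eps k H A).rTensor H)) ↔
    ∀ x y z : H, LinearMap.mul' k A (TensorProduct.map (BA ∘ₗ TensorProduct.mk k H H x)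
        (BA ∘ₗ (TensorProduct.mk k H H).flip z) (Coalgebra.comul (R := k) y)) =
      Coalgebra.counit (R := k) y • BA (x ⊗ₜ z) := by
  have hl : ∀ x y z : H, (mulActUnit (LinearMap.mul' k (A ⊗[k] Hᵐᵒᵖ) ∘ₗ
          TensorProduct.map (rightTrivial BA) (rightTrivial BA)) ∘ₗ
        ((TensorProduct.assoc k H H (H ⊗[k] H)).symm.toLinearMap ∘ₗ
          (TensorProduct.assoc k H H H).toLinearMap.lTensor H).lTensor (A ⊗[k] Hᵐᵒᵖ) ∘ₗ
        idTensor (psi ρ) (tensorId H (delta k H A))) (x ⊗ₜ (y ⊗ₜ z)) =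
      LinearMap.mul' k A (TensorProduct.map (BA ∘ₗ TensorProduct.mk k H H x)
        (BA ∘ₗ (TensorProduct.mk k H H).flip z) (Coalgebra.comul (R := k) y)) ⊗ₜ 1 := by
    intro x y z
    simp only [LinearMap.comp_apply, idTensor, LinearMap.lTensor_tmul, tensorId_delta,
      LinearMap.rTensor_tmul, LinearEquiv.coe_coe, TensorProduct.assoc_symm_tmul, psi_one,
      TensorProduct.assoc_tmul, mulActUnit_tmul, one_mul]
    generalize Coalgebra.comul (R := k) y = c
    induction c using TensorProduct.induction_on with
    | zero => simp only [TensorProduct.zero_tmul, TensorProduct.tmul_zero, map_zero]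
    | add a b ha hb => simp only [TensorProduct.add_tmul, TensorProduct.tmul_add, map_add, ha, hb]
    | tmul p q => simp [rightTrivial_apply]
  have hr : ∀ x y z : H, (mulActUnit (rightTrivial BA) ∘ₗ
      idTensor (psi ρ) ((eps k H A).rTensor H)) (x ⊗ₜ (y ⊗ₜ z)) =
      (Coalgebra.counit (R := k) y • BA (x ⊗ₜ z)) ⊗ₜ 1 := by
    intro x y z
    simp only [LinearMap.comp_apply, idTensor, LinearMap.lTensor_tmul, LinearMap.rTensor_tmul,
      eps_apply, LinearEquiv.coe_coe, TensorProduct.assoc_symm_tmul, TensorProduct.tmul_smul,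
      map_smul, ← TensorProduct.smul_tmul', psi_one, TensorProduct.assoc_tmul, mulActUnit_tmul,
      one_mul, rightTrivial_apply]
  constructor
  · intro h x y z
    have := LinearMap.congr_fun h (x ⊗ₜ (y ⊗ₜ z))
    rw [hl, hr] at this
    exact tmul_one_inj this
  · intro h
    refine TensorProduct.ext' fun x t => ?_
    induction t using TensorProduct.induction_on with
    | zero => simp only [TensorProduct.tmul_zero, map_zero]
    | add a b ha hb => simp only [TensorProduct.tmul_add, map_add, ha, hb]
    | tmul y z => rw [hl, hr, h]

/-- The evaluated condition B^A(x ⊗ y₁) B^A(y₂ ⊗ z) = ε(y) B^A(x ⊗ z) at y = 1 is the heavy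
condition. For the converse, B^A(x ⊗ y₁) B^A(y₂ ⊗ z) = B^A(x ⊗ 1) t(y₁) t(S(y₂)) t(z) for t(h) =
B^A(1 ⊗ h), and multiplicativity of t collapses the middle to ε(y). -/
theorem isHSeparableVia_iff_isRthCasimir {ρ : A →ₐ[k] A ⊗[k] H} (hρ : IsComoduleAlgebra ρ)
    (hS : Function.Surjective (HopfAlgebra.antipode k (A := H))) (BA : H ⊗[k] H →ₗ[k] A) :
    (hopfCowreath ρ hρ).IsHSeparableVia (rightTrivial BA) ↔ IsRthCasimir ρ BA := by
  constructor
  · intro h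
    refine ⟨(isSeparableVia_iff_isRtCasimir hρ BA).1 h.toIsSeparableVia, fun x z => ?_⟩
    simpa [Algebra.TensorProduct.one_def] using (heavy_iff ρ BA).1 h.heavy x 1 z
  · intro h
    refine ⟨(isSeparableVia_iff_isRtCasimir hρ BA).2 h.toIsRtCasimir,
      (heavy_iff ρ BA).2 fun x y z => ?_⟩
    have hS' := apply_tmul_eq_antipode h.invariant
    -- Surjectivity of the antipode enters here: for p = S(r), t(p) t(q) = B^A(r ⊗ 1) B^A(1 ⊗ q) =
    -- B^A(r ⊗ q) = t(S(r) q).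
    have hmul : ∀ p q : H, BA (1 ⊗ₜ p) * BA (1 ⊗ₜ q) = BA (1 ⊗ₜ (p * q)) := by
      intro p q
      obtain ⟨r, rfl⟩ := hS p
      rw [← hS', ← h.heavy r q, hS' r 1, mul_one]
    have key : ∀ c : H ⊗[k] H, LinearMap.mul' k A
        (TensorProduct.map (BA ∘ₗ TensorProduct.mk k H H x)
          (BA ∘ₗ (TensorProduct.mk k H H).flip z) c) =
        BA (x ⊗ₜ 1) * BA (1 ⊗ₜ LinearMap.mul' k H ((HopfAlgebra.antipode k).lTensor H c)) *
          BA (1 ⊗ₜ z) := by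
      intro c
      induction c using TensorProduct.induction_on with
      | zero => simp only [map_zero, TensorProduct.tmul_zero, mul_zero, zero_mul]
      | add a b ha hb => simp only [map_add, ha, hb, TensorProduct.tmul_add, mul_add, add_mul]
      | tmul p q =>
      simp only [TensorProduct.map_tmul, LinearMap.comp_apply, TensorProduct.mk_apply,
        LinearMap.flip_apply, LinearMap.mul'_apply, LinearMap.lTensor_tmul]
      rw [← h.heavy x p, hS' q z, ← hmul, ← hmul, mul_assoc, mul_assoc, mul_assoc]
    rw [key, HopfAlgebra.mul_antipode_lTensor_comul_apply, Algebra.algebraMap_eq_smul_one,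
      TensorProduct.tmul_smul, map_smul, h.normalized, mul_smul_comm, mul_one, smul_mul_assoc,
      h.heavy]

end HopfCowreath

/-! ### Sign rules for ordered products of anticommuting elements -/

section SortedProd

variable {k : Type u} [Field k] {B : Type v} [Ring B] [Algebra k B] {n : ℕ}

/-- `y_P = y_{i₁} ⋯ y_{iₛ}` for `P = {i₁ < … < iₛ}`. -/
def sortedProd (y : Fin n → B) (P : Finset (Fin n)) : B := ((P.sort (· ≤ ·)).map y).prod

@[simp] theorem sortedProd_empty (y : Fin n → B) : sortedProd y ∅ = 1 := by simp [sortedProd]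

@[simp] theorem sortedProd_singleton (y : Fin n → B) (i : Fin n) : sortedProd y {i} = y i := by
  simp [sortedProd]

theorem sortedProd_insert_min (y : Fin n → B) {m : Fin n} {P : Finset (Fin n)}
    (h : ∀ p ∈ P, m < p) : sortedProd y (insert m P) = y m * sortedProd y P := by
  rw [sortedProd, Finset.sort_insert _ (fun b hb => (h b hb).le) (fun hm => (h m hm).false)]
  simp [sortedProd]

/-- To reach its place, y_i passes exactly the factors with smaller index, one sign each. -/
theorem mul_sortedProd (y : Fin n → B) (hy : ∀ i j, y i * y j = -(y j * y i)) (i : Fin n)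
    (R : Finset (Fin n)) : i ∉ R → y i * sortedProd y R =
      (-1 : k) ^ (R.filter (· < i)).card • sortedProd y (insert i R) := by
  induction R using Finset.induction_on_min with
  | empty => intro _; simp
  | insert m R hm ih =>
    intro hi
    rw [Finset.mem_insert, not_or] at hi
    have hmR : m ∉ R := fun h => (hm m h).false
    rcases lt_or_gt_of_ne hi.1 with h | h
    · have h1 : ∀ p ∈ insert m R, i < p := by
        intro p hp
        rcases Finset.mem_insert.1 hp with rfl | hp
        · exact h
        · exact h.trans (hm p hp)
      rw [Finset.filter_false_of_mem (fun p hp => (h1 p hp).le.not_gt), Finset.card_empty,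
        pow_zero, one_smul, sortedProd_insert_min y h1]
    · have h1 : ∀ p ∈ insert i R, m < p := by
        intro p hp
        rcases Finset.mem_insert.1 hp with rfl | hp
        · exact h
        · exact hm p hp
      rw [sortedProd_insert_min y hm, ← mul_assoc, hy, neg_mul, mul_assoc, ih hi.2,
        Finset.insert_comm, sortedProd_insert_min y h1, Finset.filter_insert, if_pos h,
        Finset.card_insert_of_notMem (by simp [hmR]), pow_succ, mul_neg_one, neg_smul,
        mul_smul_comm]

/-- The positions of the elements of P inside P itself are 1, …, |P|. -/
theorem sum_card_filter_le (P : Finset (Fin n)) :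
    ∑ p ∈ P, (P.filter (· ≤ p)).card = P.card * (P.card + 1) / 2 := by
  induction P using Finset.induction_on_max with
  | empty => simp
  | insert m P hm ih =>
    have hmP : m ∉ P := fun h => (hm m h).false
    rw [Finset.sum_insert hmP, Finset.filter_true_of_mem, Finset.card_insert_of_notMem hmP]
    · have h1 : ∀ p ∈ P, ((insert m P).filter (· ≤ p)).card = (P.filter (· ≤ p)).card := by
        intro p hp
        rw [Finset.filter_insert, if_neg (hm p hp).not_ge]
      rw [Finset.sum_congr rfl h1, ih,
        show (P.card + 1) * (P.card + 1 + 1) = P.card * (P.card + 1) + (P.card + 1) * 2 by ring,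
        Nat.add_mul_div_right _ _ two_pos, add_comm]
    · intro p hp
      rcases Finset.mem_insert.1 hp with rfl | hp
      · exact le_rfl
      · exact (hm p hp).le

/-- The position of p in P ⊔ R is its position in P plus the number of smaller elements of R. The
positions inside P add up to the triangular number subtracted in `posSum`, so `posSum` counts the
inversions between P and R. -/
theorem posSum_union {P R : Finset (Fin n)} (h : Disjoint P R) :
    posSum P (P ∪ R) = ∑ p ∈ P, (R.filter (· < p)).card := by
  have h1 : ∀ p ∈ P, ((P ∪ R).filter (· ≤ p)).card =
      (P.filter (· ≤ p)).card + (R.filter (· < p)).card := by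
    intro p hp
    rw [Finset.filter_union, Finset.card_union_of_disjoint (Finset.disjoint_filter_filter h)]
    congr 2
    refine Finset.filter_congr fun r hr => ⟨fun hle => lt_of_le_of_ne hle ?_, le_of_lt⟩
    rintro rfl
    exact Finset.disjoint_left.1 h hp hr
  rw [posSum, Finset.sum_congr rfl h1, Finset.sum_add_distrib, sum_card_filter_le,
    Nat.add_sub_cancel_left]

theorem posSum_self (P : Finset (Fin n)) : posSum P P = 0 := by
  simpa using posSum_union (Finset.disjoint_empty_right P)

/-- Sorting the concatenated word needs one transposition of anticommuting factors for each
inversion. -/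
theorem sortedProd_mul_sortedProd (y : Fin n → B) (hy : ∀ i j, y i * y j = -(y j * y i))
    {P R : Finset (Fin n)} (h : Disjoint P R) : sortedProd y P * sortedProd y R =
      (-1 : k) ^ posSum P (P ∪ R) • sortedProd y (P ∪ R) := by
  rw [posSum_union h]
  induction P using Finset.induction_on_min with
  | empty => simp
  | insert m P hm ih =>
    rw [Finset.disjoint_insert_left] at h
    have hmP : m ∉ P := fun h => (hm m h).false
    rw [sortedProd_insert_min y hm, mul_assoc, ih h.2, mul_smul_comm,
      mul_sortedProd (k := k) y hy m (P ∪ R) (by simp [hmP, h.1]), smul_smul, ← pow_add,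
      Finset.sum_insert hmP, add_comm, Finset.insert_union]
    congr 4
    rw [Finset.filter_union, Finset.filter_false_of_mem (fun p hp => (hm p hp).le.not_gt),
      Finset.empty_union]

theorem sortedProd_eq_smul_of_subset (y : Fin n → B) (hy : ∀ i j, y i * y j = -(y j * y i))
    {P Q : Finset (Fin n)} (h : P ⊆ Q) : sortedProd y Q =
      (-1 : k) ^ posSum P Q • (sortedProd y P * sortedProd y (Q \ P)) := by
  rw [sortedProd_mul_sortedProd (k := k) y hy Finset.disjoint_sdiff, Finset.union_sdiff_of_subset h,
    smul_smul, ← mul_pow, neg_one_mul, neg_neg, one_pow, one_smul]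

/-- `y_{i₁} ⋯ y_{iₛ}` commutes up to sign with whatever anticommutes with all `y_i`. -/
theorem mul_sortedProd_of_anticomm (y : Fin n → B) (z : B) (P : Finset (Fin n))
    (hz : ∀ i ∈ P, z * y i = -(y i * z)) :
    z * sortedProd y P = (-1 : k) ^ P.card • (sortedProd y P * z) := by
  induction P using Finset.induction_on_min with
  | empty => simp
  | insert m P hm ih =>
    rw [sortedProd_insert_min y hm, ← mul_assoc, hz m (Finset.mem_insert_self m P), neg_mul,
      mul_assoc, ih (fun i hi => hz i (Finset.mem_insert_of_mem hi)),
      Finset.card_insert_of_notMem (fun h => (hm m h).false), pow_succ, mul_neg_one, neg_smul,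
      mul_smul_comm, mul_assoc]

/-- Each of the |P| factors passes each of the |Q| factors. Disjointness is not needed, since a
repeated index also obeys the anticommutation rule. -/
theorem sortedProd_comm (y : Fin n → B) (hy : ∀ i j, y i * y j = -(y j * y i))
    (P Q : Finset (Fin n)) : sortedProd y Q * sortedProd y P =
      (-1 : k) ^ (P.card * Q.card) • (sortedProd y P * sortedProd y Q) := by
  have h1 : ∀ i, sortedProd y Q * y i = (-1 : k) ^ Q.card • (y i * sortedProd y Q) := by
    intro i
    rw [mul_sortedProd_of_anticomm (k := k) y (y i) Q (fun j _ => hy i j), smul_smul, ← mul_pow,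
      neg_one_mul, neg_neg, one_pow, one_smul]
  induction P using Finset.induction_on_min with
  | empty => simp
  | insert m P hm ih =>
    rw [sortedProd_insert_min y hm, ← mul_assoc, h1, smul_mul_assoc, mul_assoc, ih,
      Finset.card_insert_of_notMem (fun h => (hm m h).false), mul_smul_comm, smul_smul, ← pow_add,
      mul_assoc, add_mul, one_mul, add_comm]

theorem sortedProd_eq_smul_mul_of_mem (y : Fin n → B) (hy : ∀ i j, y i * y j = -(y j * y i))
    {p : Fin n} {P : Finset (Fin n)} (hp : p ∈ P) : sortedProd y P =
      (-1 : k) ^ (posSum {p} P + (P \ {p}).card) • (sortedProd y (P \ {p}) * y p) := by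
  rw [sortedProd_eq_smul_of_subset (k := k) y hy (Finset.singleton_subset_iff.2 hp),
    sortedProd_singleton, mul_sortedProd_of_anticomm (k := k) y (y p) _ (fun i _ => hy p i),
    smul_smul, pow_add]

/-- A common factor y_p is moved to the right end of the first product and to the left end of the
second, producing y_p y_p. -/
theorem sortedProd_mul_eq_zero (k : Type u) [Field k] [Algebra k B] (y : Fin n → B)
    (hy : ∀ i j, y i * y j = -(y j * y i))
    (hy₀ : ∀ i, y i * y i = 0) {P Q : Finset (Fin n)} (h : ¬ Disjoint P Q) :
    sortedProd y P * sortedProd y Q = 0 := by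
  obtain ⟨p, hP, hQ⟩ := Finset.not_disjoint_iff.1 h
  rw [sortedProd_eq_smul_mul_of_mem (k := k) y hy hP,
    sortedProd_eq_smul_of_subset (k := k) y hy (Finset.singleton_subset_iff.2 hQ),
    sortedProd_singleton, smul_mul_smul_comm, mul_assoc, ← mul_assoc (y p), hy₀, zero_mul, mul_zero,
    smul_zero]

end SortedProd

/-! ### Spanning elements of E(n) and surjectivity of its antipode -/

namespace EAlg

variable {k : Type u} [Field k] {n : ℕ}

theorem x_mul_x (i j : Fin n) : x k n i * x k n j = -(x k n j * x k n i) := by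
  rcases lt_trichotomy i j with h | rfl | h
  · exact x_mul_x_of_lt k n i j h
  · rw [x_mul_self, neg_zero]
  · rw [x_mul_x_of_lt k n j i h, neg_neg]

theorem xProd_eq_sortedProd (P : Finset (Fin n)) : xProd k P = sortedProd (x k n) P := rfl

@[simp] theorem xProd_empty : xProd k (∅ : Finset (Fin n)) = 1 := sortedProd_empty _

@[simp] theorem xProd_singleton (i : Fin n) : xProd k {i} = x k n i := sortedProd_singleton _ _

theorem xProd_insert_min {m : Fin n} {P : Finset (Fin n)} (h : ∀ p ∈ P, m < p) :
    xProd k (insert m P) = x k n m * xProd k P := sortedProd_insert_min _ h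

theorem gx_zero (P : Finset (Fin n)) : gx k 0 P = xProd k P := by simp [gx]

theorem gx_one (P : Finset (Fin n)) : gx k 1 P = g k n * xProd k P := by simp [gx]

theorem g_mul_g_mul (a : EAlg k n) : g k n * (g k n * a) = a := by
  rw [← mul_assoc, g_mul_g, one_mul]

theorem g_mul_xProd (P : Finset (Fin n)) :
    g k n * xProd k P = (-1 : k) ^ P.card • (xProd k P * g k n) :=
  mul_sortedProd_of_anticomm _ _ _ fun i _ => g_mul_x k n i

theorem g_mul_xProd_mul_g (P : Finset (Fin n)) :
    g k n * xProd k P * g k n = (-1 : k) ^ P.card • xProd k P := by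
  rw [g_mul_xProd, smul_mul_assoc, mul_assoc, g_mul_g, mul_one]

theorem g_mul_gx_mul_g (j : Fin 2) (P : Finset (Fin n)) :
    g k n * gx k j P * g k n = (-1 : k) ^ P.card • gx k j P := by
  rw [gx, ← mul_assoc, ← pow_succ', pow_succ, mul_assoc, mul_assoc, ← mul_assoc (g k n),
    g_mul_xProd_mul_g, mul_smul_comm]

/-- The span contains 1 and is stable under left multiplication by the generators. Spanning suffices
for comparing linear maps; linear independence is not needed. -/
theorem span_gx : Submodule.span k
    (Set.range fun p : Fin 2 × Finset (Fin n) => gx k p.1 p.2) = ⊤ := by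
  set S := Submodule.span k (Set.range fun p : Fin 2 × Finset (Fin n) => gx k p.1 p.2) with hS
  have hmem : ∀ j P, gx k j P ∈ S := fun j P => Submodule.subset_span ⟨(j, P), rfl⟩
  have hg : ∀ z ∈ S, g k n * z ∈ S := by
    intro z hz
    refine Submodule.span_induction ?_ (by simp) (fun a b _ _ ha hb => ?_) (fun c a _ ha => ?_) hz
    · rintro _ ⟨⟨j, P⟩, rfl⟩
      fin_cases j
      · simpa [gx_zero, gx_one] using hmem 1 P
      · simpa [gx_zero, gx_one, g_mul_g_mul] using hmem 0 P
    · rw [mul_add]; exact S.add_mem ha hb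
    · rw [mul_smul_comm]; exact S.smul_mem c ha
  have hx : ∀ i, ∀ z ∈ S, x k n i * z ∈ S := by
    intro i z hz
    have h0 : ∀ P, x k n i * xProd k P ∈ S := by
      intro P
      by_cases hi : i ∈ P
      · rw [← xProd_singleton, xProd_eq_sortedProd, xProd_eq_sortedProd,
          sortedProd_mul_eq_zero k _ x_mul_x (x_mul_self k n)
            (by simpa using hi)]
        exact S.zero_mem
      · rw [xProd_eq_sortedProd, mul_sortedProd (k := k) _ x_mul_x i P hi, ← xProd_eq_sortedProd,
          ← gx_zero]
        exact S.smul_mem _ (hmem _ _)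
    refine Submodule.span_induction ?_ (by simp) (fun a b _ _ ha hb => ?_) (fun c a _ ha => ?_) hz
    · rintro _ ⟨⟨j, P⟩, rfl⟩
      fin_cases j
      · simpa [gx_zero] using h0 P
      · simp only [Fin.mk_one, gx_one]
        rw [← mul_assoc, ← neg_neg (x k n i * g k n), ← g_mul_x, neg_mul, mul_assoc]
        exact S.neg_mem (hg _ (h0 P))
    · rw [mul_add]; exact S.add_mem ha hb
    · rw [mul_smul_comm]; exact S.smul_mem c ha
  have hall : ∀ a : EAlg k n, ∀ z ∈ S, a * z ∈ S := by
    intro a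
    induction a using EAlg.induction with
    | hr r => intro z hz; rw [← Algebra.smul_def]; exact S.smul_mem r hz
    | hg => exact hg
    | hx i => exact hx i
    | hmul a b ha hb => intro z hz; rw [mul_assoc]; exact ha _ (hb _ hz)
    | hadd a b ha hb => intro z hz; rw [add_mul]; exact S.add_mem (ha _ hz) (hb _ hz)
  refine Submodule.eq_top_iff'.2 fun a => ?_
  have h1 : (1 : EAlg k n) ∈ S := by simpa [gx_zero] using hmem 0 ∅
  simpa using hall a 1 h1

theorem linearMap_ext_gx {M : Type*} [AddCommGroup M] [Module k M] {f f' : EAlg k n →ₗ[k] M}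
    (h : ∀ j P, f (gx k j P) = f' (gx k j P)) : f = f' :=
  LinearMap.ext_on_range span_gx fun p => h p.1 p.2

theorem antipode_eq (a : EAlg k n) : HopfAlgebra.antipode k a = antipodeLin a := rfl

theorem antipode_surjective : Function.Surjective (HopfAlgebra.antipode k (A := EAlg k n)) := by
  intro a
  induction a using EAlg.induction with
  | hr r => exact ⟨algebraMap k _ r, antipodeLin_algebraMap r⟩
  | hg => exact ⟨g k n, antipodeLin_g⟩
  | hx i =>
    -- S(g xᵢ) = S(xᵢ) S(g) = g xᵢ g = -xᵢ.
    refine ⟨-(g k n * x k n i), ?_⟩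
    rw [antipode_eq, map_neg, antipodeLin_mul, antipodeLin_g, antipodeLin_x, g_mul_x, neg_mul,
      neg_neg, mul_assoc, g_mul_g, mul_one]
  | hmul a b ha hb =>
    obtain ⟨a, rfl⟩ := ha
    obtain ⟨b, rfl⟩ := hb
    exact ⟨b * a, antipodeLin_mul b a⟩
  | hadd a b ha hb =>
    obtain ⟨a, rfl⟩ := ha
    obtain ⟨b, rfl⟩ := hb
    exact ⟨a + b, map_add _ a b⟩

end EAlg

/-! ### Contracting a coaction with functionals -/

section Contract

variable {k : Type u} [Field k] {H : Type w} [Ring H] [Bialgebra k H]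
  {A : Type v} [Ring A] [Algebra k A]

/-- `a ↦ a₀ f(a₁)` -/
def contract (ρ : A →ₐ[k] A ⊗[k] H) (f : H →ₗ[k] k) : A →ₗ[k] A :=
  (TensorProduct.rid k A).toLinearMap ∘ₗ f.lTensor A ∘ₗ ρ.toLinearMap

theorem contract_apply (ρ : A →ₐ[k] A ⊗[k] H) (f : H →ₗ[k] k) (a : A) :
    contract ρ f a = TensorProduct.rid k A (f.lTensor A (ρ a)) := rfl

-- H coacting on itself is the universal case: identities between contractions are verified here and
-- then transported to A.
variable (k H) in
theorem isComoduleAlgebra_comul : IsComoduleAlgebra (Bialgebra.comulAlgHom k H) where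
  coassoc := Coalgebra.coassoc
  counit := by
    refine LinearMap.ext fun a => ?_
    simp only [LinearMap.comp_apply, AlgHom.toLinearMap_apply, Bialgebra.comulAlgHom_apply,
      Coalgebra.lTensor_counit_comul, LinearEquiv.coe_coe, TensorProduct.rid_tmul, one_smul,
      LinearMap.id_apply]

theorem contract_counit {ρ : A →ₐ[k] A ⊗[k] H} (hρ : IsComoduleAlgebra ρ) (a : A) :
    contract ρ Coalgebra.counit a = a := LinearMap.congr_fun hρ.counit a

/-- The counit axiom provides a left inverse of ρ. -/
theorem IsComoduleAlgebra.injective {ρ : A →ₐ[k] A ⊗[k] H} (hρ : IsComoduleAlgebra ρ) :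
    Function.Injective ρ := fun a b h => by
  rw [← contract_counit hρ a, ← contract_counit hρ b, contract_apply, contract_apply, h]

/-- The operator `f` on `A` corresponds to the operator `F` on `H` under the coaction. -/
def Intertwines (ρ : A →ₐ[k] A ⊗[k] H) (f : A →ₗ[k] A) (F : H →ₗ[k] H) : Prop :=
  ∀ a, ρ (f a) = F.lTensor A (ρ a)

/-- Coassociativity: ρ(a₀ f(a₁)) = a₀ ⊗ a₁ f(a₂), that is, contraction by f on A becomes contraction
by f on the H leg. -/
theorem intertwines_contract {ρ : A →ₐ[k] A ⊗[k] H} (hρ : IsComoduleAlgebra ρ) (f : H →ₗ[k] k) :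
    Intertwines ρ (contract ρ f) (contract (Bialgebra.comulAlgHom k H) f) := by
  intro a
  have h1 : TensorProduct.assoc k A H H (ρ.toLinearMap.rTensor H (ρ a)) =
      (Coalgebra.comul (R := k) (A := H)).lTensor A (ρ a) :=
    LinearMap.congr_fun hρ.coassoc a
  have h2 : ∀ u : A ⊗[k] H, ρ (TensorProduct.rid k A (f.lTensor A u)) =
      ((TensorProduct.rid k H).toLinearMap ∘ₗ f.lTensor H).lTensor A
        (TensorProduct.assoc k A H H (ρ.toLinearMap.rTensor H u)) := by
    intro u
    induction u using TensorProduct.induction_on with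
    | zero => simp only [map_zero]
    | add a b ha hb => simp only [map_add, ha, hb]
    | tmul b p =>
    rw [LinearMap.lTensor_tmul, TensorProduct.rid_tmul, map_smul, LinearMap.rTensor_tmul,
      AlgHom.toLinearMap_apply]
    generalize ρ b = w
    induction w using TensorProduct.induction_on with
    | zero => simp only [TensorProduct.zero_tmul, map_zero, smul_zero]
    | add a b ha hb => simp only [TensorProduct.add_tmul, map_add, smul_add, ha, hb]
    | tmul c q => simp
  rw [contract_apply, h2, h1, ← LinearMap.comp_apply, ← LinearMap.lTensor_comp]
  rfl

namespace Intertwines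

variable {ρ : A →ₐ[k] A ⊗[k] H} {f f' : A →ₗ[k] A} {F F' : H →ₗ[k] H}

theorem id : Intertwines ρ LinearMap.id LinearMap.id := fun a => by simp

theorem comp (h : Intertwines ρ f F) (h' : Intertwines ρ f' F') :
    Intertwines ρ (f ∘ₗ f') (F ∘ₗ F') := fun a => by
  rw [LinearMap.comp_apply, h, h', LinearMap.lTensor_comp, LinearMap.comp_apply]

theorem neg (h : Intertwines ρ f F) : Intertwines ρ (-f) (-F) := fun a => by
  rw [LinearMap.neg_apply, map_neg, h, LinearMap.lTensor_neg, LinearMap.neg_apply]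

theorem zero : Intertwines ρ 0 0 := fun a => by simp

/-- Injectivity of ρ is what lets a relation between operators on H pass to the corresponding
operators on A. -/
theorem unique (hρ : IsComoduleAlgebra ρ) (h : Intertwines ρ f F) (h' : Intertwines ρ f' F) :
    f = f' := LinearMap.ext fun a => hρ.injective (by rw [h, h'])

/-- Apply the counit to the second leg of ρ(f a) = a₀ ⊗ F(a₁). -/
theorem eq_contract (hρ : IsComoduleAlgebra ρ) (h : Intertwines ρ f F) (a : A) :
    f a = contract ρ (Coalgebra.counit ∘ₗ F) a := by
  rw [contract_apply, LinearMap.lTensor_comp, LinearMap.comp_apply, ← h, ← contract_apply,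
    contract_counit hρ]

end Intertwines

end Contract

/-! ### The functionals on E(n) that give φ and dᵢ -/

namespace EAlg

variable {k : Type u} [Field k] {n : ℕ}

/-- The character `g ↦ -1`, `xᵢ ↦ 0` of `E(n)`. -/
def signHom : EAlg k n →ₐ[k] k :=
  lift (-1) (fun _ => 0) (by simp) (by simp) (by simp) (by simp)

@[simp] theorem signHom_g : signHom (g k n) = -1 := lift_g ..

@[simp] theorem signHom_x (i : Fin n) : signHom (x k n i) = 0 := lift_x ..

/-- The representation `g ↦ diag(-1, 1)`, `xⱼ ↦ -δᵢⱼ E₁₂` of `E(n)`. -/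
def matHom (i : Fin n) : EAlg k n →ₐ[k] Matrix (Fin 2) (Fin 2) k :=
  lift !![-1, 0; 0, 1] (fun j => !![0, if i = j then -1 else 0; 0, 0])
    (by simp [Matrix.one_fin_two])
    (fun j => by
      generalize (if i = j then (-1 : k) else 0) = c
      ext a b; fin_cases a <;> fin_cases b <;> simp)
    (fun j => by
      generalize (if i = j then (-1 : k) else 0) = c
      ext a b; fin_cases a <;> fin_cases b <;> simp)
    (fun j l _ => by
      generalize (if i = j then (-1 : k) else 0) = c
      generalize (if i = l then (-1 : k) else 0) = c'
      ext a b; fin_cases a <;> fin_cases b <;> simp)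

/-- The functional on `E(n)` with `xᵢ ↦ -1`, `g xᵢ ↦ 1`, and zero on the other elements of the
standard basis. It is a skew derivation. -/
def skewDer (i : Fin n) : EAlg k n →ₗ[k] k :=
  Matrix.entryLinearMap k k 0 1 ∘ₗ (matHom i).toLinearMap

theorem skewDer_apply (i : Fin n) (a : EAlg k n) : skewDer i a = matHom i a 0 1 := rfl

/-- The representation is upper triangular with diagonal characters χ and ε, so multiplying matrices
makes its corner entry a (χ, ε)-skew derivation. -/
theorem matHom_entries (i : Fin n) (a : EAlg k n) :
    matHom i a 0 0 = signHom a ∧ matHom i a 1 0 = 0 ∧ matHom i a 1 1 = counitHom a := by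
  induction a using EAlg.induction with
  | hr r => simp [AlgHom.commutes, Matrix.algebraMap_matrix_apply]
  | hg => simp [matHom]
  | hx j => simp [matHom]
  | hmul a b ha hb => simp [Matrix.mul_apply, Fin.sum_univ_two, ha, hb]
  | hadd a b ha hb => simp [ha, hb]

theorem skewDer_mul (i : Fin n) (a b : EAlg k n) : skewDer i (a * b) =
    signHom a * skewDer i b + skewDer i a * Coalgebra.counit (R := k) b := by
  rw [counit_eq, skewDer_apply, skewDer_apply, skewDer_apply, map_mul, Matrix.mul_apply,
    Fin.sum_univ_two, (matHom_entries i a).1, (matHom_entries i b).2.2]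

@[simp] theorem skewDer_g (i : Fin n) : skewDer i (g k n) = 0 := by simp [skewDer_apply, matHom]

@[simp] theorem skewDer_x (i j : Fin n) : skewDer i (x k n j) = if i = j then -1 else 0 := by
  simp [skewDer_apply, matHom]

@[simp] theorem skewDer_one (i : Fin n) : skewDer i (1 : EAlg k n) = 0 := by simp [skewDer_apply]

end EAlg

/-! ### The involution and skew derivations of a comodule algebra -/

section Coaction

variable {k : Type u} [Field k] {n : ℕ} {A : Type v} [Ring A] [Algebra k A]

/-- The algebra map `a ↦ a₀ χ(a₁)`, where `χ` is the character `g ↦ -1`, `xᵢ ↦ 0`. -/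
def coactPhi (ρ : A →ₐ[k] A ⊗[k] EAlg k n) : A →ₐ[k] A :=
  ((Algebra.TensorProduct.rid k k A).toAlgHom.comp
    (Algebra.TensorProduct.map (AlgHom.id k A) EAlg.signHom)).comp ρ

theorem coactPhi_eq_contract (ρ : A →ₐ[k] A ⊗[k] EAlg k n) :
    (coactPhi ρ).toLinearMap = contract ρ EAlg.signHom.toLinearMap := rfl

/-- The skew derivations `a ↦ a₀ Dᵢ(a₁)`. -/
def coactDer (ρ : A →ₐ[k] A ⊗[k] EAlg k n) (i : Fin n) : A →ₗ[k] A := contract ρ (EAlg.skewDer i)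

/-- The skew Leibniz rule of Dᵢ on the second leg: contraction with ε gives the identity and
contraction with χ gives φ. -/
theorem coactDer_mul {ρ : A →ₐ[k] A ⊗[k] EAlg k n} (hρ : IsComoduleAlgebra ρ) (i : Fin n)
    (a b : A) : coactDer ρ i (a * b) = coactDer ρ i a * b + coactPhi ρ a * coactDer ρ i b := by
  have key : ∀ u v : A ⊗[k] EAlg k n,
      TensorProduct.rid k A ((EAlg.skewDer i).lTensor A (u * v)) =
      TensorProduct.rid k A ((EAlg.skewDer i).lTensor A u) *
        TensorProduct.rid k A ((Coalgebra.counit (R := k)).lTensor A v) +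
      TensorProduct.rid k A (EAlg.signHom.toLinearMap.lTensor A u) *
        TensorProduct.rid k A ((EAlg.skewDer i).lTensor A v) := by
    intro u v
    induction u using TensorProduct.induction_on with
    | zero => simp only [zero_mul, map_zero, add_zero]
    | add u u' h h' => simp only [add_mul, map_add, h, h']; abel
    | tmul a p =>
    induction v using TensorProduct.induction_on with
    | zero => simp only [mul_zero, map_zero, add_zero]
    | add v v' h h' => simp only [mul_add, map_add, h, h']; abel
    | tmul b q =>
    simp only [Algebra.TensorProduct.tmul_mul_tmul, LinearMap.lTensor_tmul,
      TensorProduct.rid_tmul, EAlg.skewDer_mul, smul_mul_smul_comm, add_smul,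
      AlgHom.toLinearMap_apply]
    rw [add_comm]
  rw [coactDer, contract_apply, map_mul, key, ← contract_apply, ← contract_apply,
    contract_counit hρ, ← contract_apply, ← contract_apply, ← coactPhi_eq_contract]
  rfl

end Coaction

/-! ### The tuple of E(n) coacting on itself -/

namespace EAlg

variable {k : Type u} [Field k] {n : ℕ}

variable (k n) in
/-- The algebra map `h ↦ h₁ χ(h₂)` of `E(n)`. -/
def selfPhi : EAlg k n →ₐ[k] EAlg k n := coactPhi (Bialgebra.comulAlgHom k (EAlg k n))

variable (k) in
/-- The skew derivations `h ↦ h₁ Dᵢ(h₂)` of `E(n)`. -/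
def selfDer (i : Fin n) : EAlg k n →ₗ[k] EAlg k n :=
  coactDer (Bialgebra.comulAlgHom k (EAlg k n)) i

theorem selfDer_mul (i : Fin n) (a b : EAlg k n) :
    selfDer k i (a * b) = selfDer k i a * b + selfPhi k n a * selfDer k i b :=
  coactDer_mul (isComoduleAlgebra_comul k _) i a b

@[simp] theorem selfPhi_g : selfPhi k n (g k n) = -g k n := by
  simp [selfPhi, coactPhi, comul_eq]

@[simp] theorem selfPhi_x (i : Fin n) : selfPhi k n (x k n i) = -x k n i := by
  simp [selfPhi, coactPhi, comul_eq]

@[simp] theorem selfDer_g (i : Fin n) : selfDer k i (g k n) = 0 := by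
  simp [selfDer, coactDer, contract_apply, comul_eq]

@[simp] theorem selfDer_x (i j : Fin n) :
    selfDer k i (x k n j) = if i = j then -1 else 0 := by
  simp only [selfDer, coactDer, contract_apply, comul_eq, Bialgebra.comulAlgHom_apply, comulHom_x,
    map_add, LinearMap.lTensor_tmul, TensorProduct.rid_tmul, skewDer_g, skewDer_x, zero_smul,
    zero_add]
  split_ifs <;> simp

@[simp] theorem selfDer_one (i : Fin n) : selfDer k i 1 = 0 := by
  simp [selfDer, coactDer, contract_apply, Algebra.TensorProduct.one_def]

theorem selfDer_algebraMap (i : Fin n) (r : k) : selfDer k i (algebraMap k _ r) = 0 := by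
  rw [Algebra.algebraMap_eq_smul_one, map_smul, selfDer_one, smul_zero]

theorem selfPhi_selfPhi (a : EAlg k n) : selfPhi k n (selfPhi k n a) = a := by
  have : (selfPhi k n).comp (selfPhi k n) = AlgHom.id k _ := hom_ext (by simp) (by simp)
  exact DFunLike.congr_fun this a

/-- Both sides obey compatible twisted Leibniz rules, so the generators decide. -/
theorem selfPhi_selfDer (i : Fin n) (a : EAlg k n) :
    selfPhi k n (selfDer k i a) = -selfDer k i (selfPhi k n a) := by
  induction a using EAlg.induction with
  | hr r => simp [selfDer_algebraMap]
  | hg => simp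
  | hx j => simp only [selfDer_x, selfPhi_x, map_neg]; split_ifs <;> simp
  | hmul a b ha hb => simp only [selfDer_mul, map_add, map_mul, ha, hb]; noncomm_ring
  | hadd a b ha hb => simp only [map_add, ha, hb]; abel

theorem selfDer_selfDer (i j : Fin n) (a : EAlg k n) :
    selfDer k i (selfDer k j a) = -selfDer k j (selfDer k i a) := by
  induction a using EAlg.induction with
  | hr r => simp [selfDer_algebraMap]
  | hg => simp
  | hx l => simp only [selfDer_x]; split_ifs <;> simp
  | hmul a b ha hb =>
    simp only [selfDer_mul, map_add, ha, hb, selfPhi_selfDer, selfPhi_selfPhi, mul_neg, neg_mul]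
    abel
  | hadd a b ha hb => simp only [map_add, ha, hb]; abel

/-- Anticommutation with i = j gives 2 dᵢ² = 0. -/
theorem selfDer_sq (hk : (2 : k) ≠ 0) (i : Fin n) (a : EAlg k n) :
    selfDer k i (selfDer k i a) = 0 := by
  have h := eq_neg_iff_add_eq_zero.1 (selfDer_selfDer i i a)
  rw [← two_smul k] at h
  exact (smul_eq_zero.1 h).resolve_left hk

theorem selfPhi_xProd (P : Finset (Fin n)) :
    selfPhi k n (xProd k P) = (-1 : k) ^ P.card • xProd k P := by
  induction P using Finset.induction_on_min with
  | empty => simp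
  | insert m P hm ih =>
    rw [xProd_insert_min hm, map_mul, ih, selfPhi_x,
      Finset.card_insert_of_notMem (fun h => (hm m h).false), pow_succ, mul_neg_one, neg_smul,
      mul_smul_comm, neg_mul, smul_neg]

theorem selfPhi_gx (j : Fin 2) (P : Finset (Fin n)) :
    selfPhi k n (gx k j P) = (-1 : k) ^ ((j : ℕ) + P.card) • gx k j P := by
  fin_cases j <;> simp [gx, selfPhi_xProd, pow_add]

theorem selfDer_g_mul (i : Fin n) (a : EAlg k n) :
    selfDer k i (g k n * a) = -(g k n * selfDer k i a) := by
  simp [selfDer_mul]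

theorem selfDer_x_mul {i j : Fin n} (h : i ≠ j) (a : EAlg k n) :
    selfDer k i (x k n j * a) = -(x k n j * selfDer k i a) := by
  simp [selfDer_mul, h]

theorem selfDer_x_mul_self (i : Fin n) (a : EAlg k n) :
    selfDer k i (x k n i * a) = -a - x k n i * selfDer k i a := by
  simp [selfDer_mul, sub_eq_add_neg]

theorem selfDer_xProd_of_notMem (i : Fin n) (P : Finset (Fin n)) :
    i ∉ P → selfDer k i (xProd k P) = 0 := by
  induction P using Finset.induction_on_min with
  | empty => simp
  | insert m P hm ih =>
    intro h
    rw [Finset.mem_insert, not_or] at h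
    rw [xProd_insert_min hm, selfDer_x_mul h.1, ih h.2, mul_zero, neg_zero]

end EAlg

/-! ### Composite derivations d_P -/

section DProd

variable {k : Type u} [Field k] {n : ℕ} {A : Type v} [Ring A] [Algebra k A]

/-- Regarding d_P as an ordered product in the ring of endomorphisms makes all the sign rules for
anticommuting elements available. -/
theorem dProd_eq_sortedProd (d : Fin n → A →ₗ[k] A) (P : Finset (Fin n)) :
    dProd d P = sortedProd (B := Module.End k A) d P := rfl

@[simp] theorem dProd_empty (d : Fin n → A →ₗ[k] A) : dProd d ∅ = LinearMap.id :=
  sortedProd_empty (B := Module.End k A) d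

@[simp] theorem dProd_singleton (d : Fin n → A →ₗ[k] A) (i : Fin n) : dProd d {i} = d i :=
  sortedProd_singleton (B := Module.End k A) d i

theorem dProd_insert_min (d : Fin n → A →ₗ[k] A) {m : Fin n} {P : Finset (Fin n)}
    (h : ∀ p ∈ P, m < p) : dProd d (insert m P) = d m ∘ₗ dProd d P :=
  sortedProd_insert_min (B := Module.End k A) d h

theorem intertwines_dProd {ρ : A →ₐ[k] A ⊗[k] EAlg k n} (hρ : IsComoduleAlgebra ρ)
    (P : Finset (Fin n)) : Intertwines ρ (dProd (coactDer ρ) P) (dProd (EAlg.selfDer k) P) := by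
  induction P using Finset.induction_on_min with
  | empty => simpa using Intertwines.id
  | insert m P hm ih =>
    rw [dProd_insert_min _ hm, dProd_insert_min _ hm]
    exact (intertwines_contract hρ _).comp ih

theorem comm_dProd {A' : Type w} [Ring A'] [Algebra k A'] {d : Fin n → A →ₗ[k] A}
    {d' : Fin n → A' →ₗ[k] A'} {f : A →ₗ[k] A'} (h : ∀ i a, d' i (f a) = f (d i a))
    (P : Finset (Fin n)) (a : A) : dProd d' P (f a) = f (dProd d P a) := by
  induction P using Finset.induction_on_min with
  | empty => simp
  | insert m P hm ih =>
    rw [dProd_insert_min _ hm, dProd_insert_min _ hm, LinearMap.comp_apply, LinearMap.comp_apply,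
      ih, h]

theorem dProd_anticomm {d : Fin n → A →ₗ[k] A} {f : A →ₗ[k] A} {P : Finset (Fin n)}
    (h : ∀ i ∈ P, ∀ a, d i (f a) = -f (d i a)) (a : A) :
    dProd d P (f a) = (-1 : k) ^ P.card • f (dProd d P a) := by
  have h1 := mul_sortedProd_of_anticomm (k := k) (B := Module.End k A) d f P
    fun i hi => LinearMap.ext fun a => by
      simp only [Module.End.mul_apply, LinearMap.neg_apply, h i hi, neg_neg]
  have h2 := LinearMap.congr_fun h1 a
  simp only [LinearMap.smul_apply, Module.End.mul_apply] at h2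
  rw [dProd_eq_sortedProd, h2, smul_smul, ← mul_pow, neg_one_mul, neg_neg, one_pow, one_smul]

end DProd

/-! ### Derivatives of the spanning elements and the dual expansion -/

namespace EAlg

variable {k : Type u} [Field k] {n : ℕ}

theorem dProd_selfDer_g_mul (P : Finset (Fin n)) (a : EAlg k n) :
    dProd (selfDer k) P (g k n * a) = (-1 : k) ^ P.card • (g k n * dProd (selfDer k) P a) :=
  dProd_anticomm (f := LinearMap.mulLeft k (g k n)) (fun i _ a => selfDer_g_mul i a) a

theorem dProd_selfDer_x_mul {m : Fin n} {P : Finset (Fin n)} (hm : m ∉ P) (a : EAlg k n) :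
    dProd (selfDer k) P (x k n m * a) = (-1 : k) ^ P.card • (x k n m * dProd (selfDer k) P a) :=
  dProd_anticomm (f := LinearMap.mulLeft k (x k n m))
    (fun _ hi a => selfDer_x_mul (ne_of_mem_of_not_mem hi hm) a) a

theorem triangle_succ (s : ℕ) : (s + 1) * (s + 1 + 1) / 2 = s * (s + 1) / 2 + (s + 1) := by
  rw [show (s + 1) * (s + 1 + 1) = s * (s + 1) + (s + 1) * 2 by ring,
    Nat.add_mul_div_right _ _ two_pos]

/-- For m below P, the operator d_P passes x_m at the cost of (-1)^{|P|} and strips x_P by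
induction; then d_m removes x_m with one further sign. The exponents 1, 2, …, |P| accumulate to the
triangular number. -/
theorem dProd_selfDer_xProd_mul {P R : Finset (Fin n)} (h : Disjoint P R) :
    dProd (selfDer k) P (xProd k P * xProd k R) =
      (-1 : k) ^ (P.card * (P.card + 1) / 2) • xProd k R := by
  induction P using Finset.induction_on_min with
  | empty => simp
  | insert m P hm ih =>
    rw [Finset.disjoint_insert_left] at h
    have hmP : m ∉ P := fun h => (hm m h).false
    rw [dProd_insert_min _ hm, xProd_insert_min hm, mul_assoc, LinearMap.comp_apply,
      dProd_selfDer_x_mul hmP, ih h.2, mul_smul_comm, smul_smul, map_smul, selfDer_x_mul_self,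
      selfDer_xProd_of_notMem m R h.1, mul_zero, sub_zero, Finset.card_insert_of_notMem hmP,
      triangle_succ, ← pow_add, smul_neg, ← neg_smul, ← mul_neg_one, ← pow_succ]
    congr 2
    ring

/-- Splitting x_Q into x_P x_{Q∖P} costs the sign `posSum P Q`, and d_P passes g^l with sign
(-1)^{l|P|}, which the exponent absorbs as the summand 2l. -/
theorem dProd_selfDer_gx_of_subset (l : Fin 2) {P Q : Finset (Fin n)} (h : P ⊆ Q) :
    dProd (selfDer k) P (gx k l Q) =
      (-1 : k) ^ (posSum P Q + P.card * (P.card + 2 * (l : ℕ) + 1) / 2) • gx k l (Q \ P) := by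
  have h1 : dProd (selfDer k) P (xProd k Q) =
      (-1 : k) ^ (posSum P Q + P.card * (P.card + 1) / 2) • xProd k (Q \ P) := by
    rw [xProd_eq_sortedProd Q, sortedProd_eq_smul_of_subset (k := k) _ x_mul_x h, map_smul,
      ← xProd_eq_sortedProd, ← xProd_eq_sortedProd,
      dProd_selfDer_xProd_mul Finset.disjoint_sdiff, smul_smul, pow_add]
  fin_cases l
  · simpa [gx_zero] using h1
  · simp only [Fin.mk_one, gx_one, dProd_selfDer_g_mul, h1, mul_smul_comm, smul_smul, ← pow_add,
      mul_one]
    rw [show P.card * (P.card + 2 + 1) = P.card * (P.card + 1) + P.card * 2 by ring,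
      Nat.add_mul_div_right _ _ two_pos]
    congr 2
    ring

/-- With p in P but not in Q, reorder d_P so that d_p acts first; it kills x_Q. -/
theorem dProd_selfDer_gx_of_not_subset (l : Fin 2) {P Q : Finset (Fin n)} (h : ¬ P ⊆ Q) :
    dProd (selfDer k) P (gx k l Q) = 0 := by
  obtain ⟨p, hP, hQ⟩ := Finset.not_subset.1 h
  have h1 : dProd (selfDer k) P (xProd k Q) = 0 := by
    rw [dProd_eq_sortedProd, sortedProd_eq_smul_mul_of_mem (k := k) (B := Module.End k (EAlg k n))
      (selfDer k) (fun i j => LinearMap.ext fun a => selfDer_selfDer i j a) hP,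
      LinearMap.smul_apply, Module.End.mul_apply, selfDer_xProd_of_notMem p Q hQ, map_zero,
      smul_zero]
  fin_cases l
  · simpa [gx_zero] using h1
  · simp [gx_one, dProd_selfDer_g_mul, h1]

theorem counit_gx (l : Fin 2) (P : Finset (Fin n)) :
    Coalgebra.counit (R := k) (gx k l P) = if P = ∅ then 1 else 0 := by
  rw [counit_eq, gx, map_mul, map_pow, counitHom_g, one_pow, one_mul]
  induction P using Finset.induction_on_min with
  | empty => simp
  | insert m P hm _ => simp [xProd_insert_min hm, Finset.insert_ne_empty]

/-- The elements `(x_P + (-1)^{|P|+j} g x_P) / 2` of `E(n)`. -/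
def coactElem (k : Type u) [Field k] (j : Fin 2) (P : Finset (Fin n)) : EAlg k n :=
  (2 : k)⁻¹ • (xProd k P + (-1 : k) ^ (P.card + (j : ℕ)) • (g k n * xProd k P))

/-- The functionals dual to `coactElem`, up to sign. -/
def coactFun (k : Type u) [Field k] (j : Fin 2) (P : Finset (Fin n)) : EAlg k n →ₗ[k] k :=
  Coalgebra.counit ∘ₗ (((selfPhi k n).toLinearMap : Module.End k (EAlg k n)) ^ (j : ℕ)) ∘ₗ
    dProd (selfDer k) P

theorem counit_selfPhi_pow_gx (j l : Fin 2) (P : Finset (Fin n)) : Coalgebra.counit (R := k)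
    ((((selfPhi k n).toLinearMap : Module.End k (EAlg k n)) ^ (j : ℕ)) (gx k l P)) =
      if P = ∅ then (-1 : k) ^ ((j : ℕ) * (l : ℕ)) else 0 := by
  have h1 : ((((selfPhi k n).toLinearMap : Module.End k (EAlg k n)) ^ (j : ℕ)) (gx k l P)) =
      (-1 : k) ^ ((j : ℕ) * ((l : ℕ) + P.card)) • gx k l P := by
    fin_cases j <;> simp [selfPhi_gx]
  rw [h1, map_smul, counit_gx]
  split_ifs with h
  · simp [h]
  · simp

/-- d_P leaves a multiple of g^l x_{Q∖P} or zero, and ε then leaves only P = Q. The dependence on j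
is just the sign (-1)^{jl}. -/
theorem coactFun_gx (j l : Fin 2) (P Q : Finset (Fin n)) : coactFun k j P (gx k l Q) =
    if P = Q then (-1 : k) ^ (Q.card * (Q.card + 2 * (l : ℕ) + 1) / 2 + (j : ℕ) * (l : ℕ))
    else 0 := by
  rw [coactFun, LinearMap.comp_apply, LinearMap.comp_apply]
  by_cases h : P ⊆ Q
  · rw [dProd_selfDer_gx_of_subset l h, map_smul, map_smul, counit_selfPhi_pow_gx]
    by_cases h' : P = Q
    · subst h'
      simp [posSum_self, pow_add]
    · have h2 : Q \ P ≠ ∅ := fun h3 => h' (h.antisymm (Finset.sdiff_eq_empty_iff_subset.1 h3))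
      simp [h', h2]
  · have h' : P ≠ Q := fun h' => h h'.subset
    rw [dProd_selfDer_gx_of_not_subset l h]
    simp [h']

/-- On g^l x_Q only P = Q contributes. The sum over j is a Fourier inversion on a group of order
two: the sum of the two elements with P = Q is x_Q, and their difference is g x_Q up to the sign
(-1)^{|Q|}. This uses the invertibility of 2. -/
theorem sum_coactFun_smul_coactElem (hk : (2 : k) ≠ 0) (a : EAlg k n) :
    ∑ j : Fin 2, ∑ P : Finset (Fin n),
      ((-1 : k) ^ (P.card * (P.card + 1) / 2) * coactFun k j P a) • coactElem k j P = a := by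
  let T : EAlg k n →ₗ[k] EAlg k n :=
    { toFun := fun a => ∑ j : Fin 2, ∑ P : Finset (Fin n),
        ((-1 : k) ^ (P.card * (P.card + 1) / 2) * coactFun k j P a) • coactElem k j P
      map_add' := fun a b => by simp only [map_add, mul_add, add_smul, Finset.sum_add_distrib]
      map_smul' := fun c a => by
        simp only [map_smul, smul_eq_mul, mul_left_comm _ c, mul_smul c, Finset.smul_sum,
          RingHom.id_apply] }
  have hT : T = LinearMap.id := by
    refine linearMap_ext_gx fun l Q => ?_
    have h0 : ∀ j : Fin 2, ∑ P : Finset (Fin n),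
        ((-1 : k) ^ (P.card * (P.card + 1) / 2) * coactFun k j P (gx k l Q)) • coactElem k j P =
        ((-1 : k) ^ (Q.card * (l : ℕ) + (j : ℕ) * (l : ℕ))) • coactElem k j Q := by
      intro j
      rw [Finset.sum_eq_single Q]
      · rw [coactFun_gx, if_pos rfl, show Q.card * (Q.card + 2 * (l : ℕ) + 1) =
          Q.card * (Q.card + 1) + (Q.card * l) * 2 by ring,
          Nat.add_mul_div_right _ _ two_pos, ← pow_add]
        congr 1
        -- The triangular sign occurs once as a coefficient and once in the functional, and cancels.
        rw [show ∀ a b c : ℕ, a + (a + b + c) = 2 * a + (b + c) by intros; ring, pow_add, pow_mul]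
        simp
      · intro P _ h
        rw [coactFun_gx, if_neg h, mul_zero, zero_smul]
      · simp
    simp only [T, LinearMap.coe_mk, AddHom.coe_mk, h0, LinearMap.id_apply, Fin.sum_univ_two]
    have h2 : ∀ z : EAlg k n, (2 : k)⁻¹ • (z + z) = z := fun z => by
      rw [← two_smul k z, smul_smul, inv_mul_cancel₀ hk, one_smul]
    have h1 : ∀ m : ℕ, (-1 : k) ^ m * (-1 : k) ^ m = 1 := fun m => by
      rw [← mul_pow, neg_one_mul, neg_neg, one_pow]
    fin_cases l
    · simp only [Fin.zero_eta, coactElem, gx_zero, Fin.val_zero, Fin.val_one, mul_zero, add_zero,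
        pow_zero, one_smul, ← smul_add, pow_succ, mul_neg_one, neg_smul]
      rw [show ∀ a b : EAlg k n, a + b + (a + -b) = a + a by intros; abel, h2]
    · simp only [Fin.mk_one, coactElem, gx_one, Fin.val_zero, Fin.val_one, mul_one, add_zero,
        pow_succ, mul_neg_one, neg_smul, smul_comm _ (2 : k)⁻¹]
      have h3 : ∀ a b : EAlg k n, (-1 : k) ^ Q.card • (a + (-1 : k) ^ Q.card • b) +
          (-1 : k) ^ Q.card • -(a + -((-1 : k) ^ Q.card • b)) = b + b := by
        intro a b
        simp only [smul_add, smul_neg, neg_add, smul_smul, h1, one_smul]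
        abel
      rw [← smul_neg, ← smul_add (2 : k)⁻¹, h3, h2]
  exact LinearMap.congr_fun hT a

end EAlg

/-! ### Existence of the tuple -/

section Existence

variable {k : Type u} [Field k] {n : ℕ} {A : Type v} [Ring A] [Algebra k A]

open EAlg

/-- The relations among φ and the dᵢ hold for E(n) coacting on itself and pass to A because ρ is
injective and intertwines the operators. The formula for ρ comes from expanding its second leg. -/
theorem isCoactionTuple_coact (hk : (2 : k) ≠ 0) {ρ : A →ₐ[k] A ⊗[k] EAlg k n}
    (hρ : IsComoduleAlgebra ρ) : IsCoactionTuple ρ (coactPhi ρ) (coactDer ρ) := by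
  have hφ : Intertwines ρ (coactPhi ρ).toLinearMap (selfPhi k n).toLinearMap :=
    intertwines_contract hρ _
  have hd : ∀ i, Intertwines ρ (coactDer ρ i) (selfDer k i) := fun i => intertwines_contract hρ _
  refine ⟨fun a => ?_, fun i a b => coactDer_mul hρ i a b, fun i a => ?_, fun i a => ?_,
    fun i j a => ?_, fun a => ?_⟩
  · have h : (selfPhi k n).toLinearMap ∘ₗ (selfPhi k n).toLinearMap = LinearMap.id :=
      LinearMap.ext selfPhi_selfPhi
    exact LinearMap.congr_fun (Intertwines.unique hρ (h ▸ hφ.comp hφ) Intertwines.id) a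
  · have h : selfDer k i ∘ₗ selfDer k i = 0 := LinearMap.ext (selfDer_sq hk i)
    exact LinearMap.congr_fun (Intertwines.unique hρ (h ▸ (hd i).comp (hd i)) Intertwines.zero) a
  · have h : (selfPhi k n).toLinearMap ∘ₗ selfDer k i =
        -(selfDer k i ∘ₗ (selfPhi k n).toLinearMap) := LinearMap.ext (selfPhi_selfDer i)
    exact LinearMap.congr_fun
      (Intertwines.unique hρ (h ▸ hφ.comp (hd i)) ((hd i).comp hφ).neg) a
  · have h : selfDer k i ∘ₗ selfDer k j = -(selfDer k j ∘ₗ selfDer k i) :=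
      LinearMap.ext (selfDer_selfDer i j)
    exact LinearMap.congr_fun
      (Intertwines.unique hρ (h ▸ (hd i).comp (hd j)) ((hd j).comp (hd i)).neg) a
  · have h1 : ∀ c : A ⊗[k] EAlg k n, c = ∑ j : Fin 2, ∑ P : Finset (Fin n),
        (-1 : k) ^ (P.card * (P.card + 1) / 2) •
          (TensorProduct.rid k A ((coactFun k j P).lTensor A c) ⊗ₜ[k] coactElem k j P) := by
      intro c
      induction c using TensorProduct.induction_on with
      | zero => simp
      | add b c hb hc =>
        conv_lhs => rw [hb, hc]
        simp only [← Finset.sum_add_distrib, map_add, TensorProduct.add_tmul, smul_add]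
      | tmul b p =>
        conv_lhs => rw [← sum_coactFun_smul_coactElem hk p]
        simp only [TensorProduct.tmul_sum, LinearMap.lTensor_tmul, TensorProduct.rid_tmul,
          TensorProduct.tmul_smul, ← TensorProduct.smul_tmul', smul_smul]
    -- The coefficients of the expansion are contractions of ρ(a), and φ^j d_P is the contraction by
    -- the counit after its counterpart on E(n), which is how `coactFun` is defined.
    have h2 : ∀ (j : Fin 2) (P : Finset (Fin n)), (coactPhi ρ)^[(j : ℕ)] (dProd (coactDer ρ) P a) =
        TensorProduct.rid k A ((coactFun k j P).lTensor A (ρ a)) := by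
      intro j P
      have h3 : Intertwines ρ ((coactPhi ρ).toLinearMap ^ (j : ℕ) : Module.End k A)
          ((selfPhi k n).toLinearMap ^ (j : ℕ) : Module.End k (EAlg k n)) := by
        fin_cases j
        · exact Intertwines.id
        · simpa using hφ
      rw [← contract_apply, coactFun, ← (h3.comp (intertwines_dProd hρ P)).eq_contract hρ,
        LinearMap.comp_apply, Module.End.pow_apply]
      rfl
    rw [h1 (ρ a)]
    simp only [h2]
    rfl

end Existence

/-! ### Values of χ and Dᵢ on the elements of the coaction formula -/

namespace EAlg

variable {k : Type u} [Field k] {n : ℕ}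

theorem signHom_xProd (P : Finset (Fin n)) :
    signHom (xProd k P) = if P = ∅ then 1 else 0 := by
  induction P using Finset.induction_on_min with
  | empty => simp
  | insert m P hm _ => simp [xProd_insert_min hm, Finset.insert_ne_empty]

theorem skewDer_xProd (i : Fin n) (P : Finset (Fin n)) :
    skewDer i (xProd k P) = if P = {i} then -1 else 0 := by
  induction P using Finset.induction_on_min with
  | empty => simp
  | insert m P hm _ =>
    have hmP : m ∉ P := fun h => (hm m h).false
    rw [xProd_insert_min hm, skewDer_mul, signHom_x, zero_mul, zero_add, skewDer_x, ← gx_zero,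
      counit_gx]
    by_cases h : P = ∅
    · subst h
      simp [eq_comm]
    · have h' : insert m P ≠ {i} := fun h' => by
        have h1 := congrArg Finset.card h'
        rw [Finset.card_insert_of_notMem hmP, Finset.card_singleton] at h1
        exact h (Finset.card_eq_zero.1 (by omega))
      simp [h, h']

/-- Only P = ∅ can contribute, and χ(1 ± g) / 2 is 0 for the sign + and 1 for the sign -. This
isolates φ in the formula for ρ. -/
theorem signHom_coactElem (hk : (2 : k) ≠ 0) (j : Fin 2) (P : Finset (Fin n)) :
    signHom (coactElem k j P) = if P = ∅ ∧ j = 1 then 1 else 0 := by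
  rw [coactElem, map_smul, map_add, map_smul, map_mul, signHom_g, signHom_xProd]
  by_cases h : P = ∅
  · subst h
    fin_cases j
    · simp
    · simp only [Fin.mk_one, Finset.card_empty, zero_add, pow_one, if_true, true_and,
        smul_eq_mul]
      field_simp
      norm_num
  · simp [h]

/-- Dᵢ is -1 on xᵢ and 1 on g xᵢ, so it selects (xᵢ - g xᵢ) / 2. This isolates dᵢ in the formula for
ρ; the value -1 cancels the sign carried there by |P| = 1. -/
theorem skewDer_coactElem (hk : (2 : k) ≠ 0) (i : Fin n) (j : Fin 2) (P : Finset (Fin n)) :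
    skewDer i (coactElem k j P) = if P = {i} ∧ j = 0 then -1 else 0 := by
  rw [coactElem, map_smul, map_add, map_smul, skewDer_mul, signHom_g, skewDer_g, zero_mul, add_zero,
    skewDer_xProd]
  by_cases h : P = {i}
  · subst h
    fin_cases j
    · simp only [Fin.zero_eta, Finset.card_singleton, add_zero, pow_one, if_true,
        and_self, smul_eq_mul]
      field_simp
      norm_num
    · simp
  · simp [h]

/-! ### The right adjoint action -/

/-- `a ⊗ b ↦ S(a) y b` -/
def conjMap (y : EAlg k n) : EAlg k n ⊗[k] EAlg k n →ₗ[k] EAlg k n :=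
  LinearMap.mul' k _ ∘ₗ TensorProduct.map (HopfAlgebra.antipode k) (LinearMap.mulLeft k y)

@[simp] theorem conjMap_tmul (y a b : EAlg k n) :
    conjMap y (a ⊗ₜ[k] b) = antipodeLin a * (y * b) := rfl

/-- The antipode reverses products, so sandwiching is a right action of H ⊗ H; this makes y ◁ h a
right action of H. -/
theorem conjMap_mul (y : EAlg k n) (u v : EAlg k n ⊗[k] EAlg k n) :
    conjMap y (u * v) = conjMap (conjMap y u) v := by
  induction v using TensorProduct.induction_on with
  | zero => simp only [mul_zero, map_zero]
  | add v v' h h' => simp only [mul_add, map_add, h, h']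
  | tmul c d =>
  induction u using TensorProduct.induction_on with
  | zero => simp
  | add u u' h h' => simp only [add_mul, map_add, h, h', conjMap_tmul, mul_add]
  | tmul a b => simp [mul_assoc]

/-- The right adjoint action `y ◁ h = S(h₁) y h₂`. -/
def adj (y : EAlg k n) : EAlg k n →ₗ[k] EAlg k n := conjMap y ∘ₗ Coalgebra.comul

theorem adj_add (y y' : EAlg k n) : adj (y + y') = adj y + adj y' := by
  have : conjMap (y + y') = conjMap y + conjMap y' :=
    TensorProduct.ext' fun a b => by simp [add_mul, mul_add]
  rw [adj, this, LinearMap.add_comp, adj, adj]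

theorem adj_smul (c : k) (y : EAlg k n) : adj (c • y) = c • adj y := by
  have : conjMap (c • y) = c • conjMap y := TensorProduct.ext' fun a b => by simp
  rw [adj, this, LinearMap.smul_comp, adj]

theorem adj_zero : adj (0 : EAlg k n) = 0 := by simpa using adj_smul (0 : k) (0 : EAlg k n)

theorem adj_mul (y h h' : EAlg k n) : adj y (h * h') = adj (adj y h) h' := by
  simp only [adj, LinearMap.comp_apply, Bialgebra.comul_mul, conjMap_mul]

@[simp] theorem adj_one (y : EAlg k n) : adj y 1 = y := by
  simp [adj, Algebra.TensorProduct.one_def]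

theorem adj_g (y : EAlg k n) : adj y (g k n) = g k n * y * g k n := by
  simp [adj, comul_eq, mul_assoc]

theorem adj_x (y : EAlg k n) (i : Fin n) :
    adj y (x k n i) = g k n * x k n i * y * g k n + y * x k n i := by
  simp [adj, comul_eq, mul_assoc]

theorem adj_gx_g_mul (l : Fin 2) (Q : Finset (Fin n)) (h : EAlg k n) :
    adj (gx k l Q) (g k n * h) = (-1 : k) ^ Q.card • adj (gx k l Q) h := by
  rw [adj_mul, adj_g, g_mul_gx_mul_g, adj_smul, LinearMap.smul_apply]

/-- The hypothesis says that the two terms of y ◁ xᵢ agree, so y ◁ x_m = 2 y x_m. It is inherited by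
y x_m, and every factor of x_P contributes another 2. -/
theorem adj_xProd_of_comm {y : EAlg k n}
    (hy : ∀ i, g k n * x k n i * y * g k n = y * x k n i) (P : Finset (Fin n)) :
    adj y (xProd k P) = (2 : k) ^ P.card • (y * xProd k P) := by
  induction P using Finset.induction_on_min generalizing y with
  | empty => simp
  | insert m P hm ih =>
    have h1 : ∀ i, g k n * x k n i * (y * x k n m) * g k n = y * x k n m * x k n i := by
      intro i
      rw [mul_assoc, mul_assoc y, ← neg_neg (x k n m * g k n), ← g_mul_x, mul_neg, mul_neg,
        ← mul_assoc y, ← mul_assoc _ (y * g k n), ← mul_assoc _ y, hy, mul_assoc, x_mul_x, mul_neg,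
        neg_neg, mul_assoc]
    rw [xProd_insert_min hm, adj_mul, adj_x, hy, ← two_smul k, adj_smul, LinearMap.smul_apply,
      ih h1, Finset.card_insert_of_notMem (fun h => (hm m h).false), pow_succ', mul_smul, mul_assoc]

/-- Compares the two summands of (g^l x_Q) ◁ xᵢ: they are opposite for l = 0 and equal for l = 1. -/
theorem g_mul_x_mul_gx_mul_g (l : Fin 2) (Q : Finset (Fin n)) (i : Fin n) :
    g k n * x k n i * gx k l Q * g k n = (-1 : k) ^ ((l : ℕ) + 1) • (gx k l Q * x k n i) := by
  have h1 : xProd k Q * x k n i = (-1 : k) ^ Q.card • (x k n i * xProd k Q) := by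
    simpa [xProd_eq_sortedProd] using sortedProd_comm (k := k) (x k n) x_mul_x {i} Q
  have h2 : g k n * x k n i * xProd k Q * g k n = -(xProd k Q * x k n i) := by
    rw [g_mul_x, neg_mul, neg_mul, mul_assoc (x k n i), mul_assoc (x k n i), g_mul_xProd_mul_g,
      mul_smul_comm, h1]
  fin_cases l
  · simpa [gx_zero] using h2
  · simp only [Fin.mk_one, gx_one]
    rw [g_mul_x, neg_mul, neg_mul, mul_assoc (x k n i), g_mul_g_mul, mul_assoc (g k n), h1,
      mul_smul_comm, ← mul_assoc (g k n), g_mul_x, neg_mul, mul_assoc (x k n i) (g k n),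
      g_mul_xProd, mul_smul_comm, smul_neg, smul_smul, ← mul_pow, neg_one_mul, neg_neg, one_pow,
      one_smul]
    simp [mul_assoc]

theorem adj_gx_zero (P Q : Finset (Fin n)) :
    adj (gx k 0 Q) (xProd k P) = if P = ∅ then gx k 0 Q else 0 := by
  induction P using Finset.induction_on_min with
  | empty => simp
  | insert m P hm _ =>
    rw [xProd_insert_min hm, adj_mul, adj_x, g_mul_x_mul_gx_mul_g]
    simp [adj_zero, Finset.insert_ne_empty]

/-- By doubling, the action gives 2^{|P|} g x_Q x_P; sorting x_Q x_P yields |P||Q| signs for the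
exchange and then the inversions, or zero if an index repeats. -/
theorem adj_gx_one (P Q : Finset (Fin n)) : adj (gx k 1 Q) (xProd k P) =
    if Disjoint P Q then
      (2 ^ P.card * (-1 : k) ^ (P.card * Q.card + posSum P (P ∪ Q))) • gx k 1 (P ∪ Q)
    else 0 := by
  have h1 : ∀ i, g k n * x k n i * gx k 1 Q * g k n = gx k 1 Q * x k n i := by
    intro i
    rw [g_mul_x_mul_gx_mul_g]
    simp
  rw [adj_xProd_of_comm h1, gx_one, gx_one, mul_assoc, xProd_eq_sortedProd, xProd_eq_sortedProd,
    sortedProd_comm (k := k) _ x_mul_x]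
  split_ifs with h
  · rw [sortedProd_mul_sortedProd (k := k) _ x_mul_x h, smul_smul, ← pow_add, mul_smul_comm,
      smul_smul, xProd_eq_sortedProd]
  · rw [sortedProd_mul_eq_zero k _ x_mul_x (x_mul_self k n) h, smul_zero, mul_zero, smul_zero]

end EAlg

/-! ### From Sweedler conditions to conditions on the tuple -/

section Conditions

variable {k : Type u} [Field k] {n : ℕ} {A : Type v} [Ring A] [Algebra k A]

open EAlg

theorem contract_eq_sum {ρ : A →ₐ[k] A ⊗[k] EAlg k n} {φ : A →ₐ[k] A} {d : Fin n → A →ₗ[k] A}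
    (T : IsCoactionTuple ρ φ d) (f : EAlg k n →ₗ[k] k) (a : A) :
    contract ρ f a = ∑ j : Fin 2, ∑ P : Finset (Fin n),
      ((-1 : k) ^ (P.card * (P.card + 1) / 2) * f (coactElem k j P)) •
        φ^[(j : ℕ)] (dProd d P a) := by
  rw [contract_apply, T.rho_eq]
  simp only [map_sum, map_smul, LinearMap.lTensor_tmul, TensorProduct.rid_tmul, mul_smul, coactElem]

/-- Together with the analogous statement for dᵢ, this shows that the coaction determines its tuple,
so nothing depends on which tuple is fixed. -/
theorem IsCoactionTuple.coactPhi_apply (hk : (2 : k) ≠ 0) {ρ : A →ₐ[k] A ⊗[k] EAlg k n}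
    {φ : A →ₐ[k] A} {d : Fin n → A →ₗ[k] A} (T : IsCoactionTuple ρ φ d) (a : A) :
    contract ρ signHom.toLinearMap a = φ a := by
  rw [contract_eq_sum T, Fin.sum_univ_two, Finset.sum_eq_zero, zero_add, Finset.sum_eq_single ∅]
  · simp [signHom_coactElem hk]
  · intro P _ hP
    simp [signHom_coactElem hk, hP]
  · simp
  · intro P _
    simp [signHom_coactElem hk]

theorem IsCoactionTuple.coactDer_apply (hk : (2 : k) ≠ 0) {ρ : A →ₐ[k] A ⊗[k] EAlg k n}
    {φ : A →ₐ[k] A} {d : Fin n → A →ₗ[k] A} (T : IsCoactionTuple ρ φ d) (i : Fin n) (a : A) :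
    contract ρ (skewDer i) a = d i a := by
  rw [contract_eq_sum T, Fin.sum_univ_two, add_comm, Finset.sum_eq_zero, zero_add,
    Finset.sum_eq_single {i}]
  · simp [skewDer_coactElem hk]
  · intro P _ hP
    simp [skewDer_coactElem hk, hP]
  · simp
  · intro P _
    simp [skewDer_coactElem hk]

/-- Apply Id ⊗ f to both sides of the colinearity condition. -/
theorem contract_of_colinear {ρ : A →ₐ[k] A ⊗[k] EAlg k n} {t : EAlg k n →ₗ[k] A}
    (ht : ∀ h, ρ (t h) = t.rTensor (EAlg k n) (Coalgebra.comul (R := k) h))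
    (f : EAlg k n →ₗ[k] k) (h : EAlg k n) :
    contract ρ f (t h) = t (contract (Bialgebra.comulAlgHom k (EAlg k n)) f h) := by
  rw [contract_apply, contract_apply, ht, Bialgebra.comulAlgHom_apply]
  generalize Coalgebra.comul (R := k) h = c
  induction c using TensorProduct.induction_on with
  | zero => simp only [map_zero]
  | add a b ha hb => simp only [map_add, ha, hb]
  | tmul p q => simp

/-- Colinearity of `t : E(n) → A` in terms of the tuples of `A` and of `E(n)`. -/
theorem colinear_iff (hk : (2 : k) ≠ 0) {ρ : A →ₐ[k] A ⊗[k] EAlg k n} {φ : A →ₐ[k] A}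
    {d : Fin n → A →ₗ[k] A} (T : IsCoactionTuple ρ φ d) (t : EAlg k n →ₗ[k] A) :
    (∀ h, ρ (t h) = t.rTensor (EAlg k n) (Coalgebra.comul (R := k) h)) ↔
      (∀ h, φ (t h) = t (selfPhi k n h)) ∧ ∀ i h, d i (t h) = t (selfDer k i h) := by
  constructor
  · intro ht
    refine ⟨fun h => ?_, fun i h => ?_⟩
    · rw [← T.coactPhi_apply hk, contract_of_colinear ht]
      rfl
    · rw [← T.coactDer_apply hk, contract_of_colinear ht]
      rfl
  · rintro ⟨h1, h2⟩ h
    -- Δ(h) is itself expanded by the coaction formula for E(n) over itself; the two expansions then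
    -- match term by term.
    have h3 := (isCoactionTuple_coact hk (isComoduleAlgebra_comul k (EAlg k n))).rho_eq h
    rw [Bialgebra.comulAlgHom_apply] at h3
    rw [T.rho_eq, h3]
    simp only [map_sum, map_smul, LinearMap.rTensor_tmul]
    refine Finset.sum_congr rfl fun j _ => Finset.sum_congr rfl fun P _ => ?_
    congr 2
    rw [comm_dProd h2]
    fin_cases j
    · rfl
    · exact h1 _

theorem phi_comm_iff (φ : A →ₐ[k] A) (t : EAlg k n →ₗ[k] A) :
    (∀ h, φ (t h) = t (selfPhi k n h)) ↔ ∀ (l : Fin 2) (Q : Finset (Fin n)),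
      φ (t (gx k l Q)) = (-1 : k) ^ ((l : ℕ) + Q.card) • t (gx k l Q) := by
  constructor
  · intro h l Q
    rw [h, selfPhi_gx, map_smul]
  · intro h
    have : φ.toLinearMap ∘ₗ t = t ∘ₗ (selfPhi k n).toLinearMap :=
      linearMap_ext_gx fun l Q => by
        rw [LinearMap.comp_apply, LinearMap.comp_apply, AlgHom.toLinearMap_apply,
          AlgHom.toLinearMap_apply, h, selfPhi_gx, map_smul]
    exact LinearMap.congr_fun this

/-- From commutation with each dᵢ one gets commutation with every d_P; conversely the singletons P =
{i} already suffice. -/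
theorem der_comm_iff (d : Fin n → A →ₗ[k] A) (t : EAlg k n →ₗ[k] A) :
    (∀ i h, d i (t h) = t (selfDer k i h)) ↔
      (∀ (l : Fin 2) (P Q : Finset (Fin n)), P ⊆ Q → dProd d P (t (gx k l Q)) =
        (-1 : k) ^ (posSum P Q + P.card * (P.card + 2 * (l : ℕ) + 1) / 2) • t (gx k l (Q \ P))) ∧
      ∀ (l : Fin 2) (P Q : Finset (Fin n)), ¬ P ⊆ Q → dProd d P (t (gx k l Q)) = 0 := by
  constructor
  · intro h
    refine ⟨fun l P Q hPQ => ?_, fun l P Q hPQ => ?_⟩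
    · rw [comm_dProd h, dProd_selfDer_gx_of_subset l hPQ, map_smul]
    · rw [comm_dProd h, dProd_selfDer_gx_of_not_subset l hPQ, map_zero]
  · rintro ⟨h1, h2⟩ i
    have : d i ∘ₗ t = t ∘ₗ selfDer k i := linearMap_ext_gx fun l Q => by
      rw [LinearMap.comp_apply, LinearMap.comp_apply, ← dProd_singleton d,
        ← dProd_singleton (selfDer k)]
      by_cases h : {i} ⊆ Q
      · rw [h1 l _ Q h, dProd_selfDer_gx_of_subset l h, map_smul]
      · rw [h2 l _ Q h, dProd_selfDer_gx_of_not_subset l h, map_zero]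
    exact LinearMap.congr_fun this

/-! ### The balancing condition -/

/-- `y, a ↦ a₀ t(y ◁ a₁)` -/
def adjSum (ρ : A →ₐ[k] A ⊗[k] EAlg k n) (t : EAlg k n →ₗ[k] A) (y : EAlg k n) (a : A) : A :=
  LinearMap.mul' k A ((t ∘ₗ adj y).lTensor A (ρ a))

theorem adjSum_ext {ρ : A →ₐ[k] A ⊗[k] EAlg k n} {t : EAlg k n →ₗ[k] A} {a : A}
    (h : ∀ l Q, adjSum ρ t (gx k l Q) a = t (gx k l Q) * a) (y : EAlg k n) :
    adjSum ρ t y a = t y * a := by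
  let f : EAlg k n →ₗ[k] A :=
    { toFun := fun y => adjSum ρ t y a
      map_add' := fun y y' => by
        simp only [adjSum, adj_add, LinearMap.comp_add, LinearMap.lTensor_add, LinearMap.add_apply,
          map_add]
      map_smul' := fun c y => by
        simp only [adjSum, adj_smul, LinearMap.comp_smul, LinearMap.lTensor_smul,
          LinearMap.smul_apply, map_smul, RingHom.id_apply] }
  have : f = LinearMap.mulRight k a ∘ₗ t := linearMap_ext_gx fun l Q => h l Q
  exact LinearMap.congr_fun this y

/-- B^A(h a₁ ⊗ h' a₂) = t(S(a₁) S(h) h' a₂) with t = B^A(1 ⊗ ·), so balancing depends on h, h' only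
through y = S(h) h' and involves the adjoint action of a₁ on y. -/
theorem balanced_eq_adjSum {BA : EAlg k n ⊗[k] EAlg k n →ₗ[k] A}
    (hB : ∀ h h', BA (h ⊗ₜ h') = BA (1 ⊗ₜ (HopfAlgebra.antipode k h * h')))
    (ρ : A →ₐ[k] A ⊗[k] EAlg k n) (h h' : EAlg k n) (a : A) :
    LinearMap.mul' k A
      ((BA ∘ₗ TensorProduct.map (LinearMap.mulLeft k h) (LinearMap.mulLeft k h')).lTensor A
        ((Coalgebra.comul (R := k) (A := EAlg k n)).lTensor A (ρ a))) =
      adjSum ρ (BA ∘ₗ TensorProduct.mk k _ _ 1) (HopfAlgebra.antipode k h * h') a := by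
  have h1 : BA ∘ₗ TensorProduct.map (LinearMap.mulLeft k h) (LinearMap.mulLeft k h') =
      (BA ∘ₗ TensorProduct.mk k _ _ 1) ∘ₗ conjMap (HopfAlgebra.antipode k h * h') := by
    refine TensorProduct.ext' fun p q => ?_
    rw [LinearMap.comp_apply, TensorProduct.map_tmul, hB]
    simp [antipode_eq, mul_assoc]
  rw [adjSum, adj, h1, ← LinearMap.comp_apply (LinearMap.lTensor A _) (LinearMap.lTensor A _),
    ← LinearMap.lTensor_comp, LinearMap.comp_assoc]

theorem neg_one_pow_mul_self (m : ℕ) : (-1 : k) ^ m * (-1 : k) ^ m = 1 := by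
  rw [← mul_pow, neg_one_mul, neg_neg, one_pow]

theorem iterate_involution {A : Type v} {φ : A → A} (hφ : ∀ a, φ (φ a) = a) (m : ℕ) (a : A) :
    φ^[m] a = if Even m then a else φ a := by
  induction m with
  | zero => simp
  | succ m ih =>
    rw [Function.iterate_succ_apply', ih]
    by_cases h : Even m <;> simp [h, hφ, Nat.even_add_one]

/-- The coefficient is 1 if j ≡ m mod 2 and 0 otherwise, while φ^m depends only on the parity of m.
-/
theorem sum_half_smul_iterate (hk : (2 : k) ≠ 0) {φ : A → A} (hφ : ∀ a, φ (φ a) = a) (m : ℕ)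
    (a : A) : ∑ j : Fin 2, ((2 : k)⁻¹ * (1 + (-1 : k) ^ (m + (j : ℕ)))) • φ^[(j : ℕ)] a =
      φ^[m] a := by
  rw [Fin.sum_univ_two, iterate_involution hφ m]
  have h2 : (2 : k)⁻¹ * (1 + 1) = 1 := by rw [one_add_one_eq_two, inv_mul_cancel₀ hk]
  by_cases h : Even m
  · simp [h, h.neg_one_pow, pow_succ, h2]
  · simp [h, (Nat.not_even_iff_odd.1 h).neg_one_pow, pow_succ, h2]

/-- In y ◁ (g x_P) the factor g acts first, by conjugation, and scales y = g^l x_Q by (-1)^{|Q|}. So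
both terms of the element are multiples of y ◁ x_P, and a parity projector remains. -/
theorem adj_gx_coactElem (l j : Fin 2) (P Q : Finset (Fin n)) :
    adj (gx k l Q) (coactElem k j P) =
      ((2 : k)⁻¹ * (1 + (-1 : k) ^ (P.card + Q.card + (j : ℕ)))) • adj (gx k l Q) (xProd k P) := by
  rw [coactElem, map_smul, map_add, map_smul, adj_gx_g_mul, smul_smul, ← pow_add, mul_smul,
    add_smul, one_smul, add_right_comm]

theorem adjSum_gx (hk : (2 : k) ≠ 0) {ρ : A →ₐ[k] A ⊗[k] EAlg k n} {φ : A →ₐ[k] A}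
    {d : Fin n → A →ₗ[k] A} (T : IsCoactionTuple ρ φ d) (t : EAlg k n →ₗ[k] A) (l : Fin 2)
    (Q : Finset (Fin n)) (a : A) : adjSum ρ t (gx k l Q) a =
      ∑ P : Finset (Fin n), (-1 : k) ^ (P.card * (P.card + 1) / 2) •
        (φ^[P.card + Q.card] (dProd d P a) * t (adj (gx k l Q) (xProd k P))) := by
  rw [adjSum, T.rho_eq, Finset.sum_comm, map_sum, map_sum]
  refine Finset.sum_congr rfl fun P _ => ?_
  rw [map_sum, map_sum, ← sum_half_smul_iterate hk T.phi_phi, Finset.sum_mul, Finset.smul_sum]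
  refine Finset.sum_congr rfl fun j _ => ?_
  rw [map_smul, map_smul, LinearMap.lTensor_tmul, LinearMap.mul'_apply, LinearMap.comp_apply]
  -- The second leg in the coaction formula is `coactElem k j P` only after unfolding.
  erw [adj_gx_coactElem]
  rw [map_smul, mul_smul_comm, smul_mul_assoc]

theorem dProd_iterate {ρ : A →ₐ[k] A ⊗[k] EAlg k n} {φ : A →ₐ[k] A}
    {d : Fin n → A →ₗ[k] A} (T : IsCoactionTuple ρ φ d) (P : Finset (Fin n)) (m : ℕ) (a : A) :
    dProd d P (φ^[m] a) = (-1 : k) ^ (m * P.card) • φ^[m] (dProd d P a) := by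
  induction m with
  | zero => simp
  | succ m ih =>
    rw [Function.iterate_succ_apply', Function.iterate_succ_apply', ← AlgHom.toLinearMap_apply,
      dProd_anticomm (fun i _ a => by simp [T.phi_d]), ih, AlgHom.toLinearMap_apply, map_smul,
      smul_smul, ← pow_add]
    congr 2
    ring

/-- For l = 0 only x_∅ acts nontrivially. For l = 1 the terms with P meeting Q vanish and P = ∅
gives the leading term. -/
theorem adjSum_gx_eq (hk : (2 : k) ≠ 0) {ρ : A →ₐ[k] A ⊗[k] EAlg k n} {φ : A →ₐ[k] A}
    {d : Fin n → A →ₗ[k] A} (T : IsCoactionTuple ρ φ d) (t : EAlg k n →ₗ[k] A) (l : Fin 2)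
    (Q : Finset (Fin n)) (a : A) : adjSum ρ t (gx k l Q) a =
      φ^[Q.card] a * t (gx k l Q) +
      if l = 1 then
        ∑ P ∈ Qᶜ.powerset.filter (fun P => P ≠ ∅),
          ((-1 : k) ^ (P.card * (P.card + 3) / 2 + posSum P (P ∪ Q)) * 2 ^ P.card) •
            (dProd d P (φ^[P.card + Q.card] a) * t (gx k l (P ∪ Q)))
      else 0 := by
  rw [adjSum_gx hk T]
  fin_cases l
  · rw [Finset.sum_eq_single ∅]
    · simp
    · intro P _ hP
      simp [adj_gx_zero, hP]
    · simp
  · simp only [Fin.mk_one, if_true]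
    rw [← Finset.sum_subset (Finset.subset_univ Qᶜ.powerset),
      ← Finset.add_sum_erase _ _ (Finset.empty_mem_powerset Qᶜ), Finset.filter_ne']
    · congr 1
      · simp
      · refine Finset.sum_congr rfl fun P hP => ?_
        have hPQ : Disjoint P Q :=
          Finset.subset_compl_iff_disjoint_right.1
            (Finset.mem_powerset.1 (Finset.mem_of_mem_erase hP))
        rw [adj_gx_one, if_pos hPQ, dProd_iterate T, map_smul, mul_smul_comm, smul_smul,
          smul_mul_assoc, smul_smul]
        congr 1
        rw [show P.card * (P.card + 3) = P.card * (P.card + 1) + P.card * 2 by ring,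
          Nat.add_mul_div_right _ _ two_pos]
        -- Moving d_P past φ^{|P|+|Q|} gives the exponent |P|² + |P||Q|. Its second part is the
        -- exchange sign in x_Q x_P; its first, congruent to |P|, accounts for replacing
        -- |P|(|P|+1)/2 by |P|(|P|+3)/2.
        have h1 : (-1 : k) ^ (P.card * P.card) = (-1 : k) ^ P.card := by
          rw [pow_mul]
          rcases Nat.even_or_odd P.card with h | h
          · simp [h.neg_one_pow]
          · simp [h.neg_one_pow]
        rw [add_mul, mul_comm Q.card]
        simp only [pow_add, h1]
        linear_combination -((-1 : k) ^ (P.card * (P.card + 1) / 2) * 2 ^ P.card *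
          (-1) ^ (P.card * Q.card) * (-1) ^ posSum P (P ∪ Q)) *
            neg_one_pow_mul_self (k := k) P.card
    · intro P _ hP
      have hPQ : ¬ Disjoint P Q := fun h =>
        hP (Finset.mem_powerset.2 (Finset.subset_compl_iff_disjoint_right.2 h))
      rw [adj_gx_one, if_neg hPQ, map_zero, mul_zero, smul_zero]

/-- The converse rests on S(h₁ h') h₂ h'' = S(h') S(h₁) h₂ h'' = ε(h) S(h') h''. -/
theorem invariant_iff (BA : EAlg k n ⊗[k] EAlg k n →ₗ[k] A) :
    (∀ h h' h'' : EAlg k n, BA (TensorProduct.map (LinearMap.mulRight k h')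
      (LinearMap.mulRight k h'') (Coalgebra.comul (R := k) h)) =
        Coalgebra.counit (R := k) h • BA (h' ⊗ₜ h'')) ↔
    ∀ h h', BA (h ⊗ₜ h') = BA (1 ⊗ₜ (HopfAlgebra.antipode k h * h')) := by
  refine ⟨fun h => HopfCowreath.apply_tmul_eq_antipode h, fun hB h h' h'' => ?_⟩
  have key : ∀ c : EAlg k n ⊗[k] EAlg k n, BA (TensorProduct.map (LinearMap.mulRight k h')
      (LinearMap.mulRight k h'') c) = BA (1 ⊗ₜ (antipodeLin h' *
        (LinearMap.mul' k _ ((HopfAlgebra.antipode k).rTensor _ c) * h''))) := by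
    intro c
    induction c using TensorProduct.induction_on with
    | zero => simp
    | add a b ha hb => simp only [map_add, ha, hb, add_mul, mul_add, TensorProduct.tmul_add]
    | tmul p q =>
    rw [TensorProduct.map_tmul, hB]
    simp [antipode_eq, mul_assoc]
  rw [key, HopfAlgebra.mul_antipode_rTensor_comul_apply, Algebra.algebraMap_eq_smul_one,
    smul_mul_assoc, one_mul, mul_smul_comm, TensorProduct.tmul_smul, map_smul, hB h' h'']
  rfl

theorem antipode_conditions_iff (BA : EAlg k n ⊗[k] EAlg k n →ₗ[k] A) :
    (∀ h h', BA (h ⊗ₜ h') = BA (1 ⊗ₜ (HopfAlgebra.antipode k h * h'))) ↔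
    ∀ (j l : Fin 2) (P Q : Finset (Fin n)), BA (gx k j P ⊗ₜ gx k l Q) =
      BA (1 ⊗ₜ (HopfAlgebra.antipode k (gx k j P) * gx k l Q)) := by
  refine ⟨fun h j l P Q => h _ _, fun h => ?_⟩
  have h1 : ∀ j P h', BA (gx k j P ⊗ₜ h') =
      BA (1 ⊗ₜ (HopfAlgebra.antipode k (gx k j P) * h')) := by
    intro j P
    have : BA ∘ₗ TensorProduct.mk k _ _ (gx k j P) = BA ∘ₗ TensorProduct.mk k _ _ 1 ∘ₗ
        LinearMap.mulLeft k (HopfAlgebra.antipode k (gx k j P)) :=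
      linearMap_ext_gx fun l Q => h j l P Q
    exact LinearMap.congr_fun this
  intro a b
  have : BA ∘ₗ (TensorProduct.mk k _ _).flip b = BA ∘ₗ TensorProduct.mk k _ _ 1 ∘ₗ
      LinearMap.mulRight k b ∘ₗ HopfAlgebra.antipode k :=
    linearMap_ext_gx fun j P => h1 j P b
  exact LinearMap.congr_fun this a

/-- Invariance, colinearity and balancing correspond respectively to the antipode formula, to the
rules for φ and d_P on t_{l,Q}, and to the commutation rule, which is balancing at h = 1, h' = g^l
x_Q and extends linearly. -/
theorem isRtCasimir_iff_rtConditions (hk : (2 : k) ≠ 0) {ρ : A →ₐ[k] A ⊗[k] EAlg k n}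
    {φ : A →ₐ[k] A} {d : Fin n → A →ₗ[k] A} (T : IsCoactionTuple ρ φ d)
    (BA : EAlg k n ⊗[k] EAlg k n →ₗ[k] A) : IsRtCasimir ρ BA ↔ RtConditions φ d BA := by
  constructor
  · intro h
    have hinv := (invariant_iff BA).1 h.invariant
    obtain ⟨h1, h2⟩ := (colinear_iff hk T (BA ∘ₗ TensorProduct.mk k _ _ 1)).1 h.colinear
    obtain ⟨h3, h4⟩ := (der_comm_iff d _).1 h2
    refine ⟨h.normalized, (antipode_conditions_iff BA).1 hinv, (phi_comm_iff φ _).1 h1, h3, h4,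
      fun l Q a => ?_⟩
    have h5 := h.balanced a 1 (gx k l Q)
    rw [balanced_eq_adjSum hinv, HopfAlgebra.antipode_one, one_mul, adjSum_gx_eq hk T] at h5
    exact h5.symm
  · intro h
    have hinv := (antipode_conditions_iff BA).2 h.antipode
    refine ⟨fun a x y => ?_, (colinear_iff hk T (BA ∘ₗ TensorProduct.mk k _ _ 1)).2
      ⟨(phi_comm_iff φ _).2 h.phi, (der_comm_iff d _).2 ⟨h.d_of_subset, h.d_of_not_subset⟩⟩,
      (invariant_iff BA).2 hinv, h.one⟩
    rw [balanced_eq_adjSum hinv, hinv x y]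
    refine adjSum_ext (fun l Q => ?_) _
    rw [adjSum_gx_eq hk T]
    exact (h.comm l Q a).symm

end Conditions

/-! ### Multiplicativity of t and the two additional equalities -/

section Heavy

variable {k : Type u} [Field k] {n : ℕ} {A : Type v} [Ring A] [Algebra k A]

open EAlg

theorem mul_comm_of_isRtCasimir {ρ : A →ₐ[k] A ⊗[k] EAlg k n}
    {BA : EAlg k n ⊗[k] EAlg k n →ₗ[k] A} (hB : IsRtCasimir ρ BA) (y : EAlg k n) (a : A) :
    BA (1 ⊗ₜ y) * a = adjSum ρ (BA ∘ₗ TensorProduct.mk k _ _ 1) y a := by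
  have h := hB.balanced a 1 y
  rw [balanced_eq_adjSum ((invariant_iff BA).1 hB.invariant), HopfAlgebra.antipode_one,
    one_mul] at h
  exact h.symm

/-- The rule t(y) t(z) = t(z₁) t(y ◁ z₂), obtained from balancing with a = t(z) and colinearity, for
z = g. -/
theorem mul_apply_g {ρ : A →ₐ[k] A ⊗[k] EAlg k n}
    {BA : EAlg k n ⊗[k] EAlg k n →ₗ[k] A} (hB : IsRtCasimir ρ BA) (y : EAlg k n) :
    BA (1 ⊗ₜ y) * BA (1 ⊗ₜ g k n) = BA (1 ⊗ₜ g k n) * BA (1 ⊗ₜ (g k n * y * g k n)) := by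
  rw [mul_comm_of_isRtCasimir hB, adjSum, hB.colinear, comul_eq, comulHom_g]
  simp [adj_g]

/-- The same rule for z = xᵢ, whose coproduct has two terms; t(1) = 1 removes the factor in the
second. -/
theorem mul_apply_x {ρ : A →ₐ[k] A ⊗[k] EAlg k n}
    {BA : EAlg k n ⊗[k] EAlg k n →ₗ[k] A} (hB : IsRtCasimir ρ BA) (y : EAlg k n) (i : Fin n) :
    BA (1 ⊗ₜ y) * BA (1 ⊗ₜ x k n i) = BA (1 ⊗ₜ x k n i) * BA (1 ⊗ₜ (g k n * y * g k n)) +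
      BA (1 ⊗ₜ (g k n * x k n i * y * g k n + y * x k n i)) := by
  rw [mul_comm_of_isRtCasimir hB, adjSum, hB.colinear, comul_eq, comulHom_x]
  simp [adj_g, adj_x, hB.normalized]

theorem rthConditions_of_isRthCasimir {ρ : A →ₐ[k] A ⊗[k] EAlg k n}
    {BA : EAlg k n ⊗[k] EAlg k n →ₗ[k] A} (hB : IsRthCasimir ρ BA) : RthConditions BA := by
  have hinv := (invariant_iff BA).1 hB.invariant
  have hmul : ∀ p q : EAlg k n, BA (1 ⊗ₜ p) * BA (1 ⊗ₜ q) = BA (1 ⊗ₜ (p * q)) := by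
    intro p q
    obtain ⟨r, rfl⟩ := antipode_surjective p
    rw [← hinv, ← hB.heavy r q, hinv r 1, mul_one]
  refine ⟨?_, fun P => ?_⟩
  · rw [sq, tElem, hmul, gx_one, xProd_empty, mul_one, g_mul_g, hB.normalized]
  · rw [tElem, tElem, tElem, hmul, gx_one, gx_one, gx_zero, xProd_empty, mul_one, g_mul_xProd,
      TensorProduct.tmul_smul, map_smul]

/-- The elements z with t(y) t(z) = t(y z) for all y form a subalgebra, so only z = g and z = xᵢ
matter. The extra equalities treat g; the commutation rules then force the case of xᵢ. -/
theorem apply_mul_of_rthConditions (hk : (2 : k) ≠ 0) {ρ : A →ₐ[k] A ⊗[k] EAlg k n}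
    {BA : EAlg k n ⊗[k] EAlg k n →ₗ[k] A} (hB : IsRtCasimir ρ BA) (h : RthConditions BA)
    (y z : EAlg k n) : BA (1 ⊗ₜ y) * BA (1 ⊗ₜ z) = BA (1 ⊗ₜ (y * z)) := by
  let t : EAlg k n →ₗ[k] A := BA ∘ₗ TensorProduct.mk k _ _ 1
  have ht : ∀ y, BA (1 ⊗ₜ y) = t y := fun _ => rfl
  have hsq : t (g k n) * t (g k n) = 1 := by
    have := h.sq
    rwa [sq, tElem, gx_one, xProd_empty, mul_one] at this
  have hone : ∀ P : Finset (Fin n), t (xProd k P) * t (g k n) = t (xProd k P * g k n) := by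
    intro P
    have h1 := h.t_one P
    rw [tElem, tElem, tElem, gx_one, gx_one, gx_zero, xProd_empty, mul_one, ht, ht, ht,
      g_mul_xProd, map_smul] at h1
    have h2 := congrArg (fun a => (-1 : k) ^ P.card • a) h1
    simpa only [smul_smul, neg_one_pow_mul_self, one_smul] using h2.symm
  have hright : ∀ y, t y * t (g k n) = t (y * g k n) := by
    have : LinearMap.mulRight k (t (g k n)) ∘ₗ t = t ∘ₗ LinearMap.mulRight k (g k n) := by
      refine linearMap_ext_gx fun l P => ?_
      simp only [LinearMap.comp_apply, LinearMap.mulRight_apply]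
      fin_cases l
      · simpa [gx_zero] using hone P
      · simp only [Fin.mk_one, gx_one]
        rw [g_mul_xProd_mul_g, g_mul_xProd, map_smul, map_smul, ← hone, smul_mul_assoc, mul_assoc,
          hsq, mul_one]
    exact LinearMap.congr_fun this
  -- The commutation rule for g, applied to g y g, converts right multiplicativity into left
  -- multiplicativity.
  have hleft : ∀ y, t (g k n) * t y = t (g k n * y) := by
    intro y
    have h1 := mul_apply_g hB (g k n * y * g k n)
    simp only [ht] at h1
    rw [hright, mul_assoc (g k n * y), g_mul_g, mul_one, ← mul_assoc, ← mul_assoc, g_mul_g,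
      one_mul, mul_assoc, g_mul_g, mul_one] at h1
    exact h1.symm
  have hx : ∀ i y, t y * t (x k n i) = t (y * x k n i) := by
    intro i
    have hP : ∀ P : Finset (Fin n), t (xProd k P) * t (x k n i) = t (xProd k P * x k n i) := by
      intro P
      have h1 := mul_apply_x hB (xProd k P) i
      have h2 := mul_apply_x hB (gx k 1 P) i
      have h3 := g_mul_x_mul_gx_mul_g (k := k) 0 P i
      have h4 := g_mul_x_mul_gx_mul_g (k := k) 1 P i
      have h5 := g_mul_gx_mul_g (k := k) 0 P
      have h6 := g_mul_gx_mul_g (k := k) 1 P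
      simp only [gx_zero, gx_one, Fin.val_zero, Fin.val_one, zero_add, pow_one, neg_smul,
        one_smul] at h3 h4 h5 h6
      simp only [gx_one, ht] at h1 h2
      rw [h3, neg_add_cancel, map_zero, add_zero, h5, map_smul, mul_smul_comm] at h1
      -- For y = x_P the adjoint term vanishes, giving t(x_P) t(xᵢ) = (-1)^{|P|} t(xᵢ) t(x_P). For y
      -- = g x_P it doubles, giving t(g x_P) t(xᵢ) = (-1)^{|P|} t(xᵢ) t(g x_P) + 2 t(g x_P xᵢ).
      -- Moving g to the front changes the sign of the first summand, so it equals -t(g) t(x_P)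
      -- t(xᵢ).
      have h7 : t (x k n i) * t (g k n * xProd k P) =
          -(t (g k n) * (t (x k n i) * t (xProd k P))) := by
        rw [← hleft, ← mul_assoc, hright, ← mul_assoc, hleft, g_mul_x, map_neg, neg_mul, neg_neg]
      rw [h4, h6, map_smul, mul_smul_comm, h7, smul_neg, ← mul_smul_comm, ← h1, ← hleft,
        one_add_one_eq_two, neg_one_sq, one_smul, ← two_smul k, map_smul, mul_assoc (g k n),
        ← hleft, mul_assoc] at h2
      have h8 : (2 : k) • (t (g k n) * (t (xProd k P) * t (x k n i))) =
          (2 : k) • (t (g k n) * t (xProd k P * x k n i)) := by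
        rw [two_smul]
        nth_rewrite 1 [h2]
        abel
      -- Cancel 2, which is invertible, and t(g), whose square is 1.
      have h9 := congrArg (fun a => t (g k n) * ((2 : k)⁻¹ • a)) h8
      simpa only [smul_smul, inv_mul_cancel₀ hk, one_smul, ← mul_assoc, hsq, one_mul] using h9
    have : LinearMap.mulRight k (t (x k n i)) ∘ₗ t = t ∘ₗ LinearMap.mulRight k (x k n i) := by
      refine linearMap_ext_gx fun l P => ?_
      simp only [LinearMap.comp_apply, LinearMap.mulRight_apply]
      fin_cases l
      · simpa [gx_zero] using hP P
      · simp only [Fin.mk_one, gx_one]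
        rw [← hleft, mul_assoc, hP, hleft, mul_assoc]
    exact LinearMap.congr_fun this
  rw [ht, ht, ht]
  induction z using EAlg.induction generalizing y with
  | hr r =>
    have h1 : t 1 = 1 := hB.normalized
    rw [Algebra.algebraMap_eq_smul_one, map_smul, h1, mul_smul_comm, mul_smul_comm, map_smul,
      mul_one, mul_one]
  | hg => exact hright y
  | hx i => exact hx i y
  | hmul a b ha hb => rw [← mul_assoc y, ← hb (y * a), ← ha y, mul_assoc, hb a]
  | hadd a b ha hb => rw [map_add, mul_add, mul_add, map_add, ha, hb]

theorem isRthCasimir_iff_rthConditions (hk : (2 : k) ≠ 0) {ρ : A →ₐ[k] A ⊗[k] EAlg k n}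
    {φ : A →ₐ[k] A} {d : Fin n → A →ₗ[k] A} (T : IsCoactionTuple ρ φ d)
    (BA : EAlg k n ⊗[k] EAlg k n →ₗ[k] A) :
    IsRthCasimir ρ BA ↔ RtConditions φ d BA ∧ RthConditions BA := by
  rw [← isRtCasimir_iff_rtConditions hk T]
  refine ⟨fun h => ⟨h.toIsRtCasimir, rthConditions_of_isRthCasimir h⟩,
    fun h => ⟨h.1, fun x y => ?_⟩⟩
  have hinv := (invariant_iff BA).1 h.1.invariant
  rw [hinv x 1, hinv x y, mul_one, apply_mul_of_rthConditions hk h.1 h.2]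

end Heavy

end

/-! ### The main theorem -/

theorem theorem3 {k : Type u} [Field k] (hk : ringChar k ≠ 2) (n : ℕ)
    {A : Type v} [Ring A] [Algebra k A] [FiniteDimensional k A]
    (ρ : A →ₐ[k] A ⊗[k] EAlg k n) (hρ : IsComoduleAlgebra ρ) :
    (∃ (φ : A →ₐ[k] A) (d : Fin n → A →ₗ[k] A), IsCoactionTuple ρ φ d) ∧
    ∀ (φ : A →ₐ[k] A) (d : Fin n → A →ₗ[k] A), IsCoactionTuple ρ φ d →
      (IsRtSeparable ρ hρ ↔
        ∃ BA : EAlg k n ⊗[k] EAlg k n →ₗ[k] A, RtConditions φ d BA) ∧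
      (IsRthSeparable ρ hρ ↔
        ∃ BA : EAlg k n ⊗[k] EAlg k n →ₗ[k] A, RtConditions φ d BA ∧ RthConditions BA) ∧
      ∀ BA : EAlg k n ⊗[k] EAlg k n →ₗ[k] A,
        [(hopfCowreath ρ hρ).IsSeparableVia (rightTrivial BA),
          IsRtCasimir ρ BA,
          RtConditions φ d BA].TFAE ∧
        [(hopfCowreath ρ hρ).IsHSeparableVia (rightTrivial BA),
          IsRthCasimir ρ BA,
          RtConditions φ d BA ∧ RthConditions BA].TFAE := by
  have hk2 : (2 : k) ≠ 0 := Ring.two_ne_zero hk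
  refine ⟨⟨_, _, isCoactionTuple_coact hk2 hρ⟩, fun φ d T => ?_⟩
  have h1 := HopfCowreath.isSeparableVia_iff_isRtCasimir hρ
  have h2 := isRtCasimir_iff_rtConditions hk2 T
  have h3 := HopfCowreath.isHSeparableVia_iff_isRthCasimir hρ EAlg.antipode_surjective
  have h4 := isRthCasimir_iff_rthConditions hk2 T
  refine ⟨exists_congr fun BA => (h1 BA).trans (h2 BA),
    exists_congr fun BA => (h3 BA).trans (h4 BA), fun BA => ⟨?_, ?_⟩⟩
  · tfae_have 1 ↔ 2 := h1 BA
    tfae_have 2 ↔ 3 := h2 BA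
    tfae_finish
  · tfae_have 1 ↔ 2 := h3 BA
    tfae_have 2 ↔ 3 := h4 BA
    tfae_finish
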